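/- **Conventions.** A (progressive) planar graph is a finite directed acyclic graph, in which edges may lack a source (then they are inputs of the graph) or a target (then they are outputs) or both (virtual edges), in which every vertex has at least one incoming and at least one outgoing edge, together with a planar order: a linear order $\prec$ on the edges such that (i) if there is a directed path from $e$ to $e'$ (written $e\to e'$) then $e\prec e'$, and (ii) if $e\prec e'\prec e''$ and $e\to e''$ then $e\to e'$ or $e'\to e''$. Inputs and outputs of the graph and of each vertex are ordered by $\prec$. Planar graphs can be tensored (juxtaposed) and composed (the $k$-th output of the first is glued to the $k$-th input of the second). A planar graph is prime if it has exactly one vertex and no virtual edge. $\mathbf{Str.T}$ is the category of small strict tensor categories and strict tensor functors. A tensor scheme $\mathcal D$ consists of sets $Ob(\mathcal D)$, $Mor(\mathcal D)$ and maps $s,t:Mor(\mathcal D)\to W(Ob(\mathcal D))$, where $W$ denotes words; $\mathbf{T.Sch}$ is the category of tensor schemes. $\mathbf{T.Sch}_{p}\subset\mathbf{T.Sch}$ is the full subcategory of those $\mathcal D$ for which $s(f)$ and $t(f)$ are nonempty words for every $f\in Mor(\mathcal D)$. A diagram in a tensor scheme (in a strict tensor category) is an isomorphism class of planar graphs whose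 edges are decorated by objects and whose vertices are decorated by morphisms from the word (the tensor product) of the inputs of the vertex to the word (the tensor product) of its outputs. Its domain and codomain are the words of its inputs and of its outputs. A fissus diagram is a diagram together with a decomposition of its ordered list of inputs, and of its ordered list of outputs, into a nonempty sequence of consecutive, possibly empty, blocks; its domain and codomain are words of words. Let $F:\mathbf{T.Sch}\to\mathbf{Str.T}$ send $\mathcal D$ to the strict tensor category with objects $W(Ob(\mathcal D))$ and morphisms the diagrams in $\mathcal D$; let $\mathbf\Gamma^{\otimes}:\mathbf{Str.T}\to\mathbf{Str.T}$ send $\mathcal V$ to the strict tensor category with objects $W(Ob(\mathcal V))$ and morphisms the diagrams in $\mathcal V$; let $U:\mathbf{Str.T}\to\mathbf{T.Sch}$ send $\mathcal V$ to the tensor scheme with objects $Ob(\mathcal V)$ and morphisms the prime diagrams in $\mathcal V$, with domain and codomain as source and target; let $\mathbf\Gamma_F:\mathbf{T.Sch}\to\mathbf{T.Sch}$ send $\mathcal D$ to the tensor scheme with objects $W(Ob(\mathcal D))$ and morphisms the fissus diagrams in $\mathcal D$. The functor $U$ takes its values in $\mathbf{T.Sch}_p$. An evaluation map of $\mathcal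 V\in\mathbf{Str.T}$ sends every diagram in $\mathcal V$ to a morphism of $\mathcal V$ from the tensor product of its domain to the tensor product of its codomain, preserves composition and tensor product, and sends the empty diagram to the identity of the unit object, the diagram with a single virtual edge decorated by $x$ to $\mathrm{id}_x$, and a prime diagram to the decoration of its vertex. **Theorem.** Every $\mathcal V\in\mathbf{Str.T}$ has a unique evaluation map $\varepsilon_{\mathcal V}$. The functors $F:\mathbf{T.Sch}_p\to\mathbf{Str.T}$ and $U:\mathbf{Str.T}\to\mathbf{T.Sch}_p$ form an adjunction $F\dashv U$ whose unit $\eta_{\mathcal D}:\mathcal D\to UF(\mathcal D)$ sends $x\in Ob(\mathcal D)$ to the one-letter word $\langle x\rangle$ and $f:x_1\cdots x_m\to y_1\cdots y_n$ to the prime diagram in $F(\mathcal D)$ with legs $\langle x_1\rangle,\dots,\langle x_m\rangle$ and $\langle y_1\rangle,\dots,\langle y_n\rangle$ whose vertex is decorated by the prime diagram in $\mathcal D$ decorated by $f$. For this adjunction: 1. (First identification.) The underlying functor $FU$ of the comonad is naturally isomorphic to $\mathbf\Gamma^{\otimes}$, by an isomorphism that is the identity on objects and that, on a diagram in $U(\mathcal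 V)$, replaces the decoration of each vertex (a prime diagram in $\mathcal V$) by the decoration of the vertex of that prime diagram. 2. (Second identification.) There is a natural isomorphism $\widetilde\omega:UF\to\mathbf\Gamma_F$ of functors on $\mathbf{T.Sch}$ that is the identity on objects and that sends a prime diagram in $F(\mathcal D)$ with legs decorated by words $w_1,\dots,w_m$ and $w'_1,\dots,w'_n$ and vertex decorated by the diagram $\lambda$ in $\mathcal D$ to $\lambda$ with its domain bracketed as $(w_1)\cdots(w_m)$ and its codomain bracketed as $(w'_1)\cdots(w'_n)$. On $\mathbf{T.Sch}_p$ it identifies the monad $T=UF$ with $\mathbf\Gamma_F$. 3. Under the second identification, the multiplication $\mu_{\mathcal D}:TT(\mathcal D)\to T(\mathcal D)$ is the morphism $\mathbf\Gamma_F(\mathbf\Gamma_F(\mathcal D))\to\mathbf\Gamma_F(\mathcal D)$, $\ \widetilde\omega_{\mathcal D}\circ\mu_{\mathcal D}=(\text{that morphism})\circ\mathbf\Gamma_F(\widetilde\omega_{\mathcal D})\circ\widetilde\omega_{UF(\mathcal D)}$, which concatenates words of words on objects, and which sends a fissus compound fissus diagram $x$ in $\mathcal D$ to the value of $x$ (its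 components, which are diagrams in $\mathcal D$, are tensored and composed in $F(\mathcal D)$ as the diagram $x$ prescribes), equipped with the fission structure obtained by composing the two layers of brackets: the words decorating the legs of $x$, grouped by the fission structure of $x$, are concatenated within each group. The same formula holds for $\mu_{\mathcal D}=U(\epsilon_{F(\mathcal D)})$, $\epsilon$ the counit of the adjunction, for every tensor scheme $\mathcal D$. -/

import Mathlib

open CategoryTheory

universe u

namespace TensorCalculus

/-! ## Progressive planar graphs -/

/-- Two consecutive edges: the target of `x` is the source of `y`. -/
def Step {E V : Type} (src tgt : E → Option V) (x y : E) : Prop :=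
  ∃ v, tgt x = some v ∧ src y = some v

/-- There is a directed path starting with the edge `x` and ending with the edge `y ≠ x`
(in an acyclic graph). -/
def Reach {E V : Type} (src tgt : E → Option V) : E → E → Prop :=
  Relation.TransGen (Step src tgt)

/-- A progressive planar graph with set of edges `E` and set of (real) vertices `V`.
An edge with `src e = none` is an input of the graph, an edge with `tgt e = none` is an output;
an edge with both ends missing is a virtual edge (a unitary component).
The order `lt` is the planar structure.  The lists `vin v`, `vout v`, `ins`, `outs` are the
increasing enumerations of the inputs and outputs of the vertex `v` and of the graph; they are
determined by `src`, `tgt` and `lt`. -/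
structure PlanarGraph (E V : Type) where
  src : E → Option V
  tgt : E → Option V
  lt : E → E → Prop
  vin : V → List E
  vout : V → List E
  ins : List E
  outs : List E
  lt_irrefl : ∀ x, ¬ lt x x
  lt_trans : ∀ x y z, lt x y → lt y z → lt x z
  lt_total : ∀ x y, lt x y ∨ x = y ∨ lt y x
  /-- the planar structure extends the order given by directed paths -/
  planar₁ : ∀ x y, Reach src tgt x y → lt x y
  planar₂ : ∀ x y z, Reach src tgt x z → lt x y → lt y z →
    Reach src tgt y z ∨ Reach src tgt x y
  vin_sorted : ∀ v, (vin v).Pairwise lt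
  vout_sorted : ∀ v, (vout v).Pairwise lt
  ins_sorted : ins.Pairwise lt
  outs_sorted : outs.Pairwise lt
  mem_vin : ∀ v x, x ∈ vin v ↔ tgt x = some v
  mem_vout : ∀ v x, x ∈ vout v ↔ src x = some v
  mem_ins : ∀ x, x ∈ ins ↔ src x = none
  mem_outs : ∀ x, x ∈ outs ↔ tgt x = none
  /-- the graph is directed: every vertex has at least one input and at least one output -/
  vin_ne_nil : ∀ v, vin v ≠ []
  vout_ne_nil : ∀ v, vout v ≠ []

namespace PlanarGraph

variable {E V E' V' : Type}

/-- A planar graph is prime when it is a corolla: one real vertex and no virtual edge. -/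
def IsPrime (G : PlanarGraph E V) : Prop :=
  (∃ v : V, ∀ w : V, w = v) ∧ ∀ e, G.src e ≠ none ∨ G.tgt e ≠ none

theorem wf (G : PlanarGraph E V) [Finite E] : WellFounded G.lt := by
  have : IsTrans E G.lt := ⟨G.lt_trans⟩
  have : Std.Irrefl G.lt := ⟨G.lt_irrefl⟩
  exact Finite.wellFounded_of_trans_of_irrefl _

theorem wf' (G : PlanarGraph E V) [Finite E] : WellFounded (fun x y => G.lt y x) := by
  have : IsTrans E (fun x y => G.lt y x) := ⟨fun _ _ _ h1 h2 => G.lt_trans _ _ _ h2 h1⟩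
  have : Std.Irrefl (fun x y => G.lt y x) := ⟨G.lt_irrefl⟩
  exact Finite.wellFounded_of_trans_of_irrefl _

theorem lt_asymm (G : PlanarGraph E V) {x y : E} (h : G.lt x y) (h' : G.lt y x) : False :=
  G.lt_irrefl _ (G.lt_trans _ _ _ h h')

theorem nodup_of_sorted (G : PlanarGraph E V) {l : List E} (h : l.Pairwise G.lt) : l.Nodup :=
  h.imp (fun {a b} hab (e : a = b) => G.lt_irrefl a (by rw [← e] at hab; exact hab))

theorem pairwise_cases {α : Type} {R : α → α → Prop} {l : List α} (h : l.Pairwise R) {x y : α}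
    (hx : x ∈ l) (hy : y ∈ l) : x = y ∨ R x y ∨ R y x := by
  induction h with
  | nil => cases hx
  | cons h1 _ ih =>
    rcases List.mem_cons.1 hx with ex | hx' <;> rcases List.mem_cons.1 hy with ey | hy'
    · exact Or.inl (ex.trans ey.symm)
    · subst ex; exact Or.inr (Or.inl (h1 _ hy'))
    · subst ey; exact Or.inr (Or.inr (h1 _ hx'))
    · exact ih hx' hy'

/-- A map of edges and a bijection of vertices respecting all the ordered lists of inputs and
outputs. -/
structure Compat (G : PlanarGraph E V) (H : PlanarGraph E' V') (f : E → E') (g : V ≃ V') :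
    Prop where
  ins : G.ins.map f = H.ins
  outs : G.outs.map f = H.outs
  vin : ∀ v, (G.vin v).map f = H.vin (g v)
  vout : ∀ v, (G.vout v).map f = H.vout (g v)

namespace Compat

variable {G : PlanarGraph E V} {H : PlanarGraph E' V'} {f : E → E'} {g : V ≃ V'}

theorem src_eq (h : Compat G H f g) (x : E) : H.src (f x) = (G.src x).map g := by
  cases hx : G.src x with
  | none =>
    rw [Option.map_none, ← H.mem_ins, ← h.ins]
    exact List.mem_map_of_mem ((G.mem_ins x).2 hx)
  | some v =>
    rw [Option.map_some, ← H.mem_vout, ← h.vout]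
    exact List.mem_map_of_mem ((G.mem_vout v x).2 hx)

theorem tgt_eq (h : Compat G H f g) (x : E) : H.tgt (f x) = (G.tgt x).map g := by
  cases hx : G.tgt x with
  | none =>
    rw [Option.map_none, ← H.mem_outs, ← h.outs]
    exact List.mem_map_of_mem ((G.mem_outs x).2 hx)
  | some v =>
    rw [Option.map_some, ← H.mem_vin, ← h.vin]
    exact List.mem_map_of_mem ((G.mem_vin v x).2 hx)

theorem injective (h : Compat G H f g) : Function.Injective f := by
  intro x y hxy
  have hs : G.src x = G.src y := by
    have := h.src_eq x
    rw [hxy, h.src_eq y] at this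
    exact (Option.map_injective g.injective this).symm
  cases hx : G.src x with
  | none =>
    refine List.inj_on_of_nodup_map (f := f) (l := G.ins) ?_ ((G.mem_ins x).2 hx)
      ((G.mem_ins y).2 (hs ▸ hx)) hxy
    rw [h.ins]; exact H.nodup_of_sorted H.ins_sorted
  | some v =>
    refine List.inj_on_of_nodup_map (f := f) (l := G.vout v) ?_ ((G.mem_vout v x).2 hx)
      ((G.mem_vout v y).2 (hs ▸ hx)) hxy
    rw [h.vout]; exact H.nodup_of_sorted (H.vout_sorted _)

theorem surjective (h : Compat G H f g) : Function.Surjective f := by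
  intro y
  cases hy : H.src y with
  | none =>
    have := (H.mem_ins y).2 hy
    rw [← h.ins] at this
    obtain ⟨x, -, hx⟩ := List.mem_map.1 this
    exact ⟨x, hx⟩
  | some v =>
    have := (H.mem_vout v y).2 hy
    rw [← g.apply_symm_apply v, ← h.vout] at this
    obtain ⟨x, -, hx⟩ := List.mem_map.1 this
    exact ⟨x, hx⟩

theorem step_iff (h : Compat G H f g) (x y : E) :
    Step H.src H.tgt (f x) (f y) ↔ Step G.src G.tgt x y := by
  constructor
  · rintro ⟨v, h1, h2⟩
    rw [h.tgt_eq] at h1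
    rw [h.src_eq] at h2
    obtain ⟨w, hw, rfl⟩ := Option.map_eq_some_iff.1 h1
    obtain ⟨w', hw', e⟩ := Option.map_eq_some_iff.1 h2
    exact ⟨w, hw, by rw [hw', g.injective e]⟩
  · rintro ⟨v, h1, h2⟩
    exact ⟨g v, by rw [h.tgt_eq, h1]; rfl, by rw [h.src_eq, h2]; rfl⟩

theorem reach (h : Compat G H f g) {x y : E} (hr : Reach G.src G.tgt x y) :
    Reach H.src H.tgt (f x) (f y) :=
  Relation.TransGen.lift f (fun a b hab => (h.step_iff a b).2 hab) _ _ hr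

theorem reach_reflect (h : Compat G H f g) {x y : E}
    (hr : Reach H.src H.tgt (f x) (f y)) : Reach G.src G.tgt x y := by
  generalize hz : f y = z at hr
  induction hr generalizing y with
  | single hs => subst hz; exact Relation.TransGen.single ((h.step_iff _ _).1 hs)
  | @tail b c _ hs ih =>
    obtain ⟨w, rfl⟩ := h.surjective b
    subst hz
    exact Relation.TransGen.tail (ih rfl) ((h.step_iff _ _).1 hs)

theorem local_lt {l : List E} (h1 : l.Pairwise G.lt) (h2 : (l.map f).Pairwise H.lt) {x y : E}
    (hx : x ∈ l) (hy : y ∈ l) (hxy : G.lt x y) : H.lt (f x) (f y) := by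
  rw [List.pairwise_map] at h2
  rcases pairwise_cases (h1.and h2) hx hy with rfl | h | h
  · exact (G.lt_irrefl _ hxy).elim
  · exact h.2
  · exact (G.lt_asymm hxy h.1).elim

/-- The planar structure is determined by the graph and the local orders. -/
theorem lt (h : Compat G H f g) [Finite E] {a b : E} (hab : G.lt a b) :
    H.lt (f a) (f b) := by
  revert b
  induction a using G.wf.induction with | _ a IH1 =>
  intro b
  induction b using G.wf.induction with | _ b IH2 =>
  intro hab
  by_cases hr : Reach G.src G.tgt a b
  · exact H.planar₁ _ _ (h.reach hr)
  by_contra hcon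
  have hba : H.lt (f b) (f a) := by
    rcases H.lt_total (f a) (f b) with h1 | h1 | h1
    · exact (hcon h1).elim
    · rw [h.injective h1] at hab; exact (G.lt_irrefl _ hab).elim
    · exact h1
  have hbp : ∀ b', Step G.src G.tgt b' b → Reach G.src G.tgt b' a := by
    intro b' hs
    have hs' : Reach G.src G.tgt b' b := Relation.TransGen.single hs
    by_contra hn
    rcases G.lt_total a b' with h1 | h1 | h1
    · have h2 := IH2 b' (G.planar₁ _ _ hs') h1
      exact H.lt_asymm (H.lt_trans _ _ _ h2 (H.planar₁ _ _ (h.reach hs'))) hba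
    · subst h1; exact hr hs'
    · rcases G.planar₂ _ _ _ hs' h1 hab with h2 | h2
      · exact hr h2
      · exact hn h2
  have hap : ∀ a', Step G.src G.tgt a' a → Reach G.src G.tgt a' b := by
    intro a' hs
    have hs' : Reach G.src G.tgt a' a := Relation.TransGen.single hs
    by_contra hn
    have h1 := IH1 a' (G.planar₁ _ _ hs') (G.lt_trans _ _ _ (G.planar₁ _ _ hs') hab)
    rcases H.planar₂ _ _ _ (h.reach hs') h1 hba with h2 | h2
    · exact G.lt_asymm hab (G.planar₁ _ _ (h.reach_reflect h2))
    · exact hn (h.reach_reflect h2)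
  cases hb : G.src b with
  | none =>
    cases ha : G.src a with
    | none =>
      exact H.lt_asymm hba (local_lt G.ins_sorted (h.ins ▸ H.ins_sorted) ((G.mem_ins a).2 ha)
        ((G.mem_ins b).2 hb) hab)
    | some w =>
      obtain ⟨a', ha'⟩ := List.exists_mem_of_ne_nil _ (G.vin_ne_nil w)
      have := hap a' ⟨w, (G.mem_vin w a').1 ha', ha⟩
      obtain ⟨c, -, v, -, hv⟩ := Relation.TransGen.tail'_iff.1 this
      rw [hb] at hv; cases hv
  | some v =>
    obtain ⟨b', hb'⟩ := List.exists_mem_of_ne_nil _ (G.vin_ne_nil v)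
    rw [G.mem_vin] at hb'
    obtain ⟨a', h1, w, h2, h3⟩ := Relation.TransGen.tail'_iff.1 (hbp b' ⟨v, hb', hb⟩)
    by_cases hvw : w = v
    · subst hvw
      exact H.lt_asymm hba (local_lt (G.vout_sorted w) (h.vout w ▸ H.vout_sorted _)
        ((G.mem_vout w a).2 h3) ((G.mem_vout w b).2 hb) hab)
    · have h4 : Reach G.src G.tgt b' a' := by
        rcases Relation.reflTransGen_iff_eq_or_transGen.1 h1 with h4 | h4
        · subst h4; rw [hb'] at h2; cases h2; exact (hvw rfl).elim
        · exact h4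
      obtain ⟨b'', h5, w', h6, h7⟩ := Relation.TransGen.tail'_iff.1 (hap a' ⟨w, h2, h3⟩)
      rw [hb] at h7; cases h7
      obtain ⟨c, ⟨w', h8, h9⟩, h10⟩ :=
        Relation.TransGen.head'_iff.1 (Relation.TransGen.trans_left h4 h5)
      rw [hb'] at h8; cases h8
      exact G.lt_irrefl _ (G.planar₁ _ _ (Relation.TransGen.head' ⟨v, h6, h9⟩ h10))

theorem lt_iff (h : Compat G H f g) [Finite E] {a b : E} : H.lt (f a) (f b) ↔ G.lt a b := by
  refine ⟨fun hab => ?_, h.lt⟩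
  rcases G.lt_total a b with h1 | h1 | h1
  · exact h1
  · subst h1; exact (H.lt_irrefl _ hab).elim
  · exact (H.lt_asymm hab (h.lt h1)).elim

end Compat

end PlanarGraph

namespace PlanarGraph

variable {E V E' V' : Type}

theorem planar₁_of_step {E V : Type} {src tgt : E → Option V} {lt : E → E → Prop}
    (ht : ∀ x y z, lt x y → lt y z → lt x z) (hs : ∀ x y, Step src tgt x y → lt x y) :
    ∀ x y, Reach src tgt x y → lt x y := by
  intro x y h
  induction h with
  | single h => exact hs _ _ h
  | tail _ h ih => exact ht _ _ _ ih (hs _ _ h)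

theorem not_reach_of_src (G : PlanarGraph E V) {x y : E} (h : G.src y = none) :
    ¬ Reach G.src G.tgt x y := by
  intro hr
  obtain ⟨c, -, v, -, hv⟩ := Relation.TransGen.tail'_iff.1 hr
  rw [h] at hv; cases hv

theorem not_reach_of_tgt (G : PlanarGraph E V) {x y : E} (h : G.tgt x = none) :
    ¬ Reach G.src G.tgt x y := by
  intro hr
  obtain ⟨c, ⟨v, hv, -⟩, -⟩ := Relation.TransGen.head'_iff.1 hr
  rw [h] at hv; cases hv

theorem exists_out (G : PlanarGraph E V) [Finite E] (w : E) :
    ∃ o, G.tgt o = none ∧ (w = o ∨ Reach G.src G.tgt w o) := by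
  induction w using G.wf'.induction with | _ w IH =>
  cases hw : G.tgt w with
  | none => exact ⟨w, hw, Or.inl rfl⟩
  | some v =>
    obtain ⟨c, hc⟩ := List.exists_mem_of_ne_nil _ (G.vout_ne_nil v)
    have hs : Step G.src G.tgt w c := ⟨v, hw, (G.mem_vout v c).1 hc⟩
    obtain ⟨o, ho, hr⟩ := IH c (G.planar₁ _ _ (.single hs))
    refine ⟨o, ho, Or.inr ?_⟩
    rcases hr with rfl | hr
    · exact .single hs
    · exact .head hs hr

theorem exists_in (G : PlanarGraph E V) [Finite E] (w : E) :
    ∃ i, G.src i = none ∧ (i = w ∨ Reach G.src G.tgt i w) := by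
  induction w using G.wf.induction with | _ w IH =>
  cases hw : G.src w with
  | none => exact ⟨w, hw, Or.inl rfl⟩
  | some v =>
    obtain ⟨c, hc⟩ := List.exists_mem_of_ne_nil _ (G.vin_ne_nil v)
    have hs : Step G.src G.tgt c w := ⟨v, (G.mem_vin v c).1 hc, hw⟩
    obtain ⟨o, ho, hr⟩ := IH c (G.planar₁ _ _ (.single hs))
    refine ⟨o, ho, Or.inr ?_⟩
    rcases hr with rfl | hr
    · exact .single hs
    · exact .tail hr hs

theorem exists_next_out (G : PlanarGraph E V) [Finite E] (w : E) :
    ∃ o, G.tgt o = none ∧ (w = o ∨ Reach G.src G.tgt w o) ∧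
      ∀ o', G.tgt o' = none → (w = o' ∨ G.lt w o') → (o = o' ∨ G.lt o o') := by
  obtain ⟨o₁, h1, h2⟩ := G.exists_out w
  rcases h2 with rfl | h2
  · exact ⟨w, h1, Or.inl rfl, fun o' _ h => h⟩
  obtain ⟨o, ⟨ho, ho'⟩, hmin⟩ := G.wf.has_min {o | G.tgt o = none ∧ (w = o ∨ G.lt w o)}
    ⟨o₁, h1, Or.inr (G.planar₁ _ _ h2)⟩
  refine ⟨o, ho, ?_, fun o' h3 h4 => ?_⟩
  · rcases ho' with h | h
    · exact Or.inl h
    · refine Or.inr ?_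
      rcases G.lt_total o o₁ with h5 | h5 | h5
      · rcases G.planar₂ _ _ _ h2 h h5 with h6 | h6
        · exact (G.not_reach_of_tgt ho h6).elim
        · exact h6
      · exact h5 ▸ h2
      · exact (hmin o₁ ⟨h1, Or.inr (G.planar₁ _ _ h2)⟩ h5).elim
  · rcases G.lt_total o o' with h5 | h5 | h5
    · exact Or.inr h5
    · exact Or.inl h5
    · exact (hmin o' ⟨h3, h4⟩ h5).elim

theorem exists_prev_in (G : PlanarGraph E V) [Finite E] (w : E) :
    ∃ i, G.src i = none ∧ (i = w ∨ Reach G.src G.tgt i w) ∧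
      ∀ i', G.src i' = none → (i' = w ∨ G.lt i' w) → (i' = i ∨ G.lt i' i) := by
  obtain ⟨o₁, h1, h2⟩ := G.exists_in w
  rcases h2 with rfl | h2
  · exact ⟨o₁, h1, Or.inl rfl, fun o' _ h => h⟩
  obtain ⟨o, ⟨ho, ho'⟩, hmin⟩ := G.wf'.has_min {o | G.src o = none ∧ (o = w ∨ G.lt o w)}
    ⟨o₁, h1, Or.inr (G.planar₁ _ _ h2)⟩
  refine ⟨o, ho, ?_, fun o' h3 h4 => ?_⟩
  · rcases ho' with h | h
    · exact Or.inl h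
    · refine Or.inr ?_
      rcases G.lt_total o₁ o with h5 | h5 | h5
      · rcases G.planar₂ _ _ _ h2 h5 h with h6 | h6
        · exact h6
        · exact (G.not_reach_of_src ho h6).elim
      · exact h5 ▸ h2
      · exact (hmin o₁ ⟨h1, Or.inr (G.planar₁ _ _ h2)⟩ h5).elim
  · rcases G.lt_total o' o with h5 | h5 | h5
    · exact Or.inr h5
    · exact Or.inl h5
    · exact (hmin o' ⟨h3, h4⟩ h5).elim

/-- The `k`-th output `x` of `G` is matched with the `k`-th input `y` of `H`. -/
def Matched (G : PlanarGraph E V) (H : PlanarGraph E' V') (x : E) (y : E') : Prop :=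
  (x, y) ∈ List.zip G.outs H.ins

/-- The edges of the composition `H ∘ G`: the edges of `G` that are not outputs, the new edges
obtained by grafting the `k`-th output of `G` to the `k`-th input of `H`, and the edges of `H`
that are not inputs. -/
inductive Glue (G : PlanarGraph E V) (H : PlanarGraph E' V') : Type
  | left (x : E) (h : G.tgt x ≠ none) : Glue G H
  | mid (x : E) (y : E') (h : Matched G H x y) : Glue G H
  | right (y : E') (h : H.src y ≠ none) : Glue G H

namespace Glue

variable {G : PlanarGraph E V} {H : PlanarGraph E' V'}

/-- Source of an edge of the composition. -/
def src : Glue G H → Option (V ⊕ V')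
  | left x _ => (G.src x).map Sum.inl
  | mid x _ _ => (G.src x).map Sum.inl
  | right y _ => (H.src y).map Sum.inr

/-- Target of an edge of the composition. -/
def tgt : Glue G H → Option (V ⊕ V')
  | left x _ => (G.tgt x).map Sum.inl
  | mid _ y _ => (H.tgt y).map Sum.inr
  | right y _ => (H.tgt y).map Sum.inr

/-- The planar structure of the composition: an old edge `x` of `G` precedes an old edge `y`
of `H` exactly when some new edge lies between them. -/
def lt : Glue G H → Glue G H → Prop
  | left x _, left x' _ => G.lt x x'
  | left x _, mid x' _ _ => G.lt x x'
  | left x _, right y' _ => ∃ o i, Matched G H o i ∧ G.lt x o ∧ H.lt i y'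
  | mid x _ _, left x' _ => G.lt x x'
  | mid x _ _, mid x' _ _ => G.lt x x'
  | mid _ y _, right y' _ => H.lt y y'
  | right y _, left x' _ => ¬ ∃ o i, Matched G H o i ∧ G.lt x' o ∧ H.lt i y
  | right y _, mid _ y' _ => H.lt y y'
  | right y _, right y' _ => H.lt y y'

/-- A map out of the set of edges of a composition. -/
def elim {X : Type*} (f : E → X) (g : E' → X) : Glue G H → X
  | left x _ => f x
  | mid x _ _ => f x
  | right y _ => g y

end Glue

section matched

variable {G : PlanarGraph E V} {H : PlanarGraph E' V'}

theorem Matched.tgt {x : E} {y : E'} (h : Matched G H x y) : G.tgt x = none :=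
  (G.mem_outs x).1 (List.of_mem_zip h).1

theorem Matched.src {x : E} {y : E'} (h : Matched G H x y) : H.src y = none :=
  (H.mem_ins y).1 (List.of_mem_zip h).2

theorem zip_pairwise (hl : G.outs.length = H.ins.length) : (List.zip G.outs H.ins).Pairwise
    (fun p q => G.lt p.1 q.1 ∧ H.lt p.2 q.2) := by
  have h1 : ((List.zip G.outs H.ins).map Prod.fst).Pairwise G.lt := by
    rw [List.map_fst_zip hl.le]; exact G.outs_sorted
  have h2 : ((List.zip G.outs H.ins).map Prod.snd).Pairwise H.lt := by
    rw [List.map_snd_zip hl.ge]; exact H.ins_sorted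
  rw [List.pairwise_map] at h1 h2
  exact h1.and h2

theorem matched_cases (hl : G.outs.length = H.ins.length) {x x' : E} {y y' : E'} (h : Matched G H x y) (h' : Matched G H x' y') :
    (x = x' ∧ y = y') ∨ (G.lt x x' ∧ H.lt y y') ∨ (G.lt x' x ∧ H.lt y' y) := by
  rcases pairwise_cases (zip_pairwise hl) h h' with h1 | h1 | h1
  · exact Or.inl (Prod.mk.inj h1)
  · exact Or.inr (Or.inl h1)
  · exact Or.inr (Or.inr h1)

theorem matched_lt (hl : G.outs.length = H.ins.length) {x x' : E} {y y' : E'} (h : Matched G H x y) (h' : Matched G H x' y') :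
    G.lt x x' ↔ H.lt y y' := by
  have := matched_cases hl h h'
  have := G.lt_irrefl
  have := H.lt_irrefl
  have := fun h h' => G.lt_asymm (x := x) (y := x') h h'
  have := fun h h' => H.lt_asymm (x := y) (y := y') h h'
  grind

theorem exists_right (hl : G.outs.length = H.ins.length) {x : E} (h : G.tgt x = none) : ∃ y, Matched G H x y := by
  have := (G.mem_outs x).2 h
  rw [← List.map_fst_zip (l₂ := H.ins) hl.le] at this
  obtain ⟨p, hp, rfl⟩ := List.mem_map.1 this
  exact ⟨p.2, hp⟩

theorem exists_left (hl : G.outs.length = H.ins.length) {y : E'} (h : H.src y = none) : ∃ x, Matched G H x y := by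
  have := (H.mem_ins y).2 h
  rw [← List.map_snd_zip (l₁ := G.outs) hl.ge] at this
  obtain ⟨p, hp, rfl⟩ := List.mem_map.1 this
  exact ⟨p.1, hp⟩

end matched

namespace Glue

variable {G : PlanarGraph E V} {H : PlanarGraph E' V'}
variable (hl : G.outs.length = H.ins.length)

open Classical in
/-- The edge of the composition containing a given edge of `G`. -/
noncomputable def inL (x : E) : Glue G H :=
  if h : G.tgt x = none then mid x _ (exists_right hl h).choose_spec else left x h

open Classical in
/-- The edge of the composition containing a given edge of `H`. -/
noncomputable def inR (y : E') : Glue G H :=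
  if h : H.src y = none then mid _ y (exists_left hl h).choose_spec else right y h

theorem inL_left {x : E} (h : G.tgt x ≠ none) : inL hl x = (left x h : Glue G H) := dif_neg h

theorem inR_right {y : E'} (h : H.src y ≠ none) : inR hl y = (right y h : Glue G H) := dif_neg h

theorem inL_mid {x : E} {y : E'} (h : Matched G H x y) : inL hl x = mid x y h := by
  have h0 := h.tgt
  rw [inL, dif_pos h0]
  have := (exists_right (H := H) hl h0).choose_spec
  rcases matched_cases hl this h with h1 | h1 | h1
  · congr 1; exact h1.2
  · exact (G.lt_irrefl _ h1.1).elim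
  · exact (G.lt_irrefl _ h1.1).elim

theorem inR_mid {x : E} {y : E'} (h : Matched G H x y) : inR hl y = mid x y h := by
  have h0 := h.src
  rw [inR, dif_pos h0]
  have := (exists_left (G := G) hl h0).choose_spec
  rcases matched_cases hl this h with h1 | h1 | h1
  · congr 1; exact h1.1
  · exact (H.lt_irrefl _ h1.2).elim
  · exact (H.lt_irrefl _ h1.2).elim

theorem inL_eq_inR {x : E} {y : E'} (h : Matched G H x y) : (inL hl x : Glue G H) = inR hl y := by
  rw [inL_mid hl h, inR_mid hl h]

theorem cases_LR (p : Glue G H) :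
    (∃ x h, p = left x h ∧ p = inL hl x) ∨ (∃ x y h, p = mid x y h ∧ p = inL hl x ∧ p = inR hl y) ∨
      ∃ y h, p = right y h ∧ p = inR hl y := by
  rcases p with ⟨x, h⟩ | ⟨x, y, h⟩ | ⟨y, h⟩
  · exact Or.inl ⟨x, h, rfl, (inL_left hl h).symm⟩
  · exact Or.inr (Or.inl ⟨x, y, h, rfl, (inL_mid hl h).symm, (inR_mid hl h).symm⟩)
  · exact Or.inr (Or.inr ⟨y, h, rfl, (inR_right hl h).symm⟩)

theorem src_inL (x : E) : src (inL hl x : Glue G H) = (G.src x).map Sum.inl := by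
  rw [inL]; split <;> rfl

theorem tgt_inR (y : E') : tgt (inR hl y : Glue G H) = (H.tgt y).map Sum.inr := by
  rw [inR]; split <;> rfl

theorem tgt_inL {x : E} (h : G.tgt x ≠ none) :
    tgt (inL hl x : Glue G H) = (G.tgt x).map Sum.inl := by
  rw [inL_left hl h]; rfl

theorem src_inR {y : E'} (h : H.src y ≠ none) :
    src (inR hl y : Glue G H) = (H.src y).map Sum.inr := by
  rw [inR_right hl h]; rfl

theorem elim_inL {X : Type*} (f : E → X) (g : E' → X) (x : E) :
    elim f g (inL hl x : Glue G H) = f x := by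
  rw [inL]; split <;> rfl

theorem elim_inR {X : Type*} (f : E → X) (g : E' → X)
    (hfg : ∀ x y, Matched G H x y → f x = g y) (y : E') :
    elim f g (inR hl y : Glue G H) = g y := by
  rw [inR]
  split
  · rename_i h
    exact hfg _ _ (exists_left hl h).choose_spec
  · rfl

theorem lt_irrefl (p : Glue G H) : ¬ lt p p := by
  rcases p with ⟨x, h⟩ | ⟨x, y, h⟩ | ⟨y, h⟩
  · exact G.lt_irrefl x
  · exact G.lt_irrefl x
  · exact H.lt_irrefl y

theorem lt_total (hl : G.outs.length = H.ins.length) (p q : Glue G H) : lt p q ∨ p = q ∨ lt q p := by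
  rcases p with ⟨x, h⟩ | ⟨x, y, h⟩ | ⟨y, h⟩ <;> rcases q with ⟨x', h'⟩ | ⟨x', y', h'⟩ | ⟨y', h'⟩
  · rcases G.lt_total x x' with h1 | rfl | h1
    · exact Or.inl h1
    · exact Or.inr (Or.inl rfl)
    · exact Or.inr (Or.inr h1)
  · rcases G.lt_total x x' with h1 | rfl | h1
    · exact Or.inl h1
    · exact (h h'.tgt).elim
    · exact Or.inr (Or.inr h1)
  · by_cases h1 : ∃ o i, Matched G H o i ∧ G.lt x o ∧ H.lt i y'
    · exact Or.inl h1
    · exact Or.inr (Or.inr h1)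
  · rcases G.lt_total x x' with h1 | rfl | h1
    · exact Or.inl h1
    · exact (h' h.tgt).elim
    · exact Or.inr (Or.inr h1)
  · rcases matched_cases hl h h' with h1 | h1 | h1
    · obtain ⟨rfl, rfl⟩ := h1; exact Or.inr (Or.inl rfl)
    · exact Or.inl h1.1
    · exact Or.inr (Or.inr h1.1)
  · rcases H.lt_total y y' with h1 | rfl | h1
    · exact Or.inl h1
    · exact (h' h.src).elim
    · exact Or.inr (Or.inr h1)
  · by_cases h1 : ∃ o i, Matched G H o i ∧ G.lt x' o ∧ H.lt i y
    · exact Or.inr (Or.inr h1)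
    · exact Or.inl h1
  · rcases H.lt_total y y' with h1 | rfl | h1
    · exact Or.inl h1
    · exact (h h'.src).elim
    · exact Or.inr (Or.inr h1)
  · rcases H.lt_total y y' with h1 | rfl | h1
    · exact Or.inl h1
    · exact Or.inr (Or.inl rfl)
    · exact Or.inr (Or.inr h1)

theorem lt_trans (hl : G.outs.length = H.ins.length) (p q r : Glue G H) (h₁ : lt p q) (h₂ : lt q r) : lt p r := by
  have hG := G.lt_trans
  have hH := H.lt_trans
  have hGt := G.lt_total
  have hHt := H.lt_total
  have hGi := G.lt_irrefl
  have hHi := H.lt_irrefl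
  have hM : ∀ x x' y y', Matched G H x y → Matched G H x' y' → (G.lt x x' ↔ H.lt y y') :=
    fun _ _ _ _ h h' => matched_lt hl h h'
  have hMt : ∀ x y, Matched G H x y → G.tgt x = none := fun _ _ h => h.tgt
  have hMs : ∀ x y, Matched G H x y → H.src y = none := fun _ _ h => h.src
  rcases p with ⟨x, h⟩ | ⟨x, y, h⟩ | ⟨y, h⟩ <;>
  rcases q with ⟨x', h'⟩ | ⟨x', y', h'⟩ | ⟨y', h'⟩ <;>
  rcases r with ⟨x'', h''⟩ | ⟨x'', y'', h''⟩ | ⟨y'', h''⟩ <;>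
  simp only [lt] at h₁ h₂ ⊢ <;> grind

end Glue


namespace Glue

variable {E V E' V' : Type} {G : PlanarGraph E V} {H : PlanarGraph E' V'}
variable (hl : G.outs.length = H.ins.length)

theorem inL_injective : Function.Injective (inL hl : E → Glue G H) := by
  intro x x' h
  have := congrArg (fun p => if G.tgt x = none then elim id (fun _ => x) p else
    elim id (fun _ => x) p) h
  simpa [elim_inL] using this

theorem lt_inL {x x' : E} : lt (inL hl x : Glue G H) (inL hl x') ↔ G.lt x x' := by
  unfold inL
  split <;> split <;> rfl

theorem lt_inR {y y' : E'} : lt (inR hl y : Glue G H) (inR hl y') ↔ H.lt y y' := by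
  unfold inR
  split
  · rename_i h
    split
    · rename_i h'
      exact matched_lt hl (exists_left hl h).choose_spec (exists_left hl h').choose_spec
    · rfl
  · split <;> rfl

theorem lt_inL_inR {x : E} {y : E'} (hx : G.tgt x ≠ none) (hy : H.src y ≠ none) :
    lt (inL hl x : Glue G H) (inR hl y) ↔ ∃ o i, Matched G H o i ∧ G.lt x o ∧ H.lt i y := by
  rw [inL_left hl hx, inR_right hl hy]; rfl

theorem inR_injective : Function.Injective (inR hl : E' → Glue G H) := by
  intro y y' h
  rcases H.lt_total y y' with h1 | h1 | h1
  · rw [← lt_inR hl, h] at h1; exact (lt_irrefl _ h1).elim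
  · exact h1
  · rw [← lt_inR hl, h] at h1; exact (lt_irrefl _ h1).elim

theorem step_inL {x x' : E} (h : Step G.src G.tgt x x') :
    Step src tgt (inL hl x : Glue G H) (inL hl x') := by
  obtain ⟨v, h1, h2⟩ := h
  refine ⟨Sum.inl v, ?_, by rw [src_inL, h2]; rfl⟩
  rw [tgt_inL hl (by rw [h1]; simp), h1]; rfl

theorem step_inR {y y' : E'} (h : Step H.src H.tgt y y') :
    Step src tgt (inR hl y : Glue G H) (inR hl y') := by
  obtain ⟨v, h1, h2⟩ := h
  refine ⟨Sum.inr v, by rw [tgt_inR, h1]; rfl, ?_⟩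
  rw [src_inR hl (by rw [h2]; simp), h2]; rfl

theorem reach_inL {x x' : E} (h : Reach G.src G.tgt x x') :
    Reach src tgt (inL hl x : Glue G H) (inL hl x') :=
  Relation.TransGen.lift (inL hl) (fun _ _ h => step_inL hl h) _ _ h

theorem reach_inR {y y' : E'} (h : Reach H.src H.tgt y y') :
    Reach src tgt (inR hl y : Glue G H) (inR hl y') :=
  Relation.TransGen.lift (inR hl) (fun _ _ h => step_inR hl h) _ _ h

theorem step_cases {p q : Glue G H} (h : Step src tgt p q) :
    (∃ x x', p = inL hl x ∧ q = inL hl x' ∧ Step G.src G.tgt x x') ∨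
      ∃ y y', p = inR hl y ∧ q = inR hl y' ∧ Step H.src H.tgt y y' := by
  obtain ⟨v, h1, h2⟩ := h
  rcases v with v | v
  · left
    rcases cases_LR hl p with ⟨x, h, rfl, hp⟩ | ⟨x, y, h, rfl, hp, hp'⟩ | ⟨y, h, rfl, hp⟩ <;>
    rcases cases_LR hl q with ⟨x', h', rfl, hq⟩ | ⟨x', y', h', rfl, hq, hq'⟩ | ⟨y', h', rfl, hq⟩ <;>
    simp only [tgt, src, Option.map_eq_some_iff, reduceCtorEq, and_false, exists_false,
      Sum.inl.injEq, exists_eq_right] at h1 h2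
    · exact ⟨x, x', hp, hq, v, h1, h2⟩
    · exact ⟨x, x', hp, hq, v, h1, h2⟩
  · right
    rcases cases_LR hl p with ⟨x, h, rfl, hp⟩ | ⟨x, y, h, rfl, hp, hp'⟩ | ⟨y, h, rfl, hp⟩ <;>
    rcases cases_LR hl q with ⟨x', h', rfl, hq⟩ | ⟨x', y', h', rfl, hq, hq'⟩ | ⟨y', h', rfl, hq⟩ <;>
    simp only [tgt, src, Option.map_eq_some_iff, reduceCtorEq, and_false, exists_false,
      Sum.inr.injEq, exists_eq_right] at h1 h2
    · exact ⟨y, y', hp', hq, v, h1, h2⟩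
    · exact ⟨y, y', hp, hq, v, h1, h2⟩

theorem inL_inR_matched {x : E} {y : E'} (h : (inL hl x : Glue G H) = inR hl y) :
    Matched G H x y := by
  unfold inL inR at h
  split at h <;> split at h <;> rename_i h1 h2
  · injection h with h3 h4
    have := (exists_right (H := H) hl h1).choose_spec
    rwa [h4] at this
  all_goals cases h

theorem reach_to_inL {p : Glue G H} {x' : E} (h : Reach src tgt p (inL hl x')) :
    ∃ x, p = inL hl x ∧ Reach G.src G.tgt x x' := by
  induction h using Relation.TransGen.head_induction_on with
  | single h =>
    rcases step_cases hl h with ⟨x, x'', rfl, h2, h3⟩ | ⟨y, y', rfl, h2, h3⟩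
    · rw [← inL_injective hl h2] at h3
      exact ⟨x, rfl, .single h3⟩
    · have := (inL_inR_matched hl h2).src
      obtain ⟨v, -, h4⟩ := h3
      rw [this] at h4; cases h4
  | head h _ ih =>
    obtain ⟨x₁, rfl, ih⟩ := ih
    rcases step_cases hl h with ⟨x, x'', rfl, h2, h3⟩ | ⟨y, y', rfl, h2, h3⟩
    · rw [← inL_injective hl h2] at h3
      exact ⟨x, rfl, .head h3 ih⟩
    · have := (inL_inR_matched hl h2).src
      obtain ⟨v, -, h4⟩ := h3
      rw [this] at h4; cases h4

theorem reach_from_inR {q : Glue G H} {y : E'} (h : Reach src tgt (inR hl y) q) :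
    ∃ y', q = inR hl y' ∧ Reach H.src H.tgt y y' := by
  induction h with
  | single h =>
    rcases step_cases hl h with ⟨x, x'', h2, rfl, h3⟩ | ⟨y1, y', h2, rfl, h3⟩
    · have := (inL_inR_matched hl h2.symm).tgt
      obtain ⟨v, h4, -⟩ := h3
      rw [this] at h4; cases h4
    · rw [← inR_injective hl h2] at h3
      exact ⟨_, rfl, .single h3⟩
  | tail _ h ih =>
    obtain ⟨x₁, rfl, ih⟩ := ih
    rcases step_cases hl h with ⟨x, x'', h2, rfl, h3⟩ | ⟨y1, y', h2, rfl, h3⟩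
    · have := (inL_inR_matched hl h2.symm).tgt
      obtain ⟨v, h4, -⟩ := h3
      rw [this] at h4; cases h4
    · rw [← inR_injective hl h2] at h3
      exact ⟨_, rfl, .tail ih h3⟩

theorem reach_inL_inR {x : E} {y : E'} (h : Reach src tgt (inL hl x : Glue G H) (inR hl y)) :
    ∃ o i, Matched G H o i ∧ (x = o ∨ Reach G.src G.tgt x o) ∧
      (i = y ∨ Reach H.src H.tgt i y) := by
  generalize hp : (inL hl x : Glue G H) = p at h
  induction h using Relation.TransGen.head_induction_on generalizing x with
  | @single b h =>
    rcases step_cases hl h with ⟨x1, x2, h1, h2, h3⟩ | ⟨y1, y2, h1, h2, h3⟩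
    · rw [h1] at hp; cases inL_injective hl hp
      exact ⟨_, _, inL_inR_matched hl h2.symm, Or.inr (.single h3), Or.inl rfl⟩
    · rw [h1] at hp
      cases inR_injective hl h2
      exact ⟨_, _, inL_inR_matched hl hp, Or.inl rfl, Or.inr (.single h3)⟩
  | @head b c h hr ih =>
    rcases step_cases hl h with ⟨x1, x2, h1, h2, h3⟩ | ⟨y1, y2, h1, h2, h3⟩
    · rw [h1] at hp; cases inL_injective hl hp
      obtain ⟨o, i, hm, h4, h5⟩ := ih h2.symm
      refine ⟨o, i, hm, Or.inr ?_, h5⟩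
      rcases h4 with rfl | h4
      · exact .single h3
      · exact .head h3 h4
    · rw [h1] at hp
      subst h2
      obtain ⟨y', h4, h5⟩ := reach_from_inR hl hr
      cases inR_injective hl h4
      exact ⟨_, _, inL_inR_matched hl hp, Or.inl rfl, Or.inr (.head h3 h5)⟩

theorem reach_cross {x : E} {y : E'} {o : E} {i : E'} (hm : Matched G H o i)
    (hx : Reach G.src G.tgt x o) (hy : Reach H.src H.tgt i y) :
    Reach src tgt (inL hl x : Glue G H) (inR hl y) := by
  refine (reach_inL hl hx).trans ?_
  rw [inL_eq_inR hl hm]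
  exact reach_inR hl hy

end Glue

namespace Glue

variable {E V E' V' : Type} {G : PlanarGraph E V} {H : PlanarGraph E' V'}
variable (hl : G.outs.length = H.ins.length)

theorem lt_inL_inR_prev [Finite E'] {x : E} {w : E'}
    (h : lt (inL hl x : Glue G H) (inR hl w)) (hw : H.src w ≠ none) :
    ∃ o i, Matched G H o i ∧ Reach H.src H.tgt i w ∧ (x = o ∨ G.lt x o) := by
  obtain ⟨i, h1, h2, h3⟩ := H.exists_prev_in w
  obtain ⟨o, ho⟩ := exists_left hl h1
  have h2 : Reach H.src H.tgt i w := h2.resolve_left (by rintro rfl; exact hw h1)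
  refine ⟨o, i, ho, h2, ?_⟩
  by_cases hx : G.tgt x = none
  · obtain ⟨y, hy⟩ := exists_right hl hx
    rw [inL_eq_inR hl hy, lt_inR] at h
    rcases h3 y hy.src (Or.inr h) with rfl | h4
    · rcases matched_cases hl hy ho with h5 | h5 | h5
      · exact Or.inl h5.1
      · exact Or.inr h5.1
      · exact (H.lt_irrefl _ h5.2).elim
    · exact Or.inr ((matched_lt hl hy ho).2 h4)
  · rw [lt_inL_inR hl hx hw] at h
    obtain ⟨o', i', hm, h4, h5⟩ := h
    rcases h3 i' hm.src (Or.inr h5) with rfl | h6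
    · rcases matched_cases hl hm ho with h7 | h7 | h7
      · exact Or.inr (h7.1 ▸ h4)
      · exact (H.lt_irrefl _ h7.2).elim
      · exact (H.lt_irrefl _ h7.2).elim
    · exact Or.inr (G.lt_trans _ _ _ h4 ((matched_lt hl hm ho).2 h6))

theorem lt_inL_inR_next [Finite E] {w : E} {y : E'}
    (h : lt (inL hl w : Glue G H) (inR hl y)) (hw : G.tgt w ≠ none) :
    ∃ o i, Matched G H o i ∧ Reach G.src G.tgt w o ∧ (i = y ∨ H.lt i y) := by
  obtain ⟨o, h1, h2, h3⟩ := G.exists_next_out w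
  obtain ⟨i, hi⟩ := exists_right hl h1
  have h2 : Reach G.src G.tgt w o := h2.resolve_left (by rintro rfl; exact hw h1)
  refine ⟨o, i, hi, h2, ?_⟩
  by_cases hy : H.src y = none
  · obtain ⟨x, hx⟩ := exists_left hl hy
    rw [← inL_eq_inR hl hx, lt_inL] at h
    rcases h3 x hx.tgt (Or.inr h) with rfl | h4
    · rcases matched_cases hl hi hx with h5 | h5 | h5
      · exact Or.inl h5.2
      · exact Or.inr h5.2
      · exact (G.lt_irrefl _ h5.1).elim
    · exact Or.inr ((matched_lt hl hi hx).1 h4)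
  · rw [lt_inL_inR hl hw hy] at h
    obtain ⟨o', i', hm, h4, h5⟩ := h
    rcases h3 o' hm.tgt (Or.inr h4) with rfl | h6
    · rcases matched_cases hl hi hm with h7 | h7 | h7
      · exact Or.inr (h7.2 ▸ h5)
      · exact (G.lt_irrefl _ h7.1).elim
      · exact (G.lt_irrefl _ h7.1).elim
    · exact Or.inr (H.lt_trans _ _ _ ((matched_lt hl hi hm).1 h6) h5)

theorem cases_L (p : Glue G H) : (∃ x, p = inL hl x) ∨ ∃ y, H.src y ≠ none ∧ p = inR hl y := by
  rcases cases_LR hl p with ⟨x, h, -, h'⟩ | ⟨x, y, h, -, h', -⟩ | ⟨y, h, -, h'⟩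
  · exact Or.inl ⟨x, h'⟩
  · exact Or.inl ⟨x, h'⟩
  · exact Or.inr ⟨y, h, h'⟩

theorem cases_R (p : Glue G H) : (∃ x, G.tgt x ≠ none ∧ p = inL hl x) ∨ ∃ y, p = inR hl y := by
  rcases cases_LR hl p with ⟨x, h, -, h'⟩ | ⟨x, y, h, -, -, h'⟩ | ⟨y, h, -, h'⟩
  · exact Or.inl ⟨x, h, h'⟩
  · exact Or.inr ⟨y, h'⟩
  · exact Or.inr ⟨y, h'⟩

theorem reach_lt (hl : G.outs.length = H.ins.length) (p q : Glue G H) (h : Reach src tgt p q) : lt p q := by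
  refine planar₁_of_step (lt_trans hl) (fun p q h => ?_) p q h
  rcases step_cases hl h with ⟨x, x', rfl, rfl, h3⟩ | ⟨y, y', rfl, rfl, h3⟩
  · exact (lt_inL hl).2 (G.planar₁ _ _ (.single h3))
  · exact (lt_inR hl).2 (H.planar₁ _ _ (.single h3))

theorem planar₂ (hl : G.outs.length = H.ins.length) [Finite E] [Finite E'] (p q r : Glue G H) (h : Reach src tgt p r)
    (hpq : lt p q) (hqr : lt q r) : Reach src tgt q r ∨ Reach src tgt p q := by
  rcases cases_L hl r with ⟨z, rfl⟩ | ⟨z, hz, rfl⟩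
  · obtain ⟨x, rfl, hr⟩ := reach_to_inL hl h
    rcases cases_L hl q with ⟨w, rfl⟩ | ⟨w, hw, rfl⟩
    · rw [lt_inL] at hpq hqr
      rcases G.planar₂ _ _ _ hr hpq hqr with h1 | h1
      · exact Or.inl (reach_inL hl h1)
      · exact Or.inr (reach_inL hl h1)
    · obtain ⟨o, i, hm, h1, h2⟩ := lt_inL_inR_prev hl hpq hw
      have h2 : G.lt x o := h2.resolve_left (by rintro rfl; exact G.not_reach_of_tgt hm.tgt hr)
      have h3 := lt_trans hl _ _ _ ((lt_inR hl).2 (H.planar₁ _ _ h1)) hqr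
      rw [← inL_eq_inR hl hm, lt_inL] at h3
      rcases G.planar₂ _ _ _ hr h2 h3 with h4 | h4
      · exact (G.not_reach_of_tgt hm.tgt h4).elim
      · exact Or.inr (reach_cross hl hm h4 h1)
  rcases cases_R hl p with ⟨x, hx, rfl⟩ | ⟨y, rfl⟩
  swap
  · obtain ⟨z', hz', hr⟩ := reach_from_inR hl h
    cases inR_injective hl hz'
    rcases cases_R hl q with ⟨w, hw, rfl⟩ | ⟨w, rfl⟩
    · obtain ⟨o, i, hm, h1, h2⟩ := lt_inL_inR_next hl hqr hw
      have h2 : H.lt i _ := h2.resolve_left (by rintro rfl; exact H.not_reach_of_src hm.src hr)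
      have h3 := lt_trans hl _ _ _ hpq ((lt_inL hl).2 (G.planar₁ _ _ h1))
      rw [inL_eq_inR hl hm, lt_inR] at h3
      rcases H.planar₂ _ _ _ hr h3 h2 with h4 | h4
      · exact Or.inl (reach_cross hl hm h1 h4)
      · exact (H.not_reach_of_src hm.src h4).elim
    · rw [lt_inR] at hpq hqr
      rcases H.planar₂ _ _ _ hr hpq hqr with h1 | h1
      · exact Or.inl (reach_inR hl h1)
      · exact Or.inr (reach_inR hl h1)
  obtain ⟨o, i, hm, h1, h2⟩ := reach_inL_inR hl h
  have h1 := h1.resolve_left (by rintro rfl; exact hx hm.tgt)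
  have h2 := h2.resolve_left (by rintro rfl; exact hz hm.src)
  rcases cases_L hl q with ⟨w, rfl⟩ | ⟨w, hw, rfl⟩
  · rw [lt_inL] at hpq
    by_cases hw : G.tgt w = none
    · obtain ⟨y, hy⟩ := exists_right hl hw
      rcases matched_cases hl hy hm with h3 | h3 | h3
      · rw [h3.1]; exact Or.inr (reach_inL hl h1)
      · rcases G.planar₂ _ _ _ h1 hpq h3.1 with h4 | h4
        · exact (G.not_reach_of_tgt hw h4).elim
        · exact Or.inr (reach_inL hl h4)
      · rw [inL_eq_inR hl hy, lt_inR] at hqr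
        rcases H.planar₂ _ _ _ h2 h3.2 hqr with h4 | h4
        · rw [inL_eq_inR hl hy]; exact Or.inl (reach_inR hl h4)
        · exact (H.not_reach_of_src hy.src h4).elim
    · obtain ⟨o', i', hm', h3, h4⟩ := lt_inL_inR_next hl hqr hw
      have h4 : H.lt i' z := h4.resolve_left (by rintro rfl; exact hz hm'.src)
      rcases matched_cases hl hm' hm with h5 | h5 | h5
      · rw [h5.1] at h3; exact Or.inl (reach_cross hl hm h3 h2)
      · rcases G.planar₂ _ _ _ h1 hpq (G.lt_trans _ _ _ (G.planar₁ _ _ h3) h5.1) with h6 | h6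
        · exact Or.inl (reach_cross hl hm h6 h2)
        · exact Or.inr (reach_inL hl h6)
      · rcases H.planar₂ _ _ _ h2 h5.2 h4 with h6 | h6
        · exact Or.inl (reach_cross hl hm' h3 h6)
        · exact (H.not_reach_of_src hm'.src h6).elim
  · obtain ⟨o', i', hm', h3, h4⟩ := lt_inL_inR_prev hl hpq hw
    have h4 : G.lt x o' := h4.resolve_left (by rintro rfl; exact hx hm'.tgt)
    rw [lt_inR] at hqr
    rcases matched_cases hl hm' hm with h5 | h5 | h5
    · rw [h5.2] at h3; exact Or.inr (reach_cross hl hm h1 h3)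
    · rcases G.planar₂ _ _ _ h1 h4 h5.1 with h6 | h6
      · exact (G.not_reach_of_tgt hm'.tgt h6).elim
      · exact Or.inr (reach_cross hl hm' h6 h3)
    · rcases H.planar₂ _ _ _ h2 (H.lt_trans _ _ _ h5.2 (H.planar₁ _ _ h3)) hqr with h6 | h6
      · exact Or.inl (reach_inR hl h6)
      · exact Or.inr (reach_cross hl hm h1 h6)

instance [Finite E] [Finite E'] : Finite (Glue G H) := by
  refine Finite.of_injective (β := E ⊕ (E × E') ⊕ E') (fun p => match p with
    | left x _ => Sum.inl x
    | mid x y _ => Sum.inr (Sum.inl (x, y))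
    | right y _ => Sum.inr (Sum.inr y)) ?_
  rintro (⟨x, h⟩ | ⟨x, y, h⟩ | ⟨y, h⟩) (⟨x', h'⟩ | ⟨x', y', h'⟩ | ⟨y', h'⟩) <;> simp

end Glue

/-- The composition `H ∘ G`, defined when the number of outputs of `G` is the number of inputs
of `H`: the outputs of `G` are grafted to the inputs of `H` in order. -/
noncomputable def comp {E V E' V' : Type} [Finite E] [Finite E'] (G : PlanarGraph E V)
    (H : PlanarGraph E' V') (hl : G.outs.length = H.ins.length) :
    PlanarGraph (Glue G H) (V ⊕ V') where
  src := Glue.src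
  tgt := Glue.tgt
  lt := Glue.lt
  vin := Sum.elim (fun v => (G.vin v).map (Glue.inL hl)) (fun v => (H.vin v).map (Glue.inR hl))
  vout := Sum.elim (fun v => (G.vout v).map (Glue.inL hl)) (fun v => (H.vout v).map (Glue.inR hl))
  ins := G.ins.map (Glue.inL hl)
  outs := H.outs.map (Glue.inR hl)
  lt_irrefl := Glue.lt_irrefl
  lt_trans := Glue.lt_trans hl
  lt_total := Glue.lt_total hl
  planar₁ := Glue.reach_lt hl
  planar₂ := Glue.planar₂ hl
  vin_sorted := by
    rintro (v | v)
    · exact List.pairwise_map.2 ((G.vin_sorted v).imp (Glue.lt_inL hl).2)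
    · exact List.pairwise_map.2 ((H.vin_sorted v).imp (Glue.lt_inR hl).2)
  vout_sorted := by
    rintro (v | v)
    · exact List.pairwise_map.2 ((G.vout_sorted v).imp (Glue.lt_inL hl).2)
    · exact List.pairwise_map.2 ((H.vout_sorted v).imp (Glue.lt_inR hl).2)
  ins_sorted := List.pairwise_map.2 (G.ins_sorted.imp (Glue.lt_inL hl).2)
  outs_sorted := List.pairwise_map.2 (H.outs_sorted.imp (Glue.lt_inR hl).2)
  mem_vin := by
    rintro (v | v) p
    · simp only [Sum.elim_inl, List.mem_map, G.mem_vin]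
      constructor
      · rintro ⟨x, h, rfl⟩
        rw [Glue.tgt_inL hl (by simp [h]), h]; rfl
      · intro h
        rcases Glue.cases_R hl p with ⟨x, hx, rfl⟩ | ⟨y, rfl⟩
        · rw [Glue.tgt_inL hl hx] at h
          refine ⟨x, ?_, rfl⟩
          simpa using h
        · rw [Glue.tgt_inR] at h; simp at h
    · simp only [Sum.elim_inr, List.mem_map, H.mem_vin]
      constructor
      · rintro ⟨x, h, rfl⟩
        rw [Glue.tgt_inR hl, h]; rfl
      · intro h
        rcases Glue.cases_R hl p with ⟨x, hx, rfl⟩ | ⟨y, rfl⟩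
        · rw [Glue.tgt_inL hl hx] at h; simp at h
        · rw [Glue.tgt_inR] at h
          refine ⟨y, ?_, rfl⟩
          simpa using h
  mem_vout := by
    rintro (v | v) p
    · simp only [Sum.elim_inl, List.mem_map, G.mem_vout]
      constructor
      · rintro ⟨x, h, rfl⟩
        rw [Glue.src_inL hl, h]; rfl
      · intro h
        rcases Glue.cases_L hl p with ⟨x, rfl⟩ | ⟨y, hy, rfl⟩
        · rw [Glue.src_inL] at h
          refine ⟨x, ?_, rfl⟩
          simpa using h
        · rw [Glue.src_inR hl hy] at h; simp at h
    · simp only [Sum.elim_inr, List.mem_map, H.mem_vout]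
      constructor
      · rintro ⟨x, h, rfl⟩
        rw [Glue.src_inR hl (by simp [h]), h]; rfl
      · intro h
        rcases Glue.cases_L hl p with ⟨x, rfl⟩ | ⟨y, hy, rfl⟩
        · rw [Glue.src_inL] at h; simp at h
        · rw [Glue.src_inR hl hy] at h
          refine ⟨y, ?_, rfl⟩
          simpa using h
  mem_ins := by
    intro p
    simp only [List.mem_map, G.mem_ins]
    constructor
    · rintro ⟨x, h, rfl⟩
      rw [Glue.src_inL, h]; rfl
    · intro h
      rcases Glue.cases_L hl p with ⟨x, rfl⟩ | ⟨y, hy, rfl⟩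
      · rw [Glue.src_inL] at h
        exact ⟨x, by simpa using h, rfl⟩
      · rw [Glue.src_inR hl hy] at h
        exact (hy (by simpa using h)).elim
  mem_outs := by
    intro p
    simp only [List.mem_map, H.mem_outs]
    constructor
    · rintro ⟨x, h, rfl⟩
      rw [Glue.tgt_inR, h]; rfl
    · intro h
      rcases Glue.cases_R hl p with ⟨x, hx, rfl⟩ | ⟨y, rfl⟩
      · rw [Glue.tgt_inL hl hx] at h
        exact (hx (by simpa using h)).elim
      · rw [Glue.tgt_inR] at h
        exact ⟨y, by simpa using h, rfl⟩
  vin_ne_nil := by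
    rintro (v | v)
    · simpa using G.vin_ne_nil v
    · simpa using H.vin_ne_nil v
  vout_ne_nil := by
    rintro (v | v)
    · simpa using G.vout_ne_nil v
    · simpa using H.vout_ne_nil v

section tensor

variable {E V E' V' : Type}

/-- Source (or target) map of a tensor product. -/
def tensorEnd (f : E → Option V) (g : E' → Option V') : E ⊕ E' → Option (V ⊕ V') :=
  Sum.elim (fun x => (f x).map Sum.inl) (fun y => (g y).map Sum.inr)

variable {s t : E → Option V} {s' t' : E' → Option V'}

theorem tensor_step_inl {x y : E} (h : Step s t x y) :
    Step (tensorEnd s s') (tensorEnd t t') (Sum.inl x) (Sum.inl y) := by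
  obtain ⟨v, h1, h2⟩ := h
  exact ⟨Sum.inl v, by simp [tensorEnd, h1], by simp [tensorEnd, h2]⟩

theorem tensor_step_inr {x y : E'} (h : Step s' t' x y) :
    Step (tensorEnd s s') (tensorEnd t t') (Sum.inr x) (Sum.inr y) := by
  obtain ⟨v, h1, h2⟩ := h
  exact ⟨Sum.inr v, by simp [tensorEnd, h1], by simp [tensorEnd, h2]⟩

theorem tensor_step {p q : E ⊕ E'} (h : Step (tensorEnd s s') (tensorEnd t t') p q) :
    (∃ x y, p = Sum.inl x ∧ q = Sum.inl y ∧ Step s t x y) ∨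
      ∃ x y, p = Sum.inr x ∧ q = Sum.inr y ∧ Step s' t' x y := by
  obtain ⟨v, h1, h2⟩ := h
  rcases v with v | v <;> rcases p with x | x <;> rcases q with y | y <;>
    simp [tensorEnd] at h1 h2
  · exact Or.inl ⟨x, y, rfl, rfl, v, h1, h2⟩
  · exact Or.inr ⟨x, y, rfl, rfl, v, h1, h2⟩

theorem tensor_reach {p q : E ⊕ E'} (h : Reach (tensorEnd s s') (tensorEnd t t') p q) :
    (∃ x y, p = Sum.inl x ∧ q = Sum.inl y ∧ Reach s t x y) ∨
      ∃ x y, p = Sum.inr x ∧ q = Sum.inr y ∧ Reach s' t' x y := by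
  induction h with
  | single hs =>
    rcases tensor_step hs with ⟨x, y, rfl, rfl, h⟩ | ⟨x, y, rfl, rfl, h⟩
    · exact Or.inl ⟨x, y, rfl, rfl, .single h⟩
    · exact Or.inr ⟨x, y, rfl, rfl, .single h⟩
  | tail _ h ih =>
    rcases ih with ⟨x, y, rfl, rfl, ih⟩ | ⟨x, y, rfl, rfl, ih⟩ <;>
    rcases tensor_step h with ⟨x', y', h1, rfl, h⟩ | ⟨x', y', h1, rfl, h⟩ <;>
    cases h1
    · exact Or.inl ⟨x, y', rfl, rfl, .tail ih h⟩
    · exact Or.inr ⟨x, y', rfl, rfl, .tail ih h⟩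

end tensor

/-- The tensor product: `G` on the left of `H`. -/
def tensor {E V E' V' : Type} (G : PlanarGraph E V) (H : PlanarGraph E' V') :
    PlanarGraph (E ⊕ E') (V ⊕ V') where
  src := tensorEnd G.src H.src
  tgt := tensorEnd G.tgt H.tgt
  lt := Sum.Lex G.lt H.lt
  vin := Sum.elim (fun v => (G.vin v).map Sum.inl) (fun v => (H.vin v).map Sum.inr)
  vout := Sum.elim (fun v => (G.vout v).map Sum.inl) (fun v => (H.vout v).map Sum.inr)
  ins := G.ins.map Sum.inl ++ H.ins.map Sum.inr
  outs := G.outs.map Sum.inl ++ H.outs.map Sum.inr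
  lt_irrefl := by
    rintro (x | x) (h | h | h)
    · exact G.lt_irrefl _ (by assumption)
    · exact H.lt_irrefl _ (by assumption)
  lt_trans := by
    have := G.lt_trans
    have := H.lt_trans
    rintro (x | x) (y | y) (z | z) <;> simp <;> grind
  lt_total := by
    have := G.lt_total
    have := H.lt_total
    rintro (x | x) (y | y) <;> simp <;> grind
  planar₁ := by
    refine planar₁_of_step ?_ ?_
    · have := G.lt_trans
      have := H.lt_trans
      rintro (x | x) (y | y) (z | z) <;> simp <;> grind
    · intro x y hs
      rcases tensor_step hs with ⟨x, y, rfl, rfl, h⟩ | ⟨x, y, rfl, rfl, h⟩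
      · exact .inl (G.planar₁ _ _ (.single h))
      · exact .inr (H.planar₁ _ _ (.single h))
  planar₂ := by
    intro p q r hs hpq hqr
    rcases tensor_reach hs with ⟨x, z, rfl, rfl, h⟩ | ⟨x, z, rfl, rfl, h⟩
    · rcases q with y | y
      · rw [Sum.lex_inl_inl] at hpq hqr
        rcases G.planar₂ _ _ _ h hpq hqr with h | h
        · exact Or.inl (Relation.TransGen.lift Sum.inl (fun _ _ => tensor_step_inl) _ _ h)
        · exact Or.inr (Relation.TransGen.lift Sum.inl (fun _ _ => tensor_step_inl) _ _ h)
      · cases hqr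
    · rcases q with y | y
      · cases hpq
      · rw [Sum.lex_inr_inr] at hpq hqr
        rcases H.planar₂ _ _ _ h hpq hqr with h | h
        · exact Or.inl (Relation.TransGen.lift Sum.inr (fun _ _ => tensor_step_inr) _ _ h)
        · exact Or.inr (Relation.TransGen.lift Sum.inr (fun _ _ => tensor_step_inr) _ _ h)
  vin_sorted := by
    have := G.vin_sorted
    have := H.vin_sorted
    rintro (v | v) <;> simp [List.pairwise_map, *]
  vout_sorted := by
    have := G.vout_sorted
    have := H.vout_sorted
    rintro (v | v) <;> simp [List.pairwise_map, *]
  ins_sorted := by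
    have := G.ins_sorted
    have := H.ins_sorted
    simp [List.pairwise_append, List.pairwise_map, *]
  outs_sorted := by
    have := G.outs_sorted
    have := H.outs_sorted
    simp [List.pairwise_append, List.pairwise_map, *]
  mem_vin := by
    have := G.mem_vin
    have := H.mem_vin
    rintro (v | v) (x | x) <;> simp [tensorEnd, *]
  mem_vout := by
    have := G.mem_vout
    have := H.mem_vout
    rintro (v | v) (x | x) <;> simp [tensorEnd, *]
  mem_ins := by
    have := G.mem_ins
    have := H.mem_ins
    rintro (x | x) <;> simp [tensorEnd, *]
  mem_outs := by
    have := G.mem_outs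
    have := H.mem_outs
    rintro (x | x) <;> simp [tensorEnd, *]
  vin_ne_nil := by
    rintro (v | v)
    · simpa using G.vin_ne_nil v
    · simpa using H.vin_ne_nil v
  vout_ne_nil := by
    rintro (v | v)
    · simpa using G.vout_ne_nil v
    · simpa using H.vout_ne_nil v

/-- The identity graph with `n` edges, all virtual, in their natural order. -/
def unit (n : ℕ) : PlanarGraph (Fin n) Empty where
  src _ := none
  tgt _ := none
  lt x y := x < y
  vin v := v.elim
  vout v := v.elim
  ins := List.finRange n
  outs := List.finRange n
  lt_irrefl x := _root_.lt_irrefl x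
  lt_trans _ _ _ := _root_.lt_trans
  lt_total x y := _root_.lt_trichotomy x y
  planar₁ := planar₁_of_step (fun _ _ _ => _root_.lt_trans) fun _ _ h => h.choose.elim
  planar₂ _ _ _ h := by
    obtain ⟨_, h, _⟩ := Relation.TransGen.head'_iff.1 h
    exact h.choose.elim
  vin_sorted v := v.elim
  vout_sorted v := v.elim
  ins_sorted := List.pairwise_lt_finRange n
  outs_sorted := List.pairwise_lt_finRange n
  mem_vin v := v.elim
  mem_vout v := v.elim
  mem_ins x := by simp
  mem_outs x := by simp
  vin_ne_nil v := v.elim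
  vout_ne_nil v := v.elim

/-- The corolla with `m` inputs and `n` outputs. -/
def corolla (m n : ℕ) (hm : m ≠ 0) (hn : n ≠ 0) : PlanarGraph (Fin m ⊕ Fin n) Unit where
  src := Sum.elim (fun _ => none) (fun _ => some ())
  tgt := Sum.elim (fun _ => some ()) (fun _ => none)
  lt := Sum.Lex (· < ·) (· < ·)
  vin _ := (List.finRange m).map Sum.inl
  vout _ := (List.finRange n).map Sum.inr
  ins := (List.finRange m).map Sum.inl
  outs := (List.finRange n).map Sum.inr
  lt_irrefl := by rintro (x | x) <;> simp
  lt_trans := by rintro (x | x) (y | y) (z | z) <;> simp <;> exact fun h h' => h.trans h'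
  lt_total := by rintro (x | x) (y | y) <;> simp <;> exact _root_.lt_trichotomy x y
  planar₁ := by
    refine planar₁_of_step ?_ ?_
    · rintro (x | x) (y | y) (z | z) <;> simp <;> exact fun h h' => h.trans h'
    · rintro (x | x) (y | y) ⟨v, h, h'⟩ <;> simp at h h' ⊢
  planar₂ := by
    have key : ∀ p q : Fin m ⊕ Fin n, Step (V := Unit) (Sum.elim (fun _ => none) fun _ => some ())
        (Sum.elim (fun _ => some ()) fun _ => none) p q ↔
        ∃ x y, p = Sum.inl x ∧ q = Sum.inr y := by
      rintro (p | p) (q | q) <;> simp [Step]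
    rintro (x | x) (y | y) (z | z) h h1 h2
    · obtain ⟨c, -, h⟩ := Relation.TransGen.tail'_iff.1 h
      simp [key] at h
    · exact Or.inl (.single ((key _ _).2 ⟨_, _, rfl, rfl⟩))
    · simp at h2
    · exact Or.inr (.single ((key _ _).2 ⟨_, _, rfl, rfl⟩))
    · simp at h1
    · simp at h1
    · simp at h2
    · obtain ⟨c, h, -⟩ := Relation.TransGen.head'_iff.1 h
      simp [key] at h
  vin_sorted _ := by simpa [List.pairwise_map] using List.pairwise_lt_finRange m
  vout_sorted _ := by simpa [List.pairwise_map] using List.pairwise_lt_finRange n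
  ins_sorted := by simpa [List.pairwise_map] using List.pairwise_lt_finRange m
  outs_sorted := by simpa [List.pairwise_map] using List.pairwise_lt_finRange n
  mem_vin := by rintro v (x | x) <;> simp
  mem_vout := by rintro v (x | x) <;> simp
  mem_ins := by rintro (x | x) <;> simp
  mem_outs := by rintro (x | x) <;> simp
  vin_ne_nil _ := by simpa using hm
  vout_ne_nil _ := by simpa using hn

/-! ### Compatible maps between composites -/

section laws

variable {E V E' V' F W : Type}

theorem Glue.map_outs_inL {G : PlanarGraph E V} {H : PlanarGraph E' V'}
    (hl : G.outs.length = H.ins.length) :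
    G.outs.map (Glue.inL hl) = (H.ins.map (Glue.inR hl) : List (Glue G H)) := by
  have h1 : (List.zip G.outs H.ins).map (fun p => (Glue.inL hl p.1 : Glue G H)) =
      (List.zip G.outs H.ins).map (fun p => (Glue.inR hl p.2 : Glue G H)) :=
    List.map_congr_left fun p hp => Glue.inL_eq_inR hl hp
  have h2 : (List.zip G.outs H.ins).map (fun p => (Glue.inL hl p.1 : Glue G H)) =
      ((List.zip G.outs H.ins).map Prod.fst).map (Glue.inL hl) := by rw [List.map_map]; rfl
  have h3 : (List.zip G.outs H.ins).map (fun p => (Glue.inR hl p.2 : Glue G H)) =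
      ((List.zip G.outs H.ins).map Prod.snd).map (Glue.inR hl) := by rw [List.map_map]; rfl
  rw [h2, h3, List.map_fst_zip hl.le, List.map_snd_zip hl.ge] at h1
  exact h1

theorem Matched.eq_of_map_eq {G : PlanarGraph E V} {H : PlanarGraph E' V'} {X : Type*}
    {f : E → X} {f' : E' → X} (h : G.outs.map f = H.ins.map f') {x : E} {y : E'}
    (hm : Matched G H x y) : f x = f' y := by
  unfold Matched at hm
  generalize G.outs = l at h hm
  generalize H.ins = l' at h hm
  induction l generalizing l' with
  | nil => simp at hm
  | cons a l ih =>
    cases l' with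
    | nil => simp at hm
    | cons b l' =>
      simp only [List.map_cons, List.cons.injEq] at h
      simp only [List.zip_cons_cons, List.mem_cons, Prod.mk.injEq] at hm
      rcases hm with ⟨rfl, rfl⟩ | hm
      · exact h.1
      · exact ih _ h.2 hm

variable [Finite E] [Finite E']

theorem Compat.of_comp {G : PlanarGraph E V} {H : PlanarGraph E' V'}
    {hl : G.outs.length = H.ins.length} {K : PlanarGraph F W} {f : E → F} {f' : E' → F}
    {w : V ⊕ V' ≃ W} (h0 : G.outs.map f = H.ins.map f')
    (hins : G.ins.map f = K.ins) (houts : H.outs.map f' = K.outs)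
    (hvin : ∀ v, (G.vin v).map f = K.vin (w (Sum.inl v)))
    (hvout : ∀ v, (G.vout v).map f = K.vout (w (Sum.inl v)))
    (hvin' : ∀ v, (H.vin v).map f' = K.vin (w (Sum.inr v)))
    (hvout' : ∀ v, (H.vout v).map f' = K.vout (w (Sum.inr v))) :
    Compat (comp G H hl) K (Glue.elim f f') w := by
  have hL : (fun x => Glue.elim f f' (Glue.inL hl x : Glue G H)) = f :=
    funext fun x => Glue.elim_inL hl f f' x
  have hR : (fun x => Glue.elim f f' (Glue.inR hl x : Glue G H)) = f' :=
    funext fun x => Glue.elim_inR hl f f' (fun _ _ hm => hm.eq_of_map_eq h0) x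
  constructor
  · simpa [comp, Function.comp_def, hL] using hins
  · simpa [comp, Function.comp_def, hR] using houts
  · rintro (v | v)
    · simpa [comp, Function.comp_def, hL] using hvin v
    · simpa [comp, Function.comp_def, hR] using hvin' v
  · rintro (v | v)
    · simpa [comp, Function.comp_def, hL] using hvout v
    · simpa [comp, Function.comp_def, hR] using hvout' v

theorem Compat.comp {E₁ V₁ E₁' V₁' : Type} [Finite E₁] [Finite E₁'] {G : PlanarGraph E V}
    {H : PlanarGraph E' V'} {G₁ : PlanarGraph E₁ V₁} {H₁ : PlanarGraph E₁' V₁'} {f : E → E₁}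
    {g : V ≃ V₁} {f' : E' → E₁'} {g' : V' ≃ V₁'} (h : Compat G G₁ f g) (h' : Compat H H₁ f' g')
    (hl : G.outs.length = H.ins.length) (hl₁ : G₁.outs.length = H₁.ins.length) :
    Compat (PlanarGraph.comp G H hl) (PlanarGraph.comp G₁ H₁ hl₁)
      (Glue.elim (Glue.inL hl₁ ∘ f) (Glue.inR hl₁ ∘ f')) (Equiv.sumCongr g g') := by
  apply Compat.of_comp
  · rw [← List.map_map, h.outs, ← List.map_map, h'.ins]
    exact Glue.map_outs_inL hl₁
  · rw [← List.map_map, h.ins]; rfl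
  · rw [← List.map_map, h'.outs]; rfl
  · intro v; rw [← List.map_map, h.vin]; rfl
  · intro v; rw [← List.map_map, h.vout]; rfl
  · intro v; rw [← List.map_map, h'.vin]; rfl
  · intro v; rw [← List.map_map, h'.vout]; rfl

theorem compat_assoc {E'' V'' : Type} [Finite E''] {G : PlanarGraph E V}
    {H : PlanarGraph E' V'} {K : PlanarGraph E'' V''}
    (h₁ : G.outs.length = H.ins.length) (h₂ : H.outs.length = K.ins.length)
    (h₃ : (comp G H h₁).outs.length = K.ins.length)
    (h₄ : G.outs.length = (comp H K h₂).ins.length) :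
    Compat (comp (comp G H h₁) K h₃) (comp G (comp H K h₂) h₄)
      (Glue.elim (Glue.elim (Glue.inL h₄) (Glue.inR h₄ ∘ Glue.inL h₂))
        (Glue.inR h₄ ∘ Glue.inR h₂)) (Equiv.sumAssoc V V' V'') := by
  have e : G.outs.map (Glue.inL h₄) = H.ins.map (Glue.inR h₄ ∘ Glue.inL h₂) := by
    rw [← List.map_map]; exact Glue.map_outs_inL h₄
  have hL : (fun x => Glue.elim (Glue.inL h₄) (Glue.inR h₄ ∘ Glue.inL h₂)
      (Glue.inL h₁ x : Glue G H)) = Glue.inL h₄ := funext fun x => Glue.elim_inL _ _ _ x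
  have hR : (fun x => Glue.elim (Glue.inL h₄) (Glue.inR h₄ ∘ Glue.inL h₂)
      (Glue.inR h₁ x : Glue G H)) = Glue.inR h₄ ∘ Glue.inL h₂ :=
    funext fun x => Glue.elim_inR _ _ _ (fun _ _ hm => hm.eq_of_map_eq e) x
  apply Compat.of_comp
  · simp only [comp, List.map_map, Function.comp_def] at hR ⊢
    rw [hR]
    have := congrArg (List.map (Glue.inR h₄)) (Glue.map_outs_inL h₂)
    simp only [List.map_map, Function.comp_def] at this
    exact this
  · simp only [comp, List.map_map, Function.comp_def] at hL ⊢
    rw [hL]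
  · simp only [comp, List.map_map]
  · rintro (v | v)
    · simp only [comp, List.map_map, Function.comp_def, Sum.elim_inl] at hL ⊢
      rw [hL]; rfl
    · simp only [comp, List.map_map, Function.comp_def, Sum.elim_inr] at hR ⊢
      rw [hR]; simp [Function.comp_def]
  · rintro (v | v)
    · simp only [comp, List.map_map, Function.comp_def, Sum.elim_inl] at hL ⊢
      rw [hL]; rfl
    · simp only [comp, List.map_map, Function.comp_def, Sum.elim_inr] at hR ⊢
      rw [hR]; simp [Function.comp_def]
  · intro v; simp [comp, Function.comp_def]
  · intro v; simp [comp, Function.comp_def]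

theorem map_finRange_get {α : Type*} {l : List α} {n : ℕ} (h : n = l.length) :
    (List.finRange n).map (fun i => l.get (i.cast h)) = l := by
  subst h; exact List.map_get_finRange l

theorem compat_unit_comp {G : PlanarGraph E V} {n : ℕ} (hn : n = G.ins.length)
    (hl : (unit n).outs.length = G.ins.length) :
    Compat (comp (unit n) G hl) G (Glue.elim (fun i : Fin n => G.ins.get (i.cast hn)) id)
      (Equiv.emptySum Empty V) := by
  apply Compat.of_comp
  · rw [List.map_id]; exact map_finRange_get hn
  · exact map_finRange_get hn
  · simp
  · intro v; exact v.elim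
  · intro v; exact v.elim
  · intro v; simp
  · intro v; simp

theorem compat_comp_unit {G : PlanarGraph E V} {n : ℕ} (hn : n = G.outs.length)
    (hl : G.outs.length = (unit n).ins.length) :
    Compat (comp G (unit n) hl) G (Glue.elim id (fun i : Fin n => G.outs.get (i.cast hn)))
      (Equiv.sumEmpty V Empty) := by
  apply Compat.of_comp
  · rw [List.map_id]; exact (map_finRange_get hn).symm
  · simp
  · exact map_finRange_get hn
  · intro v; simp
  · intro v; simp
  · intro v; exact v.elim
  · intro v; exact v.elim

theorem compat_interchange {E₁ V₁ E₁' V₁' : Type} [Finite E₁] [Finite E₁'] {G : PlanarGraph E V}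
    {H : PlanarGraph E' V'} {G₁ : PlanarGraph E₁ V₁} {H₁ : PlanarGraph E₁' V₁'}
    (hl : G.outs.length = H.ins.length) (hl₁ : G₁.outs.length = H₁.ins.length)
    (h : (tensor G G₁).outs.length = (tensor H H₁).ins.length) :
    Compat (comp (tensor G G₁) (tensor H H₁) h) (tensor (comp G H hl) (comp G₁ H₁ hl₁))
      (Glue.elim (Sum.map (Glue.inL hl) (Glue.inL hl₁)) (Sum.map (Glue.inR hl) (Glue.inR hl₁)))
      (Equiv.sumSumSumComm V V₁ V' V₁') := by
  have e := congrArg (List.map (Sum.inl : _ → Glue G H ⊕ Glue G₁ H₁)) (Glue.map_outs_inL hl)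
  have e₁ := congrArg (List.map (Sum.inr : _ → Glue G H ⊕ Glue G₁ H₁)) (Glue.map_outs_inL hl₁)
  simp only [List.map_map] at e e₁
  apply Compat.of_comp
  · simp only [tensor, List.map_append, List.map_map, Function.comp_def, Sum.map_inl,
      Sum.map_inr] at e e₁ ⊢
    rw [e, e₁]
  · simp [tensor, comp, Function.comp_def]
  · simp [tensor, comp, Function.comp_def]
  · rintro (v | v) <;> simp [tensor, comp, Function.comp_def]
  · rintro (v | v) <;> simp [tensor, comp, Function.comp_def]
  · rintro (v | v) <;> simp [tensor, comp, Function.comp_def]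
  · rintro (v | v) <;> simp [tensor, comp, Function.comp_def]

end laws

section tensorLaws

variable {E V E' V' E'' V'' : Type}

theorem Compat.tensor {E₁ V₁ E₁' V₁' : Type} {G : PlanarGraph E V}
    {H : PlanarGraph E' V'} {G₁ : PlanarGraph E₁ V₁} {H₁ : PlanarGraph E₁' V₁'} {f : E → E₁}
    {g : V ≃ V₁} {f' : E' → E₁'} {g' : V' ≃ V₁'} (h : Compat G G₁ f g) (h' : Compat H H₁ f' g') :
    Compat (PlanarGraph.tensor G H) (PlanarGraph.tensor G₁ H₁) (Sum.map f f')
      (Equiv.sumCongr g g') := by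
  constructor
  · simp [PlanarGraph.tensor, ← h.ins, ← h'.ins, Function.comp_def]
  · simp [PlanarGraph.tensor, ← h.outs, ← h'.outs, Function.comp_def]
  · rintro (v | v) <;>
      simp [PlanarGraph.tensor, ← h.vin, ← h'.vin, Function.comp_def]
  · rintro (v | v) <;>
      simp [PlanarGraph.tensor, ← h.vout, ← h'.vout, Function.comp_def]

theorem compat_tensor_assoc (G : PlanarGraph E V) (H : PlanarGraph E' V')
    (K : PlanarGraph E'' V'') :
    Compat (tensor (tensor G H) K) (tensor G (tensor H K)) (Equiv.sumAssoc E E' E'')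
      (Equiv.sumAssoc V V' V'') := by
  constructor
  · simp [tensor, Function.comp_def]
  · simp [tensor, Function.comp_def]
  · rintro ((v | v) | v) <;> simp [tensor, Function.comp_def]
  · rintro ((v | v) | v) <;> simp [tensor, Function.comp_def]

theorem compat_unit_tensor (G : PlanarGraph E V) :
    Compat (tensor (unit 0) G) G (Equiv.emptySum (Fin 0) E) (Equiv.emptySum Empty V) := by
  constructor
  · simp [tensor, unit, Function.comp_def]
  · simp [tensor, unit, Function.comp_def]
  · rintro (v | v)
    · exact v.elim
    · simp [tensor, Function.comp_def]
  · rintro (v | v)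
    · exact v.elim
    · simp [tensor, Function.comp_def]

theorem compat_tensor_unit (G : PlanarGraph E V) :
    Compat (tensor G (unit 0)) G (Equiv.sumEmpty E (Fin 0)) (Equiv.sumEmpty V Empty) := by
  constructor
  · simp [tensor, unit, Function.comp_def]
  · simp [tensor, unit, Function.comp_def]
  · rintro (v | v)
    · simp [tensor, Function.comp_def]
    · exact v.elim
  · rintro (v | v)
    · simp [tensor, Function.comp_def]
    · exact v.elim

theorem finRange_sum (m n : ℕ) :
    ((List.finRange m).map Sum.inl ++ (List.finRange n).map Sum.inr).map finSumFinEquiv =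
      List.finRange (m + n) := by
  apply List.ext_getElem
  · simp
  · intro i h1 h2
    simp only [List.length_map, List.length_append, List.length_finRange] at h1
    simp only [List.getElem_map, List.getElem_append, List.length_map, List.length_finRange,
      List.getElem_finRange]
    split <;> (ext; simp; try omega)

theorem compat_unit_unit (m n k : ℕ) (h : m + n = k) :
    Compat (tensor (unit m) (unit n)) (unit k) (fun x => (finSumFinEquiv x).cast h)
      (Equiv.emptySum Empty Empty) := by
  subst h
  constructor
  · exact finRange_sum m n
  · exact finRange_sum m n
  · rintro (v | v) <;> exact v.elim
  · rintro (v | v) <;> exact v.elim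

theorem compat_unit_cast (m n : ℕ) (h : m = n) :
    Compat (unit m) (unit n) (Fin.cast h) (Equiv.refl Empty) := by
  subst h; exact ⟨by simp, by simp, fun v => v.elim, fun v => v.elim⟩

end tensorLaws

end PlanarGraph

/-! ## Diagrams -/

namespace PlanarGraph

variable {E V E' V' : Type}

/-- Two planar graphs related by bijections respecting sources, targets and planar structures. -/
theorem compat_of_iso {G : PlanarGraph E V} {H : PlanarGraph E' V'} {e : E ≃ E'} {g : V ≃ V'}
    (hs : ∀ x, H.src (e x) = (G.src x).map g) (ht : ∀ x, H.tgt (e x) = (G.tgt x).map g)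
    (hlt : ∀ x y, H.lt (e x) (e y) ↔ G.lt x y) : Compat G H e g := by
  have key : ∀ (l : List E) (l' : List E'), l.Pairwise G.lt → l'.Pairwise H.lt →
      (∀ x, e x ∈ l' ↔ x ∈ l) → l.map e = l' := by
    intro l l' h h' hm
    have h1 : (l.map e).Pairwise H.lt := List.pairwise_map.2 (h.imp (hlt _ _).2)
    refine ((List.perm_ext_iff_of_nodup (H.nodup_of_sorted h1) (H.nodup_of_sorted h')).2
      fun y => ?_).eq_of_pairwise (fun a b _ _ h h' => (H.lt_asymm h h').elim) h1 h'
    obtain ⟨x, rfl⟩ := e.surjective y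
    rw [hm]; simp
  constructor
  · exact key _ _ G.ins_sorted H.ins_sorted fun x => by simp [H.mem_ins, G.mem_ins, hs]
  · exact key _ _ G.outs_sorted H.outs_sorted fun x => by simp [H.mem_outs, G.mem_outs, ht]
  · intro v
    exact key _ _ (G.vin_sorted v) (H.vin_sorted _) fun x => by simp [H.mem_vin, G.mem_vin, ht]
  · intro v
    exact key _ _ (G.vout_sorted v) (H.vout_sorted _) fun x => by
      simp [H.mem_vout, G.mem_vout, hs]

theorem Compat.id (G : PlanarGraph E V) : Compat G G id (Equiv.refl V) := by
  constructor <;> simp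

theorem Compat.symm {G : PlanarGraph E V} {H : PlanarGraph E' V'} {e : E ≃ E'} {g : V ≃ V'}
    (h : Compat G H e g) : Compat H G e.symm g.symm := by
  constructor
  · simp [← h.ins]
  · simp [← h.outs]
  · intro v; rw [← g.apply_symm_apply v, ← h.vin]; simp
  · intro v; rw [← g.apply_symm_apply v, ← h.vout]; simp

theorem reach_comp_equiv (G : PlanarGraph E V) (e : E ≃ E') (g : V ≃ V') {x y : E'}
    (h : Reach (fun y => (G.src (e.symm y)).map g) (fun y => (G.tgt (e.symm y)).map g) x y) :
    Reach G.src G.tgt (e.symm x) (e.symm y) := by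
  refine Relation.TransGen.lift e.symm ?_ _ _ h
  rintro a b ⟨v, h1, h2⟩
  obtain ⟨w, hw, rfl⟩ := Option.map_eq_some_iff.1 h1
  obtain ⟨w', hw', e⟩ := Option.map_eq_some_iff.1 h2
  exact ⟨w, hw, by rw [hw', g.injective e]⟩

theorem reach_comp_equiv' (G : PlanarGraph E V) (e : E ≃ E') (g : V ≃ V') {x y : E'}
    (h : Reach G.src G.tgt (e.symm x) (e.symm y)) :
    Reach (fun y => (G.src (e.symm y)).map g) (fun y => (G.tgt (e.symm y)).map g) x y := by
  have := Relation.TransGen.lift (p := Step (fun y => (G.src (e.symm y)).map g)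
    (fun y => (G.tgt (e.symm y)).map g)) e ?_ _ _ h
  · simp only [Function.onFun, Equiv.apply_symm_apply] at this
    exact this
  · rintro a b ⟨v, h1, h2⟩
    exact ⟨g v, by simp [h1], by simp [h2]⟩

/-- Renaming the edges and the vertices. -/
def reindex (G : PlanarGraph E V) (e : E ≃ E') (g : V ≃ V') : PlanarGraph E' V' where
  src y := (G.src (e.symm y)).map g
  tgt y := (G.tgt (e.symm y)).map g
  lt x y := G.lt (e.symm x) (e.symm y)
  vin v := (G.vin (g.symm v)).map e
  vout v := (G.vout (g.symm v)).map e
  ins := G.ins.map e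
  outs := G.outs.map e
  lt_irrefl _ := G.lt_irrefl _
  lt_trans _ _ _ := G.lt_trans _ _ _
  lt_total x y := by simpa using G.lt_total (e.symm x) (e.symm y)
  planar₁ x y h := G.planar₁ _ _ (G.reach_comp_equiv e g h)
  planar₂ x y z h h1 h2 := by
    rcases G.planar₂ _ _ _ (G.reach_comp_equiv e g h) h1 h2 with h | h
    · exact Or.inl (G.reach_comp_equiv' e g h)
    · exact Or.inr (G.reach_comp_equiv' e g h)
  vin_sorted v := by simpa [List.pairwise_map] using G.vin_sorted _
  vout_sorted v := by simpa [List.pairwise_map] using G.vout_sorted _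
  ins_sorted := by simpa [List.pairwise_map] using G.ins_sorted
  outs_sorted := by simpa [List.pairwise_map] using G.outs_sorted
  mem_vin v x := by
    obtain ⟨x, rfl⟩ := e.surjective x
    obtain ⟨v, rfl⟩ := g.surjective v
    simp [G.mem_vin]
  mem_vout v x := by
    obtain ⟨x, rfl⟩ := e.surjective x
    obtain ⟨v, rfl⟩ := g.surjective v
    simp [G.mem_vout]
  mem_ins x := by
    obtain ⟨x, rfl⟩ := e.surjective x
    simp [G.mem_ins]
  mem_outs x := by
    obtain ⟨x, rfl⟩ := e.surjective x
    simp [G.mem_outs]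
  vin_ne_nil v := by simpa using G.vin_ne_nil _
  vout_ne_nil v := by simpa using G.vout_ne_nil _

theorem compat_reindex (G : PlanarGraph E V) (e : E ≃ E') (g : V ≃ V') :
    Compat G (G.reindex e g) e g := by
  constructor <;> simp [reindex]

end PlanarGraph

/-- The data used to decorate planar graphs: colours for the edges, decorations for the vertices,
and the relation saying that a decoration fits a list of inputs and a list of outputs. -/
structure Sig where
  O : Type u
  M : Type u
  typ : M → List O → List O → Prop

namespace Sig

/-- Morphisms of decorating data. -/
@[ext]
structure Hom (S T : Sig.{u}) where
  o : S.O → T.O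
  m : S.M → T.M
  typ : ∀ f a b, S.typ f a b → T.typ (m f) (a.map o) (b.map o)

end Sig

/-- A planar diagram: a planar graph whose edges are coloured and whose vertices are decorated
compatibly. -/
structure Diagram (S : Sig.{u}) (E V : Type) where
  graph : PlanarGraph E V
  col : E → S.O
  dec : V → S.M
  typ : ∀ v, S.typ (dec v) ((graph.vin v).map col) ((graph.vout v).map col)

namespace Diagram

variable {S T : Sig.{u}} {E V E' V' E'' V'' : Type}

/-- The domain of a diagram: the word of the colours of its inputs. -/
def dom (A : Diagram S E V) : List S.O := A.graph.ins.map A.col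

/-- The codomain of a diagram: the word of the colours of its outputs. -/
def cod (A : Diagram S E V) : List S.O := A.graph.outs.map A.col

/-- An isomorphism of diagrams: bijections of edges and vertices respecting sources, targets,
planar structures, colours and decorations. -/
structure IsIso (A : Diagram S E V) (B : Diagram S E' V') (e : E ≃ E') (g : V ≃ V') : Prop where
  src : ∀ x, B.graph.src (e x) = (A.graph.src x).map g
  tgt : ∀ x, B.graph.tgt (e x) = (A.graph.tgt x).map g
  lt : ∀ x y, B.graph.lt (e x) (e y) ↔ A.graph.lt x y
  col : ∀ x, B.col (e x) = A.col x
  dec : ∀ v, B.dec (g v) = A.dec v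

theorem IsIso.compat {A : Diagram S E V} {B : Diagram S E' V'} {e : E ≃ E'} {g : V ≃ V'}
    (h : IsIso A B e g) : PlanarGraph.Compat A.graph B.graph e g :=
  PlanarGraph.compat_of_iso h.src h.tgt h.lt

theorem IsIso.refl (A : Diagram S E V) : IsIso A A (Equiv.refl E) (Equiv.refl V) := by
  constructor <;> simp

theorem IsIso.symm {A : Diagram S E V} {B : Diagram S E' V'} {e : E ≃ E'} {g : V ≃ V'}
    (h : IsIso A B e g) : IsIso B A e.symm g.symm := by
  constructor
  · intro x; obtain ⟨x, rfl⟩ := e.surjective x; simp [h.src]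
  · intro x; obtain ⟨x, rfl⟩ := e.surjective x; simp [h.tgt]
  · intro x y; rw [← h.lt]; simp
  · intro x; rw [← h.col]; simp
  · intro x; rw [← h.dec]; simp

theorem IsIso.trans {A : Diagram S E V} {B : Diagram S E' V'} {C : Diagram S E'' V''}
    {e : E ≃ E'} {g : V ≃ V'} {e' : E' ≃ E''} {g' : V' ≃ V''}
    (h : IsIso A B e g) (h' : IsIso B C e' g') : IsIso A C (e.trans e') (g.trans g') := by
  constructor
  · intro x; simp [h.src, h'.src]
  · intro x; simp [h.tgt, h'.tgt]
  · intro x y; simp [h.lt, h'.lt]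
  · intro x; simp [h.col, h'.col]
  · intro x; simp [h.dec, h'.dec]

/-- Two diagrams are isomorphic. -/
def Iso (A : Diagram S E V) (B : Diagram S E' V') : Prop :=
  ∃ (e : E ≃ E') (g : V ≃ V'), IsIso A B e g

theorem isIso_of_compat [Finite E] {A : Diagram S E V} {B : Diagram S E' V'} {e : E ≃ E'}
    {g : V ≃ V'} (h : PlanarGraph.Compat A.graph B.graph e g) (hc : ∀ x, B.col (e x) = A.col x)
    (hd : ∀ v, B.dec (g v) = A.dec v) : IsIso A B e g :=
  ⟨h.src_eq, h.tgt_eq, fun _ _ => h.lt_iff, hc, hd⟩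

theorem Iso.of_compat [Finite E] {A : Diagram S E V} {B : Diagram S E' V'} {f : E → E'}
    {g : V ≃ V'} (h : PlanarGraph.Compat A.graph B.graph f g) (hc : ∀ x, B.col (f x) = A.col x)
    (hd : ∀ v, B.dec (g v) = A.dec v) : Iso A B :=
  ⟨Equiv.ofBijective f ⟨h.injective, h.surjective⟩, g, isIso_of_compat h hc hd⟩

theorem Iso.refl (A : Diagram S E V) : Iso A A := ⟨_, _, IsIso.refl A⟩

theorem Iso.symm {A : Diagram S E V} {B : Diagram S E' V'} (h : Iso A B) : Iso B A := by
  obtain ⟨_, _, h⟩ := h; exact ⟨_, _, h.symm⟩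

theorem Iso.trans {A : Diagram S E V} {B : Diagram S E' V'} {C : Diagram S E'' V''}
    (h : Iso A B) (h' : Iso B C) : Iso A C := by
  obtain ⟨_, _, h⟩ := h; obtain ⟨_, _, h'⟩ := h'; exact ⟨_, _, h.trans h'⟩

theorem Iso.dom_eq {A : Diagram S E V} {B : Diagram S E' V'} (h : Iso A B) : A.dom = B.dom := by
  obtain ⟨e, g, h⟩ := h
  rw [dom, dom, ← h.compat.ins, List.map_map]
  exact List.map_congr_left fun x _ => (h.col x).symm

theorem Iso.cod_eq {A : Diagram S E V} {B : Diagram S E' V'} (h : Iso A B) : A.cod = B.cod := by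
  obtain ⟨e, g, h⟩ := h
  rw [cod, cod, ← h.compat.outs, List.map_map]
  exact List.map_congr_left fun x _ => (h.col x).symm

/-- Renaming the edges and the vertices of a diagram. -/
def reindex (A : Diagram S E V) (e : E ≃ E') (g : V ≃ V') : Diagram S E' V' where
  graph := A.graph.reindex e g
  col y := A.col (e.symm y)
  dec v := A.dec (g.symm v)
  typ v := by
    simpa [PlanarGraph.reindex, Function.comp_def] using A.typ (g.symm v)

theorem iso_reindex (A : Diagram S E V) (e : E ≃ E') (g : V ≃ V') : Iso A (A.reindex e g) :=
  ⟨e, g, by constructor <;> simp [reindex, PlanarGraph.reindex]⟩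

/-- Changing the colours and the decorations. -/
def map (φ : Sig.Hom S T) (A : Diagram S E V) : Diagram T E V where
  graph := A.graph
  col x := φ.o (A.col x)
  dec v := φ.m (A.dec v)
  typ v := by simpa [Function.comp_def] using φ.typ _ _ _ (A.typ v)

theorem IsIso.map (φ : Sig.Hom S T) {A : Diagram S E V} {B : Diagram S E' V'} {e : E ≃ E'}
    {g : V ≃ V'} (h : IsIso A B e g) : IsIso (A.map φ) (B.map φ) e g :=
  ⟨h.src, h.tgt, h.lt, fun x => congrArg φ.o (h.col x), fun x => congrArg φ.m (h.dec x)⟩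

theorem Iso.map (φ : Sig.Hom S T) {A : Diagram S E V} {B : Diagram S E' V'} (h : Iso A B) :
    Iso (A.map φ) (B.map φ) := by
  obtain ⟨_, _, h⟩ := h; exact ⟨_, _, h.map φ⟩

/-- The tensor product of two diagrams. -/
def tensor (A : Diagram S E V) (B : Diagram S E' V') : Diagram S (E ⊕ E') (V ⊕ V') where
  graph := A.graph.tensor B.graph
  col := Sum.elim A.col B.col
  dec := Sum.elim A.dec B.dec
  typ := by
    rintro (v | v)
    · simpa [PlanarGraph.tensor, Function.comp_def] using A.typ v
    · simpa [PlanarGraph.tensor, Function.comp_def] using B.typ v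

theorem length_of_cod_eq_dom {A : Diagram S E V} {B : Diagram S E' V'} (h : A.cod = B.dom) :
    A.graph.outs.length = B.graph.ins.length := by
  have := congrArg List.length h
  simpa [dom, cod] using this

theorem glue_col_inR {A : Diagram S E V} {B : Diagram S E' V'} (h : A.cod = B.dom) (y : E') :
    PlanarGraph.Glue.elim A.col B.col (PlanarGraph.Glue.inR (length_of_cod_eq_dom h) y :
      PlanarGraph.Glue A.graph B.graph) = B.col y :=
  PlanarGraph.Glue.elim_inR _ _ _ (fun _ _ hm => hm.eq_of_map_eq h) y

/-- The composition `B ∘ A` of two diagrams. -/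
noncomputable def comp [Finite E] [Finite E'] (A : Diagram S E V) (B : Diagram S E' V')
    (h : A.cod = B.dom) : Diagram S (PlanarGraph.Glue A.graph B.graph) (V ⊕ V') where
  graph := A.graph.comp B.graph (length_of_cod_eq_dom h)
  col := PlanarGraph.Glue.elim A.col B.col
  dec := Sum.elim A.dec B.dec
  typ := by
    rintro (v | v)
    · simpa [PlanarGraph.comp, Function.comp_def, PlanarGraph.Glue.elim_inL] using A.typ v
    · simpa [PlanarGraph.comp, Function.comp_def, glue_col_inR h] using B.typ v

/-- The identity diagram of a word. -/
def unit (S : Sig.{u}) (w : List S.O) : Diagram S (Fin w.length) Empty where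
  graph := PlanarGraph.unit w.length
  col := w.get
  dec v := v.elim
  typ v := v.elim

/-- The prime diagram with one vertex decorated by `f`, inputs `a` and outputs `b`. -/
def corolla (f : S.M) (a b : List S.O) (ha : a ≠ []) (hb : b ≠ []) (h : S.typ f a b) :
    Diagram S (Fin a.length ⊕ Fin b.length) Unit where
  graph := PlanarGraph.corolla a.length b.length (by simpa using ha) (by simpa using hb)
  col := Sum.elim a.get b.get
  dec _ := f
  typ _ := by
    simpa [PlanarGraph.corolla, Function.comp_def] using h

theorem dom_tensor (A : Diagram S E V) (B : Diagram S E' V') :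
    (A.tensor B).dom = A.dom ++ B.dom := by
  simp [dom, tensor, PlanarGraph.tensor, Function.comp_def]

theorem cod_tensor (A : Diagram S E V) (B : Diagram S E' V') :
    (A.tensor B).cod = A.cod ++ B.cod := by
  simp [cod, tensor, PlanarGraph.tensor, Function.comp_def]

theorem dom_comp [Finite E] [Finite E'] (A : Diagram S E V) (B : Diagram S E' V')
    (h : A.cod = B.dom) : (A.comp B h).dom = A.dom := by
  simp [dom, comp, PlanarGraph.comp, Function.comp_def, PlanarGraph.Glue.elim_inL]

theorem cod_comp [Finite E] [Finite E'] (A : Diagram S E V) (B : Diagram S E' V')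
    (h : A.cod = B.dom) : (A.comp B h).cod = B.cod := by
  simp [cod, comp, PlanarGraph.comp, Function.comp_def, glue_col_inR h]

theorem dom_unit (w : List S.O) : (unit S w).dom = w := List.map_get_finRange w

theorem cod_unit (w : List S.O) : (unit S w).cod = w := List.map_get_finRange w

theorem dom_corolla (f : S.M) (a b : List S.O) (ha : a ≠ []) (hb : b ≠ []) (h : S.typ f a b) :
    (corolla f a b ha hb h).dom = a := by
  simp [dom, corolla, PlanarGraph.corolla, Function.comp_def]

theorem cod_corolla (f : S.M) (a b : List S.O) (ha : a ≠ []) (hb : b ≠ []) (h : S.typ f a b) :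
    (corolla f a b ha hb h).cod = b := by
  simp [cod, corolla, PlanarGraph.corolla, Function.comp_def]

end Diagram

/-- A diagram on standard finite sets of edges and vertices. -/
structure Rep (S : Sig.{u}) where
  nE : ℕ
  nV : ℕ
  diag : Diagram S (Fin nE) (Fin nV)

/-- Isomorphism of diagrams as an equivalence relation. -/
def Rep.setoid (S : Sig.{u}) : Setoid (Rep S) where
  r A B := A.diag.Iso B.diag
  iseqv := ⟨fun A => Diagram.Iso.refl A.diag, fun h => h.symm, fun h h' => h.trans h'⟩

/-- Isomorphism classes of finite planar diagrams. -/
def Diag (S : Sig.{u}) : Type u := Quotient (Rep.setoid S)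

namespace Diag

variable {S T : Sig.{u}} {E V E' V' E'' V'' : Type}
variable [Finite E] [Finite V] [Finite E'] [Finite V'] [Finite E''] [Finite V'']

/-- The isomorphism class of a finite diagram. -/
noncomputable def cls (A : Diagram S E V) : Diag S :=
  Quotient.mk (Rep.setoid S) ⟨_, _, A.reindex (Finite.equivFin E) (Finite.equivFin V)⟩

/-- A diagram on standard finite sets representing the class `d`. -/
noncomputable def rep (d : Diag S) : Rep S := Quotient.out d

theorem cls_eq_iff {A : Diagram S E V} {B : Diagram S E' V'} : cls A = cls B ↔ A.Iso B := by
  refine (Quotient.eq (r := Rep.setoid S)).trans ?_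
  constructor
  · intro h
    exact (A.iso_reindex _ _).trans (Diagram.Iso.trans h (B.iso_reindex _ _).symm)
  · intro h
    exact (A.iso_reindex _ _).symm.trans (Diagram.Iso.trans h (B.iso_reindex _ _))

theorem cls_rep (d : Diag S) : cls d.rep.diag = d := by
  conv_rhs => rw [← Quotient.out_eq d]
  exact Quotient.sound (d.rep.diag.iso_reindex _ _).symm

theorem rep_iso (A : Diagram S E V) : (cls A).rep.diag.Iso A :=
  cls_eq_iff.1 (cls_rep _)

@[elab_as_elim]
theorem ind {P : Diag S → Prop} (h : ∀ (n k : ℕ) (A : Diagram S (Fin n) (Fin k)), P (cls A))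
    (d : Diag S) : P d := by
  rw [← cls_rep d]; exact h _ _ _

/-- The domain of a diagram. -/
def dom (d : Diag S) : List S.O :=
  Quotient.lift (fun A => A.diag.dom) (fun _ _ h => Diagram.Iso.dom_eq h) d

/-- The codomain of a diagram. -/
def cod (d : Diag S) : List S.O :=
  Quotient.lift (fun A => A.diag.cod) (fun _ _ h => Diagram.Iso.cod_eq h) d

theorem dom_cls (A : Diagram S E V) : dom (cls A) = A.dom := (A.iso_reindex _ _).dom_eq.symm

theorem cod_cls (A : Diagram S E V) : cod (cls A) = A.cod := (A.iso_reindex _ _).cod_eq.symm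

theorem dom_rep (d : Diag S) : d.rep.diag.dom = d.dom := by
  conv_rhs => rw [← cls_rep d, dom_cls]

theorem cod_rep (d : Diag S) : d.rep.diag.cod = d.cod := by
  conv_rhs => rw [← cls_rep d, cod_cls]

/-- Changing the colours and the decorations. -/
def map (φ : Sig.Hom S T) (d : Diag S) : Diag T :=
  Quotient.map (sa := Rep.setoid S) (sb := Rep.setoid T)
    (fun A => ⟨A.nE, A.nV, A.diag.map φ⟩) (fun _ _ h => h.map φ) d

theorem map_cls (φ : Sig.Hom S T) (A : Diagram S E V) : map φ (cls A) = cls (A.map φ) :=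
  rfl

/-- The tensor product of two diagrams. -/
noncomputable def tensor (a b : Diag S) : Diag S := cls (a.rep.diag.tensor b.rep.diag)

/-- The composition `b ∘ a` of two diagrams. -/
noncomputable def comp (a b : Diag S) (h : a.cod = b.dom) : Diag S :=
  cls (a.rep.diag.comp b.rep.diag (by rw [cod_rep, dom_rep, h]))

/-- The identity diagram of a word. -/
noncomputable def unit (w : List S.O) : Diag S := cls (Diagram.unit S w)

/-- The prime diagram with one vertex decorated by `f`. -/
noncomputable def corolla (f : S.M) (a b : List S.O) (ha : a ≠ []) (hb : b ≠ [])
    (h : S.typ f a b) : Diag S := cls (Diagram.corolla f a b ha hb h)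

theorem tensor_cls (A : Diagram S E V) (B : Diagram S E' V') :
    tensor (cls A) (cls B) = cls (A.tensor B) := by
  rw [tensor, cls_eq_iff]
  obtain ⟨e, g, h⟩ := rep_iso A
  obtain ⟨e', g', h'⟩ := rep_iso B
  refine Diagram.Iso.of_compat (h.compat.tensor h'.compat) ?_ ?_
  · rintro (x | x)
    · exact h.col x
    · exact h'.col x
  · rintro (x | x)
    · exact h.dec x
    · exact h'.dec x

theorem comp_cls (A : Diagram S E V) (B : Diagram S E' V') (h) :
    comp (cls A) (cls B) h = cls (A.comp B (by rwa [cod_cls, dom_cls] at h)) := by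
  rw [comp, cls_eq_iff]
  have hAB : A.cod = B.dom := by rwa [cod_cls, dom_cls] at h
  obtain ⟨e, g, h⟩ := rep_iso A
  obtain ⟨e', g', h'⟩ := rep_iso B
  refine Diagram.Iso.of_compat (h.compat.comp h'.compat _ _) ?_ ?_
  · rintro (⟨x, hx⟩ | ⟨x, y, hx⟩ | ⟨x, hx⟩)
    · exact (PlanarGraph.Glue.elim_inL (Diagram.length_of_cod_eq_dom hAB) _ _ _).trans (h.col x)
    · exact (PlanarGraph.Glue.elim_inL (Diagram.length_of_cod_eq_dom hAB) _ _ _).trans (h.col x)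
    · exact (Diagram.glue_col_inR hAB _).trans (h'.col x)
  · rintro (x | x)
    · exact h.dec x
    · exact h'.dec x

theorem dom_tensor (a b : Diag S) : (tensor a b).dom = a.dom ++ b.dom := by
  rw [tensor, dom_cls, Diagram.dom_tensor, dom_rep, dom_rep]

theorem cod_tensor (a b : Diag S) : (tensor a b).cod = a.cod ++ b.cod := by
  rw [tensor, cod_cls, Diagram.cod_tensor, cod_rep, cod_rep]

theorem dom_comp (a b : Diag S) (h) : (comp a b h).dom = a.dom := by
  rw [comp, dom_cls, Diagram.dom_comp, dom_rep]

theorem cod_comp (a b : Diag S) (h) : (comp a b h).cod = b.cod := by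
  rw [comp, cod_cls, Diagram.cod_comp, cod_rep]

theorem dom_unit (w : List S.O) : (unit w).dom = w := by
  rw [unit, dom_cls, Diagram.dom_unit]

theorem cod_unit (w : List S.O) : (unit w).cod = w := by
  rw [unit, cod_cls, Diagram.cod_unit]

theorem dom_corolla (f : S.M) (a b : List S.O) (ha : a ≠ []) (hb : b ≠ []) (h : S.typ f a b) :
    (corolla f a b ha hb h).dom = a := by
  rw [corolla, dom_cls, Diagram.dom_corolla]

theorem cod_corolla (f : S.M) (a b : List S.O) (ha : a ≠ []) (hb : b ≠ []) (h : S.typ f a b) :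
    (corolla f a b ha hb h).cod = b := by
  rw [corolla, cod_cls, Diagram.cod_corolla]

theorem dom_map (φ : Sig.Hom S T) (d : Diag S) : (map φ d).dom = d.dom.map φ.o := by
  induction d using ind with | h n k A => 
  rw [map_cls, dom_cls, dom_cls]
  simp [Diagram.dom, Diagram.map, Function.comp_def]

theorem cod_map (φ : Sig.Hom S T) (d : Diag S) : (map φ d).cod = d.cod.map φ.o := by
  induction d using ind with | h n k A => 
  rw [map_cls, cod_cls, cod_cls]
  simp [Diagram.cod, Diagram.map, Function.comp_def]

theorem unit_comp (w : List S.O) (d : Diag S) (h) : comp (unit w) d h = d := by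
  induction d using ind with | h n k A => 
  obtain rfl : w = A.dom := by rwa [cod_unit, dom_cls] at h
  refine (comp_cls (Diagram.unit S A.dom) A h).trans (cls_eq_iff.2 ?_)
  refine Diagram.Iso.of_compat (PlanarGraph.compat_unit_comp (by simp [Diagram.dom]) _) ?_ ?_
  · rintro (⟨x, hx⟩ | ⟨x, y, hx⟩ | ⟨x, hx⟩)
    · exact (hx rfl).elim
    · simp only [PlanarGraph.Glue.elim, Diagram.comp, Diagram.unit, List.get_eq_getElem]
      exact (List.getElem_map A.col).symm
    · rfl
  · rintro (x | x)
    · exact x.elim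
    · rfl

theorem comp_unit (w : List S.O) (d : Diag S) (h) : comp d (unit w) h = d := by
  induction d using ind with | h n k A => 
  obtain rfl : A.cod = w := by rwa [dom_unit, cod_cls] at h
  refine (comp_cls A (Diagram.unit S A.cod) h).trans (cls_eq_iff.2 ?_)
  refine Diagram.Iso.of_compat (PlanarGraph.compat_comp_unit (by simp [Diagram.cod]) _) ?_ ?_
  · rintro (⟨x, hx⟩ | ⟨x, y, hx⟩ | ⟨x, hx⟩)
    · rfl
    · rfl
    · exact (hx rfl).elim
  · rintro (x | x)
    · rfl
    · exact x.elim

theorem comp_assoc (a b c : Diag S) (h₁ h₂ h₃ h₄) :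
    comp (comp a b h₁) c h₃ = comp a (comp b c h₂) h₄ := by
  induction a using ind with | h n k A => 
  induction b using ind with | h n' k' B => 
  induction c using ind with | h n'' k'' C => 
  simp only [comp_cls, cls_eq_iff]
  refine Diagram.Iso.of_compat (PlanarGraph.compat_assoc (Diagram.length_of_cod_eq_dom
    (by rwa [cod_cls, dom_cls] at h₁)) (Diagram.length_of_cod_eq_dom
    (by rwa [cod_cls, dom_cls] at h₂)) _ _) ?_ ?_
  · have hBC : B.cod = C.dom := by rwa [cod_cls, dom_cls] at h₂
    have hABC : A.cod = (B.comp C hBC).dom := by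
      rwa [Diagram.dom_comp, ← cod_cls, ← dom_cls]
    have l := Diagram.length_of_cod_eq_dom hABC
    rintro (⟨(⟨x, hx⟩ | ⟨x, y, hx⟩ | ⟨x, hx⟩), h⟩ | ⟨(⟨x, hx⟩ | ⟨x, y, hx⟩ | ⟨x, hx⟩), z, h⟩ | ⟨z, h⟩)
    · exact PlanarGraph.Glue.elim_inL l _ _ _
    · exact PlanarGraph.Glue.elim_inL l _ _ _
    · exact (Diagram.glue_col_inR hABC _).trans
        (PlanarGraph.Glue.elim_inL (Diagram.length_of_cod_eq_dom hBC) _ _ _)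
    · exact PlanarGraph.Glue.elim_inL l _ _ _
    · exact PlanarGraph.Glue.elim_inL l _ _ _
    · exact (Diagram.glue_col_inR hABC _).trans
        (PlanarGraph.Glue.elim_inL (Diagram.length_of_cod_eq_dom hBC) _ _ _)
    · exact (Diagram.glue_col_inR hABC _).trans (Diagram.glue_col_inR hBC _)
  · rintro ((x | x) | x) <;> rfl

theorem tensor_assoc (a b c : Diag S) : tensor (tensor a b) c = tensor a (tensor b c) := by
  induction a using ind with | h n k A => 
  induction b using ind with | h n' k' B => 
  induction c using ind with | h n'' k'' C => 
  simp only [tensor_cls, cls_eq_iff]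
  refine Diagram.Iso.of_compat (PlanarGraph.compat_tensor_assoc _ _ _) ?_ ?_
  · rintro ((x | x) | x) <;> rfl
  · rintro ((x | x) | x) <;> rfl

theorem unit_tensor (d : Diag S) : tensor (unit []) d = d := by
  induction d using ind with | h n k A => 
  rw [unit, tensor_cls, cls_eq_iff]
  refine Diagram.Iso.of_compat (PlanarGraph.compat_unit_tensor _) ?_ ?_
  · rintro (x | x)
    · exact x.elim0
    · rfl
  · rintro (x | x)
    · exact x.elim
    · rfl

theorem tensor_unit (d : Diag S) : tensor d (unit []) = d := by
  induction d using ind with | h n k A => 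
  rw [unit, tensor_cls, cls_eq_iff]
  refine Diagram.Iso.of_compat (PlanarGraph.compat_tensor_unit _) ?_ ?_
  · rintro (x | x)
    · rfl
    · exact x.elim0
  · rintro (x | x)
    · rfl
    · exact x.elim

theorem unit_tensor_unit (v w : List S.O) : tensor (unit v) (unit w) = unit (v ++ w) := by
  rw [unit, unit, unit, tensor_cls, cls_eq_iff]
  refine Diagram.Iso.of_compat
    (PlanarGraph.compat_unit_unit v.length w.length (v ++ w).length (by simp)) ?_ ?_
  · rintro (x | x)
    · simp [Diagram.unit, Diagram.tensor]
    · simp [Diagram.unit, Diagram.tensor]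
  · rintro (x | x) <;> exact x.elim

theorem interchange (a b a' b' : Diag S) (h h' h'') :
    comp (tensor a a') (tensor b b') h'' = tensor (comp a b h) (comp a' b' h') := by
  induction a using ind with | h n k A => 
  induction b using ind with | h n k B => 
  induction a' using ind with | h n k A' => 
  induction b' using ind with | h n k B' => 
  simp only [comp_cls, tensor_cls, cls_eq_iff]
  refine Diagram.Iso.of_compat (PlanarGraph.compat_interchange
    (Diagram.length_of_cod_eq_dom (by rwa [cod_cls, dom_cls] at h))
    (Diagram.length_of_cod_eq_dom (by rwa [cod_cls, dom_cls] at h')) _) ?_ ?_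
  · have hAB : A.cod = B.dom := by rwa [cod_cls, dom_cls] at h
    have hAB' : A'.cod = B'.dom := by rwa [cod_cls, dom_cls] at h'
    rintro (⟨(x | x), hx⟩ | ⟨(x | x), y, hx⟩ | ⟨(x | x), hx⟩)
    · exact PlanarGraph.Glue.elim_inL (Diagram.length_of_cod_eq_dom hAB) _ _ _
    · exact PlanarGraph.Glue.elim_inL (Diagram.length_of_cod_eq_dom hAB') _ _ _
    · exact PlanarGraph.Glue.elim_inL (Diagram.length_of_cod_eq_dom hAB) _ _ _
    · exact PlanarGraph.Glue.elim_inL (Diagram.length_of_cod_eq_dom hAB') _ _ _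
    · exact Diagram.glue_col_inR hAB _
    · exact Diagram.glue_col_inR hAB' _
  · rintro ((x | x) | (x | x)) <;> rfl

theorem map_unit (φ : Sig.Hom S T) (w : List S.O) : map φ (unit w) = unit (w.map φ.o) := by
  rw [unit, map_cls, unit, cls_eq_iff]
  refine Diagram.Iso.of_compat
    (PlanarGraph.compat_unit_cast w.length (w.map φ.o).length (by simp)) ?_ ?_
  · intro x
    simp [Diagram.unit, Diagram.map]
  · exact fun x => x.elim

theorem map_tensor (φ : Sig.Hom S T) (a b : Diag S) :
    map φ (tensor a b) = tensor (map φ a) (map φ b) := by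
  induction a using ind with | h n k A => 
  induction b using ind with | h n k B => 
  simp only [map_cls, tensor_cls]
  rw [cls_eq_iff]
  refine Diagram.Iso.of_compat (PlanarGraph.Compat.id _) ?_ ?_
  · rintro (x | x) <;> rfl
  · rintro (x | x) <;> rfl

theorem map_comp (φ : Sig.Hom S T) (a b : Diag S) (h h') :
    map φ (comp a b h) = comp (map φ a) (map φ b) h' := by
  induction a using ind with | h n k A => 
  induction b using ind with | h n k B => 
  simp only [map_cls, comp_cls]
  rw [cls_eq_iff]
  refine Diagram.Iso.of_compat (PlanarGraph.Compat.id _) ?_ ?_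
  · rintro (⟨x, hx⟩ | ⟨x, y, hx⟩ | ⟨x, hx⟩) <;> rfl
  · rintro (x | x) <;> rfl

end Diag

/-! ## Strict tensor categories and tensor schemes -/

/-- A small strict tensor category, with a set of objects and a set of morphisms.
`comp f g h` is the composition `g ∘ f`. -/
structure StrictTensorCat where
  Ob : Type u
  Mor : Type u
  dom : Mor → Ob
  cod : Mor → Ob
  id : Ob → Mor
  comp : (f g : Mor) → cod f = dom g → Mor
  one : Ob
  tensorOb : Ob → Ob → Ob
  tensorMor : Mor → Mor → Mor
  dom_id : ∀ x, dom (id x) = x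
  cod_id : ∀ x, cod (id x) = x
  dom_comp : ∀ f g h, dom (comp f g h) = dom f
  cod_comp : ∀ f g h, cod (comp f g h) = cod g
  id_comp : ∀ x f h, comp (id x) f h = f
  comp_id : ∀ x f h, comp f (id x) h = f
  comp_assoc : ∀ f g k h₁ h₂ h₃ h₄, comp (comp f g h₁) k h₃ = comp f (comp g k h₂) h₄
  dom_tensor : ∀ f g, dom (tensorMor f g) = tensorOb (dom f) (dom g)
  cod_tensor : ∀ f g, cod (tensorMor f g) = tensorOb (cod f) (cod g)
  tensor_id : ∀ x y, tensorMor (id x) (id y) = id (tensorOb x y)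
  interchange : ∀ f g f' g' h h' h'', comp (tensorMor f f') (tensorMor g g') h'' =
    tensorMor (comp f g h) (comp f' g' h')
  tensorOb_assoc : ∀ x y z, tensorOb (tensorOb x y) z = tensorOb x (tensorOb y z)
  one_tensorOb : ∀ x, tensorOb one x = x
  tensorOb_one : ∀ x, tensorOb x one = x
  tensorMor_assoc : ∀ f g k, tensorMor (tensorMor f g) k = tensorMor f (tensorMor g k)
  one_tensorMor : ∀ f, tensorMor (id one) f = f
  tensorMor_one : ∀ f, tensorMor f (id one) = f

namespace StrictTensorCat

/-- Strict tensor functors. -/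
@[ext]
structure Hom (V W : StrictTensorCat.{u}) where
  onOb : V.Ob → W.Ob
  onMor : V.Mor → W.Mor
  dom : ∀ f, W.dom (onMor f) = onOb (V.dom f)
  cod : ∀ f, W.cod (onMor f) = onOb (V.cod f)
  id : ∀ x, onMor (V.id x) = W.id (onOb x)
  comp : ∀ f g h h', onMor (V.comp f g h) = W.comp (onMor f) (onMor g) h'
  one : onOb V.one = W.one
  tensorOb : ∀ x y, onOb (V.tensorOb x y) = W.tensorOb (onOb x) (onOb y)
  tensorMor : ∀ f g, onMor (V.tensorMor f g) = W.tensorMor (onMor f) (onMor g)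

/-- The category of small strict tensor categories and strict tensor functors. -/
instance : Category StrictTensorCat.{u} where
  Hom := Hom
  id V :=
    { onOb := fun x => x
      onMor := fun f => f
      dom := fun _ => rfl
      cod := fun _ => rfl
      id := fun _ => rfl
      comp := fun _ _ _ _ => rfl
      one := rfl
      tensorOb := fun _ _ => rfl
      tensorMor := fun _ _ => rfl }
  comp K L :=
    { onOb := fun x => L.onOb (K.onOb x)
      onMor := fun f => L.onMor (K.onMor f)
      dom := fun f => by rw [L.dom, K.dom]
      cod := fun f => by rw [L.cod, K.cod]
      id := fun x => by rw [K.id, L.id]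
      comp := fun f g h h' => by
        rw [K.comp f g h (by rw [K.cod, K.dom, h]), L.comp]
      one := by rw [K.one, L.one]
      tensorOb := fun x y => by rw [K.tensorOb, L.tensorOb]
      tensorMor := fun x y => by rw [K.tensorMor, L.tensorMor] }

/-- The tensor product of a word of objects. -/
def tensorList (V : StrictTensorCat.{u}) (w : List V.Ob) : V.Ob := w.foldr V.tensorOb V.one

theorem Hom.tensorList {V W : StrictTensorCat.{u}} (K : Hom V W) (w : List V.Ob) :
    W.tensorList (w.map K.onOb) = K.onOb (V.tensorList w) := by
  induction w with
  | nil => exact K.one.symm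
  | cons x w ih =>
    change W.tensorOb _ (W.tensorList _) = K.onOb (V.tensorOb x (V.tensorList w))
    rw [ih, K.tensorOb]

end StrictTensorCat

/-- A tensor scheme: sets of objects and morphisms, with source and target maps to the words in
the objects. -/
structure TensorScheme where
  Ob : Type u
  Mor : Type u
  src : Mor → List Ob
  tgt : Mor → List Ob

namespace TensorScheme

/-- Morphisms of tensor schemes. -/
@[ext]
structure Hom (D D' : TensorScheme.{u}) where
  onOb : D.Ob → D'.Ob
  onMor : D.Mor → D'.Mor
  src : ∀ f, D'.src (onMor f) = (D.src f).map onOb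
  tgt : ∀ f, D'.tgt (onMor f) = (D.tgt f).map onOb

/-- The category of tensor schemes. -/
instance : Category TensorScheme.{u} where
  Hom := Hom
  id D :=
    { onOb := fun x => x
      onMor := fun f => f
      src := fun _ => by simp
      tgt := fun _ => by simp }
  comp φ ψ :=
    { onOb := fun x => ψ.onOb (φ.onOb x)
      onMor := fun f => ψ.onMor (φ.onMor f)
      src := fun f => by rw [ψ.src, φ.src, List.map_map]; rfl
      tgt := fun f => by rw [ψ.tgt, φ.tgt, List.map_map]; rfl }

end TensorScheme

namespace Sig

theorem typ_map_id {S : Sig.{u}} {f : S.M} {a b : List S.O} (h : S.typ f a b) :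
    S.typ f (a.map fun x => x) (b.map fun x => x) := by
  simpa using h

/-- The category of decorating data. -/
instance : Category Sig.{u} where
  Hom := Hom
  id S :=
    { o := fun x => x
      m := fun f => f
      typ := fun f a b h => by simpa using h }
  comp φ ψ :=
    { o := fun x => ψ.o (φ.o x)
      m := fun f => ψ.m (φ.m f)
      typ := fun f a b h => by
        have := ψ.typ _ _ _ (φ.typ _ _ _ h)
        rw [List.map_map, List.map_map] at this
        exact this }

end Sig

theorem Diag.map_id {S : Sig.{u}} (d : Diag S) : Diag.map (𝟙 S : S ⟶ S) d = d := by
  induction d using Diag.ind with | h n k A => rfl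

theorem Diag.map_map {S T R : Sig.{u}} (φ : S ⟶ T) (ψ : T ⟶ R) (d : Diag S) :
    Diag.map (φ ≫ ψ) d = Diag.map ψ (Diag.map φ d) := by
  induction d using Diag.ind with | h n k A => rfl

/-- Diagrams in a tensor scheme `D`: edges are decorated by objects and vertices by morphisms
whose source and target are the words of the inputs and of the outputs of the vertex. -/
def schemeSig : TensorScheme.{u} ⥤ Sig.{u} where
  obj D := ⟨D.Ob, D.Mor, fun f a b => D.src f = a ∧ D.tgt f = b⟩
  map φ :=
    { o := φ.onOb
      m := φ.onMor
      typ := by rintro f a b ⟨rfl, rfl⟩; exact ⟨φ.src f, φ.tgt f⟩ }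

/-- Diagrams in a strict tensor category `V`: edges are decorated by objects and vertices by
morphisms from the tensor product of the inputs of the vertex to the tensor product of its
outputs. -/
def catSig : StrictTensorCat.{u} ⥤ Sig.{u} where
  obj V := ⟨V.Ob, V.Mor, fun f a b => V.dom f = V.tensorList a ∧ V.cod f = V.tensorList b⟩
  map K :=
    { o := K.onOb
      m := K.onMor
      typ := fun f a b h => ⟨by rw [K.dom, h.1, K.tensorList], by rw [K.cod, h.2, K.tensorList]⟩ }

/-- The strict tensor category of diagrams: the objects are words, the tensor product of objects
is juxtaposition, the morphisms are isomorphism classes of planar diagrams. -/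
noncomputable def diagCat : Sig.{u} ⥤ StrictTensorCat.{u} where
  obj S :=
    { Ob := List S.O
      Mor := Diag S
      dom := Diag.dom
      cod := Diag.cod
      id := Diag.unit
      comp := Diag.comp
      one := []
      tensorOb := fun a b => a ++ b
      tensorMor := Diag.tensor
      dom_id := Diag.dom_unit
      cod_id := Diag.cod_unit
      dom_comp := Diag.dom_comp
      cod_comp := Diag.cod_comp
      id_comp := Diag.unit_comp
      comp_id := Diag.comp_unit
      comp_assoc := Diag.comp_assoc
      dom_tensor := Diag.dom_tensor
      cod_tensor := Diag.cod_tensor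
      tensor_id := Diag.unit_tensor_unit
      interchange := Diag.interchange
      tensorOb_assoc := List.append_assoc
      one_tensorOb := List.nil_append
      tensorOb_one := List.append_nil
      tensorMor_assoc := Diag.tensor_assoc
      one_tensorMor := Diag.unit_tensor
      tensorMor_one := Diag.tensor_unit }
  map φ :=
    { onOb := List.map φ.o
      onMor := Diag.map φ
      dom := Diag.dom_map φ
      cod := Diag.cod_map φ
      id := Diag.map_unit φ
      comp := Diag.map_comp φ
      one := rfl
      tensorOb := fun _ _ => List.map_append
      tensorMor := Diag.map_tensor φ }
  map_id _ := StrictTensorCat.Hom.ext (funext fun _ => List.map_id _) (funext Diag.map_id)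
  map_comp φ ψ := StrictTensorCat.Hom.ext (funext fun w => (List.map_map (f := φ.o) (g := ψ.o) (l := w)).symm)
    (funext (Diag.map_map φ ψ))

theorem tensorList_diagCat (S : Sig.{u}) (w : List (List S.O)) :
    (diagCat.obj S).tensorList w = w.flatten := by
  induction w with
  | nil => rfl
  | cons x w ih => exact congrArg (fun y => x ++ y) ih

theorem flatten_singletons {α : Type*} (w : List α) : (w.map fun x => [x]).flatten = w := by
  induction w <;> simp_all

theorem tensorList_singletons (S : Sig.{u}) (w : List S.O) :
    (diagCat.obj S).tensorList (w.map fun x => [x]) = w :=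
  (tensorList_diagCat S (w.map fun x => [x])).trans (flatten_singletons w)

/-- The free strict tensor category on a tensor scheme. -/
noncomputable def F : TensorScheme.{u} ⥤ StrictTensorCat.{u} := schemeSig ⋙ diagCat

/-- The strict tensor category of diagrams in a strict tensor category. -/
noncomputable def GammaTensor : StrictTensorCat.{u} ⥤ StrictTensorCat.{u} := catSig ⋙ diagCat

/-! ## Prime diagrams -/

namespace PlanarGraph

variable {E V E' V' : Type}

theorem Compat.isPrime {G : PlanarGraph E V} {H : PlanarGraph E' V'} {f : E → E'} {g : V ≃ V'}
    (h : Compat G H f g) (hG : G.IsPrime) : H.IsPrime := by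
  obtain ⟨⟨v, hv⟩, he⟩ := hG
  refine ⟨⟨g v, fun w => ?_⟩, fun y => ?_⟩
  · obtain ⟨w, rfl⟩ := g.surjective w
    rw [hv w]
  · obtain ⟨x, rfl⟩ := h.surjective y
    rcases he x with h1 | h1
    · exact Or.inl (by simpa [h.src_eq] using h1)
    · exact Or.inr (by simpa [h.tgt_eq] using h1)

theorem eq_of_sorted (G : PlanarGraph E V) {l l' : List E} (h : l.Pairwise G.lt)
    (h' : l'.Pairwise G.lt) (hm : ∀ x, x ∈ l ↔ x ∈ l') : l = l' :=
  ((List.perm_ext_iff_of_nodup (G.nodup_of_sorted h) (G.nodup_of_sorted h')).2 hm).eq_of_pairwise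
    (fun _ _ _ _ h h' => (G.lt_asymm h h').elim) h h'

theorem IsPrime.no_loop {G : PlanarGraph E V} (hG : G.IsPrime) (x : E) :
    G.src x = none ∨ G.tgt x = none := by
  obtain ⟨⟨v, hv⟩, he⟩ := hG
  by_contra! h
  obtain ⟨a, ha⟩ := Option.ne_none_iff_exists'.1 h.1
  obtain ⟨b, hb⟩ := Option.ne_none_iff_exists'.1 h.2
  refine G.lt_irrefl x (G.planar₁ _ _ (.single ⟨v, ?_, ?_⟩))
  · rw [hb, hv b]
  · rw [ha, hv a]

theorem IsPrime.vin_eq {G : PlanarGraph E V} (hG : G.IsPrime) (v : V) : G.vin v = G.ins := by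
  refine G.eq_of_sorted (G.vin_sorted v) G.ins_sorted fun x => ?_
  rw [G.mem_vin, G.mem_ins]
  constructor
  · intro h
    rcases hG.no_loop x with h1 | h1
    · exact h1
    · rw [h] at h1; cases h1
  · intro h
    obtain ⟨b, hb⟩ := Option.ne_none_iff_exists'.1 ((hG.2 x).resolve_left (fun h' => h' h))
    obtain ⟨w, hw⟩ := hG.1
    rw [hb, hw b, hw v]

theorem IsPrime.vout_eq {G : PlanarGraph E V} (hG : G.IsPrime) (v : V) : G.vout v = G.outs := by
  refine G.eq_of_sorted (G.vout_sorted v) G.outs_sorted fun x => ?_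
  rw [G.mem_vout, G.mem_outs]
  constructor
  · intro h
    rcases hG.no_loop x with h1 | h1
    · rw [h] at h1; cases h1
    · exact h1
  · intro h
    obtain ⟨b, hb⟩ := Option.ne_none_iff_exists'.1 ((hG.2 x).resolve_right (fun h' => h' h))
    obtain ⟨w, hw⟩ := hG.1
    rw [hb, hw b, hw v]

theorem isPrime_corolla (m n : ℕ) (hm : m ≠ 0) (hn : n ≠ 0) : (corolla m n hm hn).IsPrime :=
  ⟨⟨(), fun _ => rfl⟩, by rintro (x | x) <;> simp [corolla]⟩

end PlanarGraph

namespace Diag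

variable {S T : Sig.{u}} {E V : Type} [Finite E] [Finite V]

/-- A diagram is prime when its graph is. -/
def IsPrime (d : Diag S) : Prop := d.rep.diag.graph.IsPrime

theorem isPrime_cls {A : Diagram S E V} : (cls A).IsPrime ↔ A.graph.IsPrime := by
  obtain ⟨e, g, h⟩ := rep_iso A
  exact ⟨h.compat.isPrime, h.symm.compat.isPrime⟩

theorem IsPrime.map {d : Diag S} (h : d.IsPrime) (φ : Sig.Hom S T) : (d.map φ).IsPrime := by
  induction d using ind with | h n k A =>
  rw [map_cls, isPrime_cls]
  exact (isPrime_cls (A := A)).1 h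

theorem isPrime_corolla (f : S.M) (a b : List S.O) (ha : a ≠ []) (hb : b ≠ [])
    (h : S.typ f a b) : (corolla f a b ha hb h).IsPrime :=
  isPrime_cls.2 (PlanarGraph.isPrime_corolla _ _ (by simpa using ha) (by simpa using hb))

/-- The decoration of the unique vertex of a prime diagram. -/
noncomputable def vertex (d : Diag S) (h : d.IsPrime) : S.M := d.rep.diag.dec h.1.choose

theorem typ_vertex (d : Diag S) (h : d.IsPrime) : S.typ (d.vertex h) d.dom d.cod := by
  have := d.rep.diag.typ h.1.choose
  rw [h.vin_eq, h.vout_eq] at this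
  rw [← dom_rep, ← cod_rep]
  exact this

theorem IsPrime.dom_ne_nil {d : Diag S} (h : d.IsPrime) : d.dom ≠ [] := by
  have := d.rep.diag.graph.vin_ne_nil h.1.choose
  rw [h.vin_eq] at this
  rw [← dom_rep]
  simpa [Diagram.dom] using this

theorem IsPrime.cod_ne_nil {d : Diag S} (h : d.IsPrime) : d.cod ≠ [] := by
  have := d.rep.diag.graph.vout_ne_nil h.1.choose
  rw [h.vout_eq] at this
  rw [← cod_rep]
  simpa [Diagram.cod] using this

end Diag

/-- The tensor scheme of prime diagrams. -/
def primeScheme : Sig.{u} ⥤ TensorScheme.{u} where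
  obj S := ⟨S.O, {d : Diag S // d.IsPrime}, fun d => d.1.dom, fun d => d.1.cod⟩
  map φ :=
    { onOb := φ.o
      onMor := fun d => ⟨d.1.map φ, d.2.map φ⟩
      src := fun d => Diag.dom_map φ d.1
      tgt := fun d => Diag.cod_map φ d.1 }
  map_id _ := TensorScheme.Hom.ext rfl (funext fun d => Subtype.ext (Diag.map_id d.1))
  map_comp φ ψ := TensorScheme.Hom.ext rfl (funext fun d => Subtype.ext (Diag.map_map φ ψ d.1))

/-- The tensor scheme of prime diagrams in a strict tensor category. -/
def U : StrictTensorCat.{u} ⥤ TensorScheme.{u} := catSig ⋙ primeScheme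

/-- A diagram in `U V` gives a diagram in `V`: replace the decoration of each vertex, which is
a prime diagram, by the decoration of the vertex of this prime diagram. -/
noncomputable def zetaSig (V : StrictTensorCat.{u}) :
    schemeSig.obj (U.obj V) ⟶ catSig.obj V where
  o := fun x => x
  m := fun d => d.1.vertex d.2
  typ := by
    rintro d a b ⟨rfl, rfl⟩
    exact Sig.typ_map_id (Diag.typ_vertex d.1 d.2)

/-! ## Fissus diagrams -/

/-- A fissus diagram: a planar diagram with a fission structure, that is, the list of its inputs
is cut into a nonempty list of consecutive blocks, and so is the list of its outputs. -/
structure FDiagram (S : Sig.{u}) (E V : Type) where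
  diag : Diagram S E V
  pin : List (List E)
  pout : List (List E)
  flatten_pin : pin.flatten = diag.graph.ins
  flatten_pout : pout.flatten = diag.graph.outs
  pin_ne_nil : pin ≠ []
  pout_ne_nil : pout ≠ []

namespace FDiagram

variable {S T : Sig.{u}} {E V E' V' E'' V'' : Type}

/-- Isomorphisms of fissus diagrams respect the fission structures. -/
def Iso (A : FDiagram S E V) (B : FDiagram S E' V') : Prop :=
  ∃ (e : E ≃ E') (g : V ≃ V'), Diagram.IsIso A.diag B.diag e g ∧
    A.pin.map (List.map e) = B.pin ∧ A.pout.map (List.map e) = B.pout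

theorem Iso.refl (A : FDiagram S E V) : Iso A A :=
  ⟨_, _, Diagram.IsIso.refl A.diag, by simp, by simp⟩

theorem Iso.symm {A : FDiagram S E V} {B : FDiagram S E' V'} (h : Iso A B) : Iso B A := by
  obtain ⟨e, g, h, h1, h2⟩ := h
  exact ⟨_, _, h.symm, by simp [← h1, Function.comp_def], by simp [← h2, Function.comp_def]⟩

theorem Iso.trans {A : FDiagram S E V} {B : FDiagram S E' V'} {C : FDiagram S E'' V''}
    (h : Iso A B) (h' : Iso B C) : Iso A C := by
  obtain ⟨e, g, h, h1, h2⟩ := h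
  obtain ⟨e', g', h', h1', h2'⟩ := h'
  exact ⟨_, _, h.trans h', by simp [← h1', ← h1, Function.comp_def],
    by simp [← h2', ← h2, Function.comp_def]⟩

/-- The domain, a word of words. -/
def dom (A : FDiagram S E V) : List (List S.O) := A.pin.map (List.map A.diag.col)

/-- The codomain, a word of words. -/
def cod (A : FDiagram S E V) : List (List S.O) := A.pout.map (List.map A.diag.col)

theorem Iso.dom_eq {A : FDiagram S E V} {B : FDiagram S E' V'} (h : Iso A B) : A.dom = B.dom := by
  obtain ⟨e, g, h, h1, h2⟩ := h
  simp [dom, ← h1, Function.comp_def, h.col]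

theorem Iso.cod_eq {A : FDiagram S E V} {B : FDiagram S E' V'} (h : Iso A B) : A.cod = B.cod := by
  obtain ⟨e, g, h, h1, h2⟩ := h
  simp [cod, ← h2, Function.comp_def, h.col]

/-- Changing the colours and the decorations. -/
def map (φ : Sig.Hom S T) (A : FDiagram S E V) : FDiagram T E V where
  diag := A.diag.map φ
  pin := A.pin
  pout := A.pout
  flatten_pin := A.flatten_pin
  flatten_pout := A.flatten_pout
  pin_ne_nil := A.pin_ne_nil
  pout_ne_nil := A.pout_ne_nil

theorem Iso.map (φ : Sig.Hom S T) {A : FDiagram S E V} {B : FDiagram S E' V'} (h : Iso A B) :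
    Iso (A.map φ) (B.map φ) := by
  obtain ⟨_, _, h, h1, h2⟩ := h; exact ⟨_, _, h.map φ, h1, h2⟩

end FDiagram

/-- A fissus diagram on standard finite sets of edges and vertices. -/
structure FRep (S : Sig.{u}) where
  nE : ℕ
  nV : ℕ
  fdiag : FDiagram S (Fin nE) (Fin nV)

/-- Isomorphism of fissus diagrams as an equivalence relation. -/
def FRep.setoid (S : Sig.{u}) : Setoid (FRep S) where
  r A B := A.fdiag.Iso B.fdiag
  iseqv := ⟨fun A => FDiagram.Iso.refl A.fdiag, fun h => h.symm, fun h h' => h.trans h'⟩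

/-- Isomorphism classes of finite fissus planar diagrams. -/
def FDiag (S : Sig.{u}) : Type u := Quotient (FRep.setoid S)

/-- Cut the list `l` into consecutive blocks of the same lengths as the members of `p`. -/
def splitAs {α β : Type*} (p : List (List α)) (l : List β) : List (List β) :=
  (p.map List.length).splitLengths l

theorem flatten_splitAs {α β : Type*} (p : List (List α)) (l : List β)
    (h : p.flatten.length = l.length) : (splitAs p l).flatten = l := by
  rw [splitAs, List.flatten_splitLengths]
  rw [← h, List.length_flatten]

theorem splitAs_ne_nil {α β : Type*} {p : List (List α)} (l : List β) (h : p ≠ []) :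
    splitAs p l ≠ [] := by
  cases p with
  | nil => exact (h rfl).elim
  | cons x p => simp [splitAs]

theorem map_splitAs {α β : Type*} (p : List (List α)) (l : List β) (f : β → α)
    (h : p.flatten = l.map f) : (splitAs p l).map (List.map f) = p := by
  induction p generalizing l with
  | nil => rfl
  | cons x p ih =>
    simp only [splitAs, List.map_cons, List.splitLengths, List.cons.injEq, List.splitAt_eq]
    simp only [List.flatten_cons] at h
    constructor
    · rw [List.map_take, ← h, List.take_left]
    · refine ih _ ?_
      rw [List.map_drop, ← h, List.drop_left]

namespace FDiag

variable {S T : Sig.{u}}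

/-- The domain of a fissus diagram, a word of words. -/
def dom (d : FDiag S) : List (List S.O) :=
  Quotient.lift (fun A => A.fdiag.dom) (fun _ _ h => FDiagram.Iso.dom_eq h) d

/-- The codomain of a fissus diagram, a word of words. -/
def cod (d : FDiag S) : List (List S.O) :=
  Quotient.lift (fun A => A.fdiag.cod) (fun _ _ h => FDiagram.Iso.cod_eq h) d

/-- Changing the colours and the decorations. -/
def map (φ : Sig.Hom S T) (d : FDiag S) : FDiag T :=
  Quotient.map (sa := FRep.setoid S) (sb := FRep.setoid T)
    (fun A => ⟨A.nE, A.nV, A.fdiag.map φ⟩) (fun _ _ h => FDiagram.Iso.map φ h) d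

/-- Forget the fission structure. -/
def forget (d : FDiag S) : Diag S :=
  Quotient.map (sa := FRep.setoid S) (sb := Rep.setoid S)
    (fun A => ⟨A.nE, A.nV, A.fdiag.diag⟩)
    (fun _ _ h => by obtain ⟨e, g, h, -, -⟩ := h; exact ⟨e, g, h⟩) d

/-- Equip the planar diagram `d` with the fission structure that brackets its domain and its
codomain as in the words of words `p` and `q`. -/
noncomputable def bracket (d : Diag S) (p q : List (List S.O)) (hp : p.flatten = d.dom)
    (hq : q.flatten = d.cod) (hp' : p ≠ []) (hq' : q ≠ []) : FDiag S :=
  Quotient.mk (FRep.setoid S) ⟨d.rep.nE, d.rep.nV,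
    { diag := d.rep.diag
      pin := splitAs p d.rep.diag.graph.ins
      pout := splitAs q d.rep.diag.graph.outs
      flatten_pin := flatten_splitAs _ _ (by rw [hp, ← Diag.dom_rep]; simp [Diagram.dom])
      flatten_pout := flatten_splitAs _ _ (by rw [hq, ← Diag.cod_rep]; simp [Diagram.cod])
      pin_ne_nil := splitAs_ne_nil _ hp'
      pout_ne_nil := splitAs_ne_nil _ hq' }⟩

theorem forget_bracket (d : Diag S) (p q : List (List S.O)) (hp hq hp' hq') :
    (bracket d p q hp hq hp' hq').forget = d := Quotient.out_eq d

theorem dom_bracket (d : Diag S) (p q : List (List S.O)) (hp hq hp' hq') :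
    (bracket d p q hp hq hp' hq').dom = p :=
  map_splitAs _ _ _ (by rw [hp, ← Diag.dom_rep]; rfl)

theorem cod_bracket (d : Diag S) (p q : List (List S.O)) (hp hq hp' hq') :
    (bracket d p q hp hq hp' hq').cod = q :=
  map_splitAs _ _ _ (by rw [hq, ← Diag.cod_rep]; rfl)

theorem dom_map (φ : Sig.Hom S T) (d : FDiag S) :
    (d.map φ).dom = d.dom.map (List.map φ.o) := by
  induction d using Quotient.ind with | _ A =>
  simp [dom, map, FDiagram.dom, FDiagram.map, Diagram.map, Function.comp_def]

theorem cod_map (φ : Sig.Hom S T) (d : FDiag S) :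
    (d.map φ).cod = d.cod.map (List.map φ.o) := by
  induction d using Quotient.ind with | _ A =>
  simp [cod, map, FDiagram.cod, FDiagram.map, Diagram.map, Function.comp_def]

theorem map_id (d : FDiag S) : map (𝟙 S : S ⟶ S) d = d := by
  induction d using Quotient.ind with | _ A => rfl

theorem map_map {R : Sig.{u}} (φ : S ⟶ T) (ψ : T ⟶ R) (d : FDiag S) :
    map (φ ≫ ψ) d = map ψ (map φ d) := by
  induction d using Quotient.ind with | _ A => rfl

theorem dom_forget (d : FDiag S) : d.forget.dom = d.dom.flatten := by
  induction d using Quotient.ind with | _ A =>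
  change A.fdiag.diag.graph.ins.map _ = (A.fdiag.pin.map (List.map _)).flatten
  rw [← A.fdiag.flatten_pin, List.map_flatten]

theorem cod_forget (d : FDiag S) : d.forget.cod = d.cod.flatten := by
  induction d using Quotient.ind with | _ A =>
  change A.fdiag.diag.graph.outs.map _ = (A.fdiag.pout.map (List.map _)).flatten
  rw [← A.fdiag.flatten_pout, List.map_flatten]

theorem dom_ne_nil (d : FDiag S) : d.dom ≠ [] := by
  induction d using Quotient.ind with | _ A =>
  change A.fdiag.pin.map _ ≠ []
  simpa using A.fdiag.pin_ne_nil

theorem cod_ne_nil (d : FDiag S) : d.cod ≠ [] := by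
  induction d using Quotient.ind with | _ A =>
  change A.fdiag.pout.map _ ≠ []
  simpa using A.fdiag.pout_ne_nil

end FDiag

/-- The tensor scheme of fissus diagrams; its objects are words. -/
def fissusScheme : Sig.{u} ⥤ TensorScheme.{u} where
  obj S := ⟨List S.O, FDiag S, FDiag.dom, FDiag.cod⟩
  map φ :=
    { onOb := List.map φ.o
      onMor := FDiag.map φ
      src := FDiag.dom_map φ
      tgt := FDiag.cod_map φ }
  map_id _ := TensorScheme.Hom.ext (funext fun _ => List.map_id _) (funext FDiag.map_id)
  map_comp φ ψ := TensorScheme.Hom.ext (funext fun w => (List.map_map (f := φ.o) (g := ψ.o) (l := w)).symm)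
    (funext (FDiag.map_map φ ψ))

/-- The tensor scheme of fissus diagrams in a tensor scheme. -/
def GammaF : TensorScheme.{u} ⥤ TensorScheme.{u} := schemeSig ⋙ fissusScheme

/-- The fissus diagram in `D` underlying a prime diagram in `F D`: the decoration of the vertex,
which is a diagram in `D`, with the fission structure given by the words on the legs. -/
noncomputable def fissusOfPrime (D : TensorScheme.{u}) (x : ((F ⋙ U).obj D).Mor) :
    (GammaF.obj D).Mor :=
  FDiag.bracket (x.1.vertex x.2) x.1.dom x.1.cod
    ((tensorList_diagCat _ _).symm.trans (Diag.typ_vertex x.1 x.2).1.symm)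
    ((tensorList_diagCat _ _).symm.trans (Diag.typ_vertex x.1 x.2).2.symm)
    x.2.dom_ne_nil x.2.cod_ne_nil

/-! ## Evaluation and fine-graining -/

/-- An evaluation map of diagrams in a strict tensor category. -/
@[ext]
structure Evaluation (V : StrictTensorCat.{u}) where
  val : Diag (catSig.obj V) → V.Mor
  dom_val : ∀ d, V.dom (val d) = V.tensorList d.dom
  cod_val : ∀ d, V.cod (val d) = V.tensorList d.cod
  /-- the empty diagram -/
  val_empty : val (Diag.unit []) = V.id V.one
  /-- unitary diagrams -/
  val_unitary : ∀ x : V.Ob, val (Diag.unit (S := catSig.obj V) [x]) = V.id x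
  val_prime : ∀ d h, val d = d.vertex h
  val_tensor : ∀ d d', val (Diag.tensor d d') = V.tensorMor (val d) (val d')
  val_comp : ∀ d d' h, val (Diag.comp d d' h) =
    V.comp (val d) (val d') (by rw [cod_val, dom_val, h])

/-- Forgetting the fission structures of the components, a diagram in `Γ_F D` (a compound fissus
diagram) becomes a diagram in the strict tensor category `F D`. -/
def forgetSig (D : TensorScheme.{u}) : schemeSig.obj (GammaF.obj D) ⟶ catSig.obj (F.obj D) where
  o := fun w => w
  m := FDiag.forget
  typ := by
    rintro x a b ⟨rfl, rfl⟩
    exact Sig.typ_map_id (S := catSig.obj (F.obj D))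
      ⟨(FDiag.dom_forget x).trans (tensorList_diagCat _ _).symm,
        (FDiag.cod_forget x).trans (tensorList_diagCat _ _).symm⟩

theorem dom_val_forget (D : TensorScheme.{u}) (ev : Evaluation (F.obj D))
    (x : FDiag (schemeSig.obj (GammaF.obj D))) :
    Diag.dom (ev.val (x.forget.map (forgetSig D))) = (x.dom.map List.flatten).flatten := by
  refine (ev.dom_val _).trans ((tensorList_diagCat _ _).trans ?_)
  refine (congrArg List.flatten (Diag.dom_map (forgetSig D) x.forget)).trans ?_
  refine (congrArg List.flatten (List.map_id' _)).trans ?_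
  rw [FDiag.dom_forget]
  exact List.flatten_flatten

theorem cod_val_forget (D : TensorScheme.{u}) (ev : Evaluation (F.obj D))
    (x : FDiag (schemeSig.obj (GammaF.obj D))) :
    Diag.cod (ev.val (x.forget.map (forgetSig D))) = (x.cod.map List.flatten).flatten := by
  refine (ev.cod_val _).trans ((tensorList_diagCat _ _).trans ?_)
  refine (congrArg List.flatten (Diag.cod_map (forgetSig D) x.forget)).trans ?_
  refine (congrArg List.flatten (List.map_id' _)).trans ?_
  rw [FDiag.cod_forget]
  exact List.flatten_flatten

/-- Fine-graining. A morphism `x` of `Γ_F (Γ_F D)` is a fissus compound fissus diagram in `D`.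
Evaluating it means tensoring and composing its components as prescribed by `x`.  The legs of `x`
are words, which bracket the legs of the value; the fission structure of `x` is a second layer of
brackets, and composing the two layers flattens the words of each block. -/
noncomputable def fineGraining (D : TensorScheme.{u}) (ev : Evaluation (F.obj D)) :
    GammaF.obj (GammaF.obj D) ⟶ GammaF.obj D where
  onOb := List.flatten
  onMor x := FDiag.bracket (ev.val ((FDiag.forget x).map (forgetSig D)))
    ((FDiag.dom x).map List.flatten) ((FDiag.cod x).map List.flatten)
    (dom_val_forget D ev x).symm (cod_val_forget D ev x).symm
    (fun h => FDiag.dom_ne_nil x (List.map_eq_nil_iff.1 h))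
    (fun h => FDiag.cod_ne_nil x (List.map_eq_nil_iff.1 h))
  src x := FDiag.dom_bracket _ _ _ (dom_val_forget D ev x).symm (cod_val_forget D ev x).symm
    (fun h => FDiag.dom_ne_nil x (List.map_eq_nil_iff.1 h))
    (fun h => FDiag.cod_ne_nil x (List.map_eq_nil_iff.1 h))
  tgt x := FDiag.cod_bracket _ _ _ (dom_val_forget D ev x).symm (cod_val_forget D ev x).symm
    (fun h => FDiag.dom_ne_nil x (List.map_eq_nil_iff.1 h))
    (fun h => FDiag.cod_ne_nil x (List.map_eq_nil_iff.1 h))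

/-! ## The adjunction -/

/-- The tensor schemes all of whose morphisms have a nonempty source and a nonempty target; these
are the morphisms that can decorate the vertices of a diagram. -/
def IsProper : ObjectProperty TensorScheme.{u} :=
  fun D => ∀ f : D.Mor, D.src f ≠ [] ∧ D.tgt f ≠ []

/-- The functor `F` on proper tensor schemes. -/
noncomputable def Fp : IsProper.{u}.FullSubcategory ⥤ StrictTensorCat.{u} := IsProper.ι ⋙ F

/-- The functor `U` with values in proper tensor schemes. -/
def Up : StrictTensorCat.{u} ⥤ IsProper.{u}.FullSubcategory :=
  IsProper.lift U fun _ f => ⟨f.2.dom_ne_nil, f.2.cod_ne_nil⟩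

/-- The unit: an object `x` goes to the word `⟨x⟩`, a morphism `f` goes to the prime diagram in
`F D` decorated by the prime diagram in `D` decorated by `f`. -/
noncomputable def eta (D : IsProper.{u}.FullSubcategory) : D ⟶ (Fp ⋙ Up).obj D :=
  ObjectProperty.homMk (
    { onOb := fun x => [x]
      onMor := fun f => ⟨Diag.corolla (S := catSig.obj (F.obj D.obj))
        (Diag.corolla (S := schemeSig.obj D.obj) f (D.obj.src f) (D.obj.tgt f)
          (D.property f).1 (D.property f).2 ⟨rfl, rfl⟩)
        ((D.obj.src f).map fun x => [x]) ((D.obj.tgt f).map fun x => [x])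
        (fun h => (D.property f).1 (List.map_eq_nil_iff.1 h))
        (fun h => (D.property f).2 (List.map_eq_nil_iff.1 h))
        ⟨(Diag.dom_corolla ..).trans (tensorList_singletons (schemeSig.obj D.obj) _).symm,
          (Diag.cod_corolla ..).trans (tensorList_singletons (schemeSig.obj D.obj) _).symm⟩,
        Diag.isPrime_corolla ..⟩
      src := fun f => Diag.dom_corolla ..
      tgt := fun f => Diag.cod_corolla .. } : TensorScheme.Hom D.obj (U.obj (F.obj D.obj)))

end TensorCalculus

open TensorCalculus

/-! Everything rests on a normal form: a diagram is a composite of layers, a layer being one vertex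
with identities on both sides. Acyclicity and finiteness provide an initial vertex, one whose inputs
are all inputs of the graph (`PlanarGraph.exists_isInitial`), and planarity forces these inputs to
be consecutive (`IsInitial.exists_ins_eq`). Such a vertex splits off: the diagram is its layer
followed by the diagram with the vertex erased (`Diagram.iso_layer_comp_erase`). Induction on the
number of vertices gives `Diag.layer_ind`.

An interpretation of colours and decorations in a strict tensor category gives a morphism to each
layer, hence to each sequence of layers. A diagram has many decompositions, so its value starts out
as a relation, `HasValue`, and independence of the decomposition (`HasValue.unique`) is a diamond
argument. If two decompositions begin with different initial vertices, the two blocks of inputs are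
disjoint, erasing both vertices gives the same diagram in either order (`Diagram.iso_erase_erase`),
and the interchange law exchanges the two layers (`StrictTensorCat.layer_comp_layer`). Values
respect composition and tensor product, so each interpretation extends to a strict tensor functor
(`Interp.lift`); by the normal form a strict tensor functor on diagrams is determined by letters and
one-vertex diagrams (`diagCat_hom_ext`). This universal property yields the evaluation map, its
uniqueness and the counit; together with the rigidity of prime diagrams it proves the identities of
the adjunction.

The identifications come from that rigidity: a prime diagram amounts to a decoration together with
two nonempty words that it fits (`Diag.IsPrime.ext`). In a diagram in `U V` the words around a
vertex already are the legs of the prime diagram decorating it, so only the inner decoration carries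
information; this is the first identification. A prime diagram in `F D` is a diagram in `D` whose
domain and codomain are cut into words, that is, a fissus diagram; this is the second. The
multiplication is `U` of the counit at `F D`. The counit is evaluation after the first
identification (`zetaHom_comp_evaluation`), and replacing decorations by inner decorations is the
same as applying the second identification to the components and forgetting their brackets
(`omegaHom_forgetSig`). These two facts give `fineGraining_eq`. -/

namespace TensorCalculus

/-! ## Removing a vertex from a planar graph -/

/-! ### Restricting lists of edges and ends of edges to a subset. -/

section subtypes

variable {α : Type} (P : α → Prop)

open Classical in
/-- The members of a list that satisfy `P`. -/
noncomputable def restrictList (l : List α) : List {x // P x} :=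
  l.filterMap fun x => if h : P x then some ⟨x, h⟩ else none

theorem mem_restrictList {l : List α} {x : {x // P x}} : x ∈ restrictList P l ↔ x.1 ∈ l := by
  simp only [restrictList, List.mem_filterMap]
  constructor
  · rintro ⟨a, ha, h⟩
    split at h
    · cases h; exact ha
    · cases h
  · exact fun h => ⟨x.1, h, by simp [x.2]⟩

theorem restrictList_pairwise {R : α → α → Prop} {l : List α} (h : l.Pairwise R) :
    (restrictList P l).Pairwise fun x y => R x.1 y.1 := by
  refine List.Pairwise.filterMap _ ?_ h
  intro a a' haa b hb b' hb'
  split at hb <;> split at hb' <;> cases hb <;> cases hb'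
  exact haa

theorem map_val_restrictList {l : List α} (h : ∀ x ∈ l, P x) :
    (restrictList P l).map Subtype.val = l := by
  induction l with
  | nil => rfl
  | cons a l ih =>
    have ha := h a List.mem_cons_self
    have := ih fun x hx => h x (List.mem_cons_of_mem _ hx)
    simp only [restrictList, List.filterMap_cons, ha, dite_true, List.map_cons] at this ⊢
    rw [this]

open Classical in
/-- Forget the end `v` of an edge. -/
noncomputable def restrictEnd {V : Type} (v : V) (o : Option V) : Option {w // w ≠ v} :=
  o.bind fun w => if h : w ≠ v then some ⟨w, h⟩ else none

variable {V : Type} {v : V}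

theorem restrictEnd_eq_some {o : Option V} {w : {w // w ≠ v}} :
    restrictEnd v o = some w ↔ o = some w.1 := by
  cases o with
  | none => simp [restrictEnd]
  | some a =>
    by_cases h : a = v
    · subst h; simpa [restrictEnd] using fun e => w.2 e.symm
    · simp [restrictEnd, h, Subtype.ext_iff]

/-- The second alternative is what turns the outputs of the removed vertex into inputs of the graph.
-/
theorem restrictEnd_eq_none {o : Option V} : restrictEnd v o = none ↔ o = none ∨ o = some v := by
  cases o with
  | none => simp [restrictEnd]
  | some a => by_cases h : a = v <;> simp [restrictEnd, h]

end subtypes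

/-! ### Initial vertices of a planar graph. -/

namespace PlanarGraph

variable {E V : Type} (G : PlanarGraph E V) {v : V}

/-- All inputs of the vertex `v` are inputs of the graph. -/
def IsInitial (v : V) : Prop := ∀ x ∈ G.vin v, G.src x = none

variable {G}

/-- A decomposition of the inputs of the graph around the inputs of `v` already encodes that `v` is
initial, so it is the only hypothesis that erasing `v` needs. -/
theorem isInitial_of_ins_eq {l r : List E} (h : G.ins = l ++ G.vin v ++ r) : G.IsInitial v := by
  intro x hx
  rw [← G.mem_ins, h]
  simp [hx]

namespace IsInitial

theorem tgt_ne_of_src (hv : G.IsInitial v) {y : E} (h : G.src y ≠ none) : G.tgt y ≠ some v :=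
  fun h' => h (hv y ((G.mem_vin v y).2 h'))

/-- No path between surviving edges is lost: an intermediate edge ending at `v` would be an input of
the graph, and no path leads to an input. -/
theorem reach_iff (hv : G.IsInitial v) {x y : {x // G.tgt x ≠ some v}} :
    Reach (fun x : {x // G.tgt x ≠ some v} => restrictEnd v (G.src x.1))
      (fun x => restrictEnd v (G.tgt x.1)) x y ↔ Reach G.src G.tgt x.1 y.1 := by
  constructor
  · intro h
    refine Relation.TransGen.lift Subtype.val ?_ _ _ h
    rintro a b ⟨w, h1, h2⟩
    exact ⟨w.1, restrictEnd_eq_some.1 h1, restrictEnd_eq_some.1 h2⟩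
  · have key : ∀ x y : {x // G.tgt x ≠ some v}, Step G.src G.tgt x.1 y.1 →
        Step (fun x : {x // G.tgt x ≠ some v} => restrictEnd v (G.src x.1))
          (fun x => restrictEnd v (G.tgt x.1)) x y := by
      rintro x y ⟨w, h1, h2⟩
      have hw : w ≠ v := by rintro rfl; exact x.2 h1
      exact ⟨⟨w, hw⟩, restrictEnd_eq_some.2 h1, restrictEnd_eq_some.2 h2⟩
    intro h
    obtain ⟨y, hy⟩ := y
    replace h : Reach G.src G.tgt x.1 y := h
    induction h with
    | single h => exact .single (key _ _ h)
    | @tail b c _ h ih =>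
      obtain ⟨w, h1, h2⟩ := h
      by_cases hb : G.tgt b = some v
      · rename_i hr
        exact (G.not_reach_of_src (hv b ((G.mem_vin v b).2 hb)) hr).elim
      · exact .tail (ih hb) (key ⟨b, hb⟩ ⟨c, hy⟩ ⟨w, h1, h2⟩)

/-- The edge before `o` on the path ends at `v`, so it is an input of the graph; nothing leads to
it, hence the path starts there. -/
theorem reach_out (hv : G.IsInitial v) {x o : E} (ho : o ∈ G.vout v)
    (h : Reach G.src G.tgt x o) : x ∈ G.vin v := by
  obtain ⟨c, h1, w, h2, h3⟩ := Relation.TransGen.tail'_iff.1 h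
  rw [(G.mem_vout v o).1 ho] at h3
  cases h3
  have hc := (G.mem_vin v c).2 h2
  rcases Relation.reflTransGen_iff_eq_or_transGen.1 h1 with rfl | h1
  · exact hc
  · exact (G.not_reach_of_src (hv c hc) h1).elim

theorem lt_out (_ : G.IsInitial v) {i o : E} (hi : i ∈ G.vin v) (ho : o ∈ G.vout v) :
    Reach G.src G.tgt i o :=
  .single ⟨v, (G.mem_vin v i).1 hi, (G.mem_vout v o).1 ho⟩

/-- An input on the right of some input of `v` is an input of `v` or lies on the right of every
output of `v`. -/
theorem out_lt (hv : G.IsInitial v) {i j o : E} (hi : i ∈ G.vin v) (hj : G.src j = none)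
    (hj' : j ∉ G.vin v) (hij : G.lt i j) (ho : o ∈ G.vout v) : G.lt o j := by
  rcases G.lt_total o j with h | rfl | h
  · exact h
  · rw [(G.mem_vout v o).1 ho] at hj; cases hj
  -- If `j` lay between `i` and `o`, the path from `i` to `o` and planarity would give a path from
  -- `j` to `o`, making `j` an input of `v`, or a path to the input `j`.
  · rcases G.planar₂ _ _ _ (hv.lt_out hi ho) hij h with h | h
    · exact (hj' (hv.reach_out ho h)).elim
    · exact (G.not_reach_of_src hj h).elim

/-- Any output of `v` separates: it comes after all inputs of `v` and, by `out_lt`, before `j`.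
Hence no foreign input sits between two inputs of `v`. -/
theorem right_of_all (hv : G.IsInitial v) {i j : E} (hi : i ∈ G.vin v) (hj : G.src j = none)
    (hj' : j ∉ G.vin v) (hij : G.lt i j) : ∀ i' ∈ G.vin v, G.lt i' j := by
  intro i' hi'
  obtain ⟨o, ho⟩ := List.exists_mem_of_ne_nil _ (G.vout_ne_nil v)
  exact G.lt_trans _ _ _ (G.planar₁ _ _ (hv.lt_out hi' ho)) (hv.out_lt hi hj hj' hij ho)

/-- The inputs of an initial vertex form a block of the inputs of the graph. -/
theorem exists_ins_eq (hv : G.IsInitial v) : ∃ l r, G.ins = l ++ G.vin v ++ r := by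
  classical
  obtain ⟨i₀, hi₀⟩ := List.exists_mem_of_ne_nil _ (G.vin_ne_nil v)
  -- The two flanks are the inputs preceding all of `G.vin v` and the inputs following all of it;
  -- `right_of_all` shows that every other input belongs to `v`.
  refine ⟨G.ins.filter fun x => ∀ i ∈ G.vin v, G.lt x i,
    G.ins.filter fun x => ∀ i ∈ G.vin v, G.lt i x, ?_⟩
  refine G.eq_of_sorted G.ins_sorted ?_ fun x => ?_
  · rw [List.pairwise_append, List.pairwise_append]
    refine ⟨⟨G.ins_sorted.filter _, G.vin_sorted v, ?_⟩, G.ins_sorted.filter _, ?_⟩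
    · intro a ha b hb
      simp only [List.mem_filter, decide_eq_true_eq] at ha
      exact ha.2 b hb
    · intro a ha b hb
      simp only [List.mem_filter, decide_eq_true_eq, List.mem_append] at ha hb
      rcases ha with ha | ha
      · exact G.lt_trans _ _ _ (ha.2 _ hi₀) (hb.2 _ hi₀)
      · exact hb.2 a ha
  · simp only [List.mem_append, List.mem_filter, decide_eq_true_eq]
    constructor
    · intro hx
      by_cases hx' : x ∈ G.vin v
      · exact Or.inl (Or.inr hx')
      · by_cases h : ∃ i ∈ G.vin v, G.lt i x
        · obtain ⟨i, hi, h⟩ := h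
          exact Or.inr ⟨hx, hv.right_of_all hi ((G.mem_ins x).1 hx) hx' h⟩
        · refine Or.inl (Or.inl ⟨hx, fun i hi => ?_⟩)
          rcases G.lt_total x i with h1 | rfl | h1
          · exact h1
          · exact (hx' hi).elim
          · exact (h ⟨i, hi, h1⟩).elim
    · rintro ((h | h) | h)
      · exact h.1
      · exact (G.mem_ins x).2 (hv x h)
      · exact h.1

end IsInitial

/-- The source of the smallest edge having a source is initial: an input of this vertex that had a
source would be a smaller such edge. Such edges exist because vertices have outputs. -/
theorem exists_isInitial [Finite E] [Nonempty V] (G : PlanarGraph E V) : ∃ v, G.IsInitial v := by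
  obtain ⟨v₀⟩ := ‹Nonempty V›
  obtain ⟨o, ho⟩ := List.exists_mem_of_ne_nil _ (G.vout_ne_nil v₀)
  obtain ⟨e, he, hmin⟩ := G.wf.has_min {e | G.src e ≠ none}
    ⟨o, by simp [(G.mem_vout v₀ o).1 ho]⟩
  obtain ⟨v, hv⟩ := Option.ne_none_iff_exists'.1 he
  refine ⟨v, fun x hx => ?_⟩
  by_contra h
  exact hmin x h (G.planar₁ _ _ (.single ⟨v, (G.mem_vin v x).1 hx, hv⟩))

/-- The outputs of `v` can take the place of its inputs: the edges of `l` precede an input of `v`,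
which precedes the outputs along a path, while the edges of `r` follow the outputs by `out_lt`. -/
theorem sorted_erase {l r : List E} (h : G.ins = l ++ G.vin v ++ r) :
    (l ++ G.vout v ++ r).Pairwise G.lt := by
  have hv := isInitial_of_ins_eq h
  have hs := G.ins_sorted
  have hn := G.nodup_of_sorted G.ins_sorted
  obtain ⟨i, hi⟩ := List.exists_mem_of_ne_nil _ (G.vin_ne_nil v)
  rw [h] at hs hn
  rw [List.nodup_append] at hn
  rw [List.pairwise_append, List.pairwise_append] at hs
  obtain ⟨⟨h1, -, h2⟩, h3, h4⟩ := hs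
  rw [List.pairwise_append, List.pairwise_append]
  refine ⟨⟨h1, G.vout_sorted v, fun a ha b hb => ?_⟩, h3, fun a ha b hb => ?_⟩
  · exact G.lt_trans _ _ _ (h2 a ha i hi) (G.planar₁ _ _ (hv.lt_out hi hb))
  · rcases List.mem_append.1 ha with ha | ha
    · exact h4 a (List.mem_append_left _ ha) b hb
    · refine hv.out_lt hi ?_ ?_ (h4 i (List.mem_append_right _ hi) b hb) ha
      · rw [← G.mem_ins, h]; simp [hb]
      · exact fun hb' => hn.2.2 b (List.mem_append_right _ hb') b hb rfl

/-- Matches `restrictEnd_eq_none`: the inputs of the erased graph are the surviving edges whose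
source was missing or was `v`. -/
theorem mem_erase_ins {l r : List E} (h : G.ins = l ++ G.vin v ++ r) {x : E} :
    x ∈ l ++ G.vout v ++ r ↔ G.tgt x ≠ some v ∧ (G.src x = none ∨ G.src x = some v) := by
  have hv := isInitial_of_ins_eq h
  have hn := G.nodup_of_sorted G.ins_sorted
  have hm := G.mem_ins x
  rw [h] at hn hm
  simp only [List.nodup_append, List.mem_append] at hn hm
  simp only [List.mem_append, G.mem_vout]
  have hm' := G.mem_vin v x
  have h1 : x ∈ l → x ∉ G.vin v := fun h h' => hn.1.2.2 x h x h' rfl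
  have h2 : x ∈ r → x ∉ G.vin v := fun h h' => hn.2.2 x (Or.inr h') x h rfl
  have h3 : G.src x = some v → x ∉ G.vin v := fun h h' => by rw [hv x h'] at h; cases h
  tauto

/-- Remove an initial vertex and its inputs; its outputs become inputs of the graph. -/
noncomputable def erase (G : PlanarGraph E V) (v : V) (l r : List E)
    (h : G.ins = l ++ G.vin v ++ r) : PlanarGraph {x // G.tgt x ≠ some v} {w // w ≠ v} where
  src x := restrictEnd v (G.src x.1)
  tgt x := restrictEnd v (G.tgt x.1)
  lt x y := G.lt x.1 y.1
  vin w := restrictList _ (G.vin w.1)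
  vout w := restrictList _ (G.vout w.1)
  ins := restrictList _ (l ++ G.vout v ++ r)
  outs := restrictList _ G.outs
  lt_irrefl x := G.lt_irrefl x.1
  lt_trans _ _ _ := G.lt_trans _ _ _
  lt_total x y := by simpa [Subtype.ext_iff] using G.lt_total x.1 y.1
  planar₁ _ _ hr := G.planar₁ _ _ ((isInitial_of_ins_eq h).reach_iff.1 hr)
  planar₂ _ _ _ hr h1 h2 := by
    have hv := isInitial_of_ins_eq h
    exact (G.planar₂ _ _ _ (hv.reach_iff.1 hr) h1 h2).imp hv.reach_iff.2 hv.reach_iff.2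
  vin_sorted w := restrictList_pairwise _ (G.vin_sorted _)
  vout_sorted w := restrictList_pairwise _ (G.vout_sorted _)
  ins_sorted := restrictList_pairwise _ (sorted_erase h)
  outs_sorted := restrictList_pairwise _ G.outs_sorted
  mem_vin w x := by rw [mem_restrictList, G.mem_vin, restrictEnd_eq_some]
  mem_vout w x := by rw [mem_restrictList, G.mem_vout, restrictEnd_eq_some]
  mem_ins x := by
    rw [mem_restrictList, mem_erase_ins h, restrictEnd_eq_none]
    exact and_iff_right x.2
  mem_outs x := by
    rw [mem_restrictList, G.mem_outs, restrictEnd_eq_none]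
    exact (or_iff_left x.2).symm
  vin_ne_nil w := by
    obtain ⟨x, hx⟩ := List.exists_mem_of_ne_nil _ (G.vin_ne_nil w.1)
    have hx' := (G.mem_vin _ _).1 hx
    exact List.ne_nil_of_mem ((mem_restrictList _ (x := ⟨x, by
      rw [hx']; exact fun e => w.2 (Option.some.inj e)⟩)).2 hx)
  vout_ne_nil w := by
    obtain ⟨x, hx⟩ := List.exists_mem_of_ne_nil _ (G.vout_ne_nil w.1)
    have hx' := (G.mem_vout _ _).1 hx
    exact List.ne_nil_of_mem ((mem_restrictList _ (x := ⟨x,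
      (isInitial_of_ins_eq h).tgt_ne_of_src (by simp [hx'])⟩)).2 hx)

section erase

variable {l r : List E} (h : G.ins = l ++ G.vin v ++ r)

/-- Restriction loses no edge from the lists that define the erased graph, so each of them can be
compared with a list of `G` through the injective map `Subtype.val`. -/
theorem map_val_erase_ins : (G.erase v l r h).ins.map Subtype.val = l ++ G.vout v ++ r :=
  map_val_restrictList _ fun _ hx => ((mem_erase_ins h).1 hx).1

theorem map_val_erase_outs : (G.erase v l r h).outs.map Subtype.val = G.outs :=
  map_val_restrictList _ fun x hx => by rw [(G.mem_outs x).1 hx]; simp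

theorem map_val_erase_vin (w : {w // w ≠ v}) :
    ((G.erase v l r h).vin w).map Subtype.val = G.vin w.1 :=
  map_val_restrictList _ fun x hx => by
    rw [(G.mem_vin _ x).1 hx]; exact fun e => w.2 (Option.some.inj e)

theorem map_val_erase_vout (w : {w // w ≠ v}) :
    ((G.erase v l r h).vout w).map Subtype.val = G.vout w.1 :=
  map_val_restrictList _ fun x hx => (isInitial_of_ins_eq h).tgt_ne_of_src
    (by simp [(G.mem_vout _ x).1 hx])

end erase

end PlanarGraph

/-! ### Splitting a diagram into the layer of an initial vertex and the rest. -/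

namespace Diagram

variable {S : Sig.{u}} {E V : Type}

/-- Remove an initial vertex of a diagram. -/
noncomputable def erase (A : Diagram S E V) (v : V) (l r : List E)
    (h : A.graph.ins = l ++ A.graph.vin v ++ r) :
    Diagram S {x // A.graph.tgt x ≠ some v} {w // w ≠ v} where
  graph := A.graph.erase v l r h
  col x := A.col x.1
  dec w := A.dec w.1
  typ w := by
    have := A.typ w.1
    rw [← PlanarGraph.map_val_erase_vin h w, ← PlanarGraph.map_val_erase_vout h w] at this
    rw [List.map_map, List.map_map] at this
    exact this

/-- One vertex with unitary diagrams on its left and on its right. -/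
def layer (a : List S.O) (f : S.M) (x y : List S.O) (b : List S.O) (hx : x ≠ []) (hy : y ≠ [])
    (h : S.typ f x y) : Diagram S ((Fin a.length ⊕ (Fin x.length ⊕ Fin y.length)) ⊕ Fin b.length)
      ((Empty ⊕ Unit) ⊕ Empty) :=
  ((unit S a).tensor (corolla f x y hx hy h)).tensor (unit S b)

/-- Coincides with the word in `cod_layer`, so that the layer of `v` can be composed with what
remains. -/
theorem dom_erase (A : Diagram S E V) (v : V) (l r : List E)
    (h : A.graph.ins = l ++ A.graph.vin v ++ r) : (A.erase v l r h).dom =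
      l.map A.col ++ (A.graph.vout v).map A.col ++ r.map A.col := by
  rw [← List.map_append, ← List.map_append, ← PlanarGraph.map_val_erase_ins h, List.map_map]
  rfl

theorem cod_layer (a : List S.O) (f : S.M) (x y : List S.O) (b : List S.O) (hx : x ≠ [])
    (hy : y ≠ []) (h : S.typ f x y) : (layer a f x y b hx hy h).cod = a ++ y ++ b := by
  rw [layer, cod_tensor, cod_tensor, cod_unit, cod_corolla, cod_unit]

/-- The diagrams obtained by removing two initial vertices in either order agree. -/
theorem iso_erase_erase [Finite E] (A : Diagram S E V) {v w : V} (hv : v ≠ w)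
    {l r l' r' : List E} (h : A.graph.ins = l ++ A.graph.vin v ++ r)
    (h' : A.graph.ins = l' ++ A.graph.vin w ++ r') {l₁ r₁ l₂ r₂}
    (h₁ : (A.erase v l r h).graph.ins = l₁ ++ (A.erase v l r h).graph.vin ⟨w, hv.symm⟩ ++ r₁)
    (h₂ : (A.erase w l' r' h').graph.ins = l₂ ++ (A.erase w l' r' h').graph.vin ⟨v, hv⟩ ++ r₂) :
    Iso ((A.erase v l r h).erase _ l₁ r₁ h₁) ((A.erase w l' r' h').erase _ l₂ r₂ h₂) := by
  have key : ∀ (v w : V) (hvw : w ≠ v) (l r : List E) (h : A.graph.ins = l ++ A.graph.vin v ++ r)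
      (x : {x // A.graph.tgt x ≠ some v}),
      (A.erase v l r h).graph.tgt x ≠ some ⟨w, hvw⟩ ↔ A.graph.tgt x.1 ≠ some w :=
    fun v w hvw l r h x => not_congr (restrictEnd_eq_some (w := ⟨w, hvw⟩))
  have key2 : ∀ (o : Option V) (u : V) (h1 : u ≠ v) (h2 : (⟨u, h1⟩ : {u // u ≠ v}) ≠ ⟨w, hv.symm⟩),
      restrictEnd (⟨w, hv.symm⟩ : {u // u ≠ v}) (restrictEnd v o) = some ⟨⟨u, h1⟩, h2⟩ ↔
        o = some u := fun o u h1 h2 => restrictEnd_eq_some.trans restrictEnd_eq_some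
  have key3 : ∀ (o : Option V) (u : V) (h1 : u ≠ w) (h2 : (⟨u, h1⟩ : {u // u ≠ w}) ≠ ⟨v, hv⟩),
      restrictEnd (⟨v, hv⟩ : {u // u ≠ w}) (restrictEnd w o) = some ⟨⟨u, h1⟩, h2⟩ ↔
        o = some u := fun o u h1 h2 => restrictEnd_eq_some.trans restrictEnd_eq_some
  let g : {u : {u // u ≠ v} // u ≠ ⟨w, hv.symm⟩} ≃ {u : {u // u ≠ w} // u ≠ ⟨v, hv⟩} :=
    { toFun := fun u => ⟨⟨u.1.1, fun e => u.2 (Subtype.ext e)⟩,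
        fun e => u.1.2 (congrArg Subtype.val e)⟩
      invFun := fun u => ⟨⟨u.1.1, fun e => u.2 (Subtype.ext e)⟩,
        fun e => u.1.2 (congrArg Subtype.val e)⟩
      left_inv := fun _ => rfl
      right_inv := fun _ => rfl }
  -- The two orders of removal leave the same vertices, nested differently in subtypes, and `g` only
  -- changes the nesting; so forgetting the ends `v` and `w` commutes.
  have ends : ∀ o : Option V, restrictEnd (⟨v, hv⟩ : {u // u ≠ w}) (restrictEnd w o) =
      (restrictEnd (⟨w, hv.symm⟩ : {u // u ≠ v}) (restrictEnd v o)).map g := by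
    intro o
    ext u
    obtain ⟨⟨u, h1⟩, h2⟩ := u
    rw [key3, Option.map_eq_some_iff]
    constructor
    · rintro rfl
      exact ⟨⟨⟨u, fun e => h2 (Subtype.ext e)⟩, fun e => h1 (congrArg Subtype.val e)⟩,
        (key2 _ _ _ _).2 rfl, rfl⟩
    · rintro ⟨⟨⟨u', h3⟩, h4⟩, h5, h6⟩
      cases h6
      exact (key2 _ _ _ _).1 h5
  -- On underlying edges the isomorphism is the identity; only the two conditions of survival are
  -- interchanged.
  refine ⟨
    { toFun := fun x => ⟨⟨x.1.1, (key _ _ hv.symm _ _ h x.1).1 x.2⟩, (key _ _ hv _ _ h' _).2 x.1.2⟩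
      invFun := fun x => ⟨⟨x.1.1, (key _ _ hv _ _ h' x.1).1 x.2⟩, (key _ _ hv.symm _ _ h _).2 x.1.2⟩
      left_inv := fun _ => rfl
      right_inv := fun _ => rfl }, g, ?_⟩
  exact ⟨fun x => ends _, fun x => ends _, fun _ _ => Iff.rfl, fun _ => rfl, fun _ => rfl⟩

/-- The edges of the layer enumerate `l`, the inputs and the outputs of `v`, and `r`; those of the
erased diagram are edges of `A` already. `Compat.of_comp` and `Iso.of_compat` reduce the claim to
equalities of lists, colours and decorations, because the local orders determine the planar order
and force the map to be bijective. -/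
theorem iso_layer_comp_erase [Finite E] (A : Diagram S E V) (v : V) (l r : List E)
    (h : A.graph.ins = l ++ A.graph.vin v ++ r) (hx hy ht hc) :
    Iso (comp (layer (l.map A.col) (A.dec v) ((A.graph.vin v).map A.col)
      ((A.graph.vout v).map A.col) (r.map A.col) hx hy ht) (A.erase v l r h) hc) A := by
  classical
  let f : (Fin (l.map A.col).length ⊕ (Fin ((A.graph.vin v).map A.col).length ⊕
      Fin ((A.graph.vout v).map A.col).length)) ⊕ Fin (r.map A.col).length → E :=
    Sum.elim (Sum.elim (fun i => l.get (i.cast (by simp)))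
      (Sum.elim (fun i => (A.graph.vin v).get (i.cast (by simp)))
        (fun i => (A.graph.vout v).get (i.cast (by simp))))) (fun i => r.get (i.cast (by simp)))
  let g : ((Empty ⊕ Unit) ⊕ Empty) ⊕ {w // w ≠ v} ≃ V :=
    { toFun := Sum.elim (fun _ => v) Subtype.val
      invFun := fun w => if h : w = v then Sum.inl (Sum.inl (Sum.inr ())) else Sum.inr ⟨w, h⟩
      left_inv := by
        rintro (((x | x) | x) | x)
        · exact x.elim
        · simp
        · exact x.elim
        · simp [x.2]
      right_inv := by
        intro w
        by_cases h : w = v <;> simp [h] }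
  have hl : (List.finRange (l.map A.col).length).map (fun i => l.get (i.cast (by simp))) = l :=
    PlanarGraph.map_finRange_get (by simp)
  have hr : (List.finRange (r.map A.col).length).map (fun i => r.get (i.cast (by simp))) = r :=
    PlanarGraph.map_finRange_get (by simp)
  have hi : (List.finRange ((A.graph.vin v).map A.col).length).map
      (fun i => (A.graph.vin v).get (i.cast (by simp))) = A.graph.vin v :=
    PlanarGraph.map_finRange_get (by simp)
  have ho : (List.finRange ((A.graph.vout v).map A.col).length).map
      (fun i => (A.graph.vout v).get (i.cast (by simp))) = A.graph.vout v :=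
    PlanarGraph.map_finRange_get (by simp)
  refine Iso.of_compat (f := PlanarGraph.Glue.elim f Subtype.val) (g := g)
    (PlanarGraph.Compat.of_comp ?_ ?_ ?_ ?_ ?_ ?_ ?_) ?_ ?_
  -- The grafted legs: the outputs of the layer and the inputs of the erased diagram must have the
  -- same images in `A`, namely `l`, the outputs of `v`, and `r`.
  · refine Eq.trans ?_ (PlanarGraph.map_val_erase_ins h).symm
    simp only [layer, tensor, unit, corolla, PlanarGraph.tensor, PlanarGraph.unit,
      PlanarGraph.corolla, List.map_append, List.map_map, f, Function.comp_def, Sum.elim_inl,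
      Sum.elim_inr, hl, ho, hr]
  · rw [h]
    simp only [layer, tensor, unit, corolla, PlanarGraph.tensor, PlanarGraph.unit,
      PlanarGraph.corolla, List.map_append, List.map_map, f, Function.comp_def, Sum.elim_inl,
      Sum.elim_inr, hl, hi, hr]
  · exact PlanarGraph.map_val_erase_outs h
  · rintro ((x | x) | x)
    · exact x.elim
    · simp only [layer, tensor, unit, corolla, PlanarGraph.tensor, PlanarGraph.unit,
        PlanarGraph.corolla, List.map_append, List.map_map, f, Function.comp_def, Sum.elim_inl,
        Sum.elim_inr, hi]
      rfl
    · exact x.elim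
  · rintro ((x | x) | x)
    · exact x.elim
    · simp only [layer, tensor, unit, corolla, PlanarGraph.tensor, PlanarGraph.unit,
        PlanarGraph.corolla, List.map_append, List.map_map, f, Function.comp_def, Sum.elim_inl,
        Sum.elim_inr, ho]
      rfl
    · exact x.elim
  · exact fun w => PlanarGraph.map_val_erase_vin h w
  · exact fun w => PlanarGraph.map_val_erase_vout h w
  · have hf : ∀ p, A.col (f p) = (layer (l.map A.col) (A.dec v) ((A.graph.vin v).map A.col)
        ((A.graph.vout v).map A.col) (r.map A.col) hx hy ht).col p := by
      rintro ((x | (x | x)) | x) <;> simp [f, layer, tensor, unit, corolla]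
    rintro (⟨x, hx⟩ | ⟨x, y, hx⟩ | ⟨x, hx⟩)
    · exact hf x
    · exact hf x
    · rfl
  · rintro (((x | x) | x) | x)
    · exact x.elim
    · rfl
    · exact x.elim
    · rfl

/-- If a diagram begins with a layer, then what follows the layer is obtained by removing an
initial vertex. -/
theorem exists_iso_erase {E' V' : Type} [Finite E] [Finite E'] {A : Diagram S E V}
    {B : Diagram S E' V'} {a : List S.O} {f : S.M} {x y b : List S.O} {hx : x ≠ []} {hy : y ≠ []}
    {ht : S.typ f x y} {hc} (h : Iso (comp (layer a f x y b hx hy ht) B hc) A) :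
    ∃ (v : V) (l r : List E) (hv : A.graph.ins = l ++ A.graph.vin v ++ r),
      l.map A.col = a ∧ A.dec v = f ∧ (A.graph.vin v).map A.col = x ∧
      (A.graph.vout v).map A.col = y ∧ r.map A.col = b ∧ Iso B (A.erase v l r hv) := by
  obtain ⟨e, g, h⟩ := h
  have hg := h.compat
  have hlen := length_of_cod_eq_dom hc
  -- `eL` and `eR` locate the edges of the layer and of `B` inside `A`; they overlap exactly on the
  -- grafted edges.
  let eL : _ → E := fun p => e (PlanarGraph.Glue.inL hlen p)
  let eR : _ → E := fun p => e (PlanarGraph.Glue.inR hlen p)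
  have hcL : ∀ p, A.col (eL p) = (layer a f x y b hx hy ht).col p := fun p =>
    (h.col _).trans (PlanarGraph.Glue.elim_inL hlen _ _ p)
  have hcR : ∀ p, A.col (eR p) = B.col p := fun p => (h.col _).trans (glue_col_inR hc p)
  let v : V := g (Sum.inl (Sum.inl (Sum.inr ())))
  let l : List E := (List.finRange a.length).map fun i => eL (Sum.inl (Sum.inl i))
  let r : List E := (List.finRange b.length).map fun i => eL (Sum.inr i)
  have hin : A.graph.vin v =
      (List.finRange x.length).map fun i => eL (Sum.inl (Sum.inr (Sum.inl i))) := by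
    rw [← hg.vin]
    simp [layer, tensor, unit, corolla, PlanarGraph.tensor, PlanarGraph.unit, PlanarGraph.corolla,
      comp, PlanarGraph.comp, Function.comp_def, eL]
  have hout : A.graph.vout v =
      (List.finRange y.length).map fun i => eL (Sum.inl (Sum.inr (Sum.inr i))) := by
    rw [← hg.vout]
    simp [layer, tensor, unit, corolla, PlanarGraph.tensor, PlanarGraph.unit, PlanarGraph.corolla,
      comp, PlanarGraph.comp, Function.comp_def, eL]
  have hv : A.graph.ins = l ++ A.graph.vin v ++ r := by
    rw [← hg.ins, hin]
    simp [layer, tensor, unit, corolla, PlanarGraph.tensor, PlanarGraph.unit, PlanarGraph.corolla,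
      comp, PlanarGraph.comp, Function.comp_def, eL, l, r]
  -- The inputs of `B` are glued to the outputs of the layer, whose images in `A` are known.
  have hmid : B.graph.ins.map eR = l ++ A.graph.vout v ++ r := by
    have := congrArg (List.map e) (PlanarGraph.Glue.map_outs_inL hlen)
    rw [List.map_map, List.map_map] at this
    refine this.symm.trans ?_
    rw [hout]
    simp [layer, tensor, unit, corolla, PlanarGraph.tensor, PlanarGraph.unit, PlanarGraph.corolla,
      Function.comp_def, eL, l, r]
  -- In the composite an edge of `B` ends at a vertex of `B` or nowhere, whereas `v` comes from the
  -- layer.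
  have hR : ∀ p, A.graph.tgt (eR p) ≠ some v := by
    intro p hp
    have h1 := hg.tgt_eq (PlanarGraph.Glue.inR hlen p)
    rw [show A.graph.tgt (e (PlanarGraph.Glue.inR hlen p)) = some v from hp] at h1
    obtain ⟨w, hw, hw'⟩ := Option.map_eq_some_iff.1 h1.symm
    rw [g.injective hw'] at hw
    have h2 := (PlanarGraph.Glue.tgt_inR hlen p).symm.trans hw
    obtain ⟨w, -, hw⟩ := Option.map_eq_some_iff.1 h2
    cases hw
  -- The layer contributes a single vertex, so the vertices of `B` account for all the others.
  let g' : V' ≃ {w // w ≠ v} := Equiv.ofBijective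
    (fun w => ⟨g (Sum.inr w), fun e => by cases g.injective e⟩) (by
      constructor
      · intro w w' hw
        exact Sum.inr_injective (g.injective (congrArg Subtype.val hw))
      · rintro ⟨w, hw⟩
        obtain ⟨(((u | u) | u) | u), rfl⟩ := g.surjective w
        · exact u.elim
        · exact (hw rfl).elim
        · exact u.elim
        · exact ⟨u, rfl⟩)
  have inj : Function.Injective (List.map (Subtype.val : {x // A.graph.tgt x ≠ some v} → E)) :=
    List.map_injective_iff.2 Subtype.val_injective
  refine ⟨v, l, r, hv, ?_, (h.dec _), ?_, ?_, ?_, ?_⟩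
  · simp only [l, List.map_map, Function.comp_def, hcL]
    exact List.map_get_finRange a
  · simp only [hin, List.map_map, Function.comp_def, hcL]
    exact List.map_get_finRange x
  · simp only [hout, List.map_map, Function.comp_def, hcL]
    exact List.map_get_finRange y
  · simp only [r, List.map_map, Function.comp_def, hcL]
    exact List.map_get_finRange b
  · refine Iso.of_compat (f := fun p => ⟨eR p, hR p⟩) (g := g') ⟨?_, ?_, ?_, ?_⟩ hcR ?_
    · apply inj
      rw [List.map_map]
      exact hmid.trans (PlanarGraph.map_val_erase_ins hv).symm
    · apply inj
      rw [List.map_map]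
      refine Eq.trans ?_ (PlanarGraph.map_val_erase_outs hv).symm
      rw [← hg.outs]
      exact (List.map_map (f := PlanarGraph.Glue.inR hlen) (g := e)).symm
    · intro w
      apply inj
      rw [List.map_map]
      refine Eq.trans ?_ (PlanarGraph.map_val_erase_vin hv _).symm
      refine Eq.trans ?_ (hg.vin (Sum.inr w))
      exact (List.map_map (f := PlanarGraph.Glue.inR hlen) (g := e)).symm
    · intro w
      apply inj
      rw [List.map_map]
      refine Eq.trans ?_ (PlanarGraph.map_val_erase_vout hv _).symm
      refine Eq.trans ?_ (hg.vout (Sum.inr w))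
      exact (List.map_map (f := PlanarGraph.Glue.inR hlen) (g := e)).symm
    · exact fun w => h.dec _

/-- Without vertices every edge is virtual, so the inputs and the outputs are one and the same
sorted list of all edges. -/
theorem iso_unit [Finite E] [IsEmpty V] (A : Diagram S E V) : Iso (unit S A.dom) A := by
  have h0 : ∀ o : Option V, o = none := fun o => by
    cases o with
    | none => rfl
    | some v => exact isEmptyElim v
  have hio : A.graph.ins = A.graph.outs := A.graph.eq_of_sorted A.graph.ins_sorted
    A.graph.outs_sorted fun x => by
      rw [A.graph.mem_ins, A.graph.mem_outs, h0 (A.graph.src x), h0 (A.graph.tgt x)]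
  have hi : (List.finRange A.dom.length).map
      (fun i => A.graph.ins.get (i.cast (by simp [dom]))) = A.graph.ins :=
    PlanarGraph.map_finRange_get (by simp [dom])
  refine Iso.of_compat (f := fun i => A.graph.ins.get (i.cast (by simp [dom])))
    (g := Equiv.equivOfIsEmpty _ _) ⟨hi, hi.trans hio, fun v => v.elim, fun v => v.elim⟩ ?_
    fun v => v.elim
  intro i
  exact (List.getElem_map A.col).symm

end Diagram

/-! ## Layers in strict tensor categories -/

namespace StrictTensorCat

variable (V : StrictTensorCat.{u})

theorem tensorList_append (a b : List V.Ob) :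
    V.tensorList (a ++ b) = V.tensorOb (V.tensorList a) (V.tensorList b) := by
  induction a with
  | nil => exact (V.one_tensorOb _).symm
  | cons x a ih =>
    change V.tensorOb x (V.tensorList (a ++ b)) = V.tensorOb (V.tensorOb x (V.tensorList a)) _
    rw [ih, V.tensorOb_assoc]

theorem tensorList_singleton (x : V.Ob) : V.tensorList [x] = x := V.tensorOb_one x

theorem id_tensorList_append (a b : List V.Ob) : V.id (V.tensorList (a ++ b)) =
    V.tensorMor (V.id (V.tensorList a)) (V.id (V.tensorList b)) := by
  rw [tensorList_append, V.tensor_id]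

/-- The morphism `f` with identities on its left and on its right. -/
def layer (a : List V.Ob) (f : V.Mor) (b : List V.Ob) : V.Mor :=
  V.tensorMor (V.tensorMor (V.id (V.tensorList a)) f) (V.id (V.tensorList b))

theorem layer_nil (f : V.Mor) : V.layer [] f [] = f :=
  (V.tensorMor_one _).trans (V.one_tensorMor f)

theorem layer_append_right (a : List V.Ob) (f : V.Mor) (b c : List V.Ob) :
    V.layer a f (b ++ c) = V.tensorMor (V.layer a f b) (V.id (V.tensorList c)) := by
  simp only [layer, id_tensorList_append, V.tensorMor_assoc]

theorem layer_append_left (a c : List V.Ob) (f : V.Mor) (b : List V.Ob) :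
    V.layer (c ++ a) f b = V.tensorMor (V.id (V.tensorList c)) (V.layer a f b) := by
  simp only [layer, id_tensorList_append, V.tensorMor_assoc]

variable {V}

theorem dom_layer {a : List V.Ob} {f : V.Mor} {b x : List V.Ob} (h : V.dom f = V.tensorList x) :
    V.dom (V.layer a f b) = V.tensorList (a ++ x ++ b) := by
  simp only [layer, V.dom_tensor, V.dom_id, h, tensorList_append]

theorem cod_layer {a : List V.Ob} {f : V.Mor} {b x : List V.Ob} (h : V.cod f = V.tensorList x) :
    V.cod (V.layer a f b) = V.tensorList (a ++ x ++ b) := by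
  simp only [layer, V.cod_tensor, V.cod_id, h, tensorList_append]

/-- The proof of composability depends on both morphisms, so both are replaced at once and the proof
is transported with them. -/
theorem comp_congr {f f' g g' : V.Mor} {h} (hf : f = f') (hg : g = g') :
    V.comp f g h = V.comp f' g' (hf ▸ hg ▸ h) := by
  subst hf hg; rfl

/-- Two layers acting on disjoint blocks commute. -/
theorem layer_comp_layer {a s b x y x' y' : List V.Ob} {f f' : V.Mor}
    (hx : V.dom f = V.tensorList x) (hy : V.cod f = V.tensorList y)
    (hx' : V.dom f' = V.tensorList x') (hy' : V.cod f' = V.tensorList y') (h h') :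
    V.comp (V.layer a f (s ++ x' ++ b)) (V.layer (a ++ y ++ s) f' b) h =
      V.comp (V.layer (a ++ x ++ s) f' b) (V.layer a f (s ++ y' ++ b)) h' := by
  have key : ∀ w : List V.Ob, V.layer a f (s ++ w ++ b) =
      V.tensorMor (V.layer a f s) (V.id (V.tensorList (w ++ b))) := fun w => by
    rw [List.append_assoc, layer_append_right]
  have key' : ∀ w : List V.Ob, V.layer (a ++ w ++ s) f' b =
      V.tensorMor (V.id (V.tensorList (a ++ w ++ s))) (V.layer [] f' b) := fun w => by
    rw [← layer_append_left, List.append_nil]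
  have d1 := cod_layer (a := a) (b := s) hy
  have d2 := dom_layer (a := a) (b := s) hx
  have d3 := dom_layer (a := []) (b := b) hx'
  have d4 := cod_layer (a := []) (b := b) hy'
  rw [List.nil_append] at d3 d4
  -- Both composites equal the tensor product in which `f` and `f'` act side by side: cutting the
  -- words after `s`, each layer is a layer on one side tensored with an identity, and interchange
  -- applies.
  trans V.tensorMor (V.layer a f s) (V.layer [] f' b)
  · rw [comp_congr (key x') (key' y), V.interchange _ _ _ _ (by rw [d1, V.dom_id])
      (by rw [d3, V.cod_id]), V.comp_id, V.id_comp]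
  · rw [comp_congr (key' x) (key y'), V.interchange _ _ _ _ (by rw [d2, V.cod_id])
      (by rw [d4, V.dom_id]), V.comp_id, V.id_comp]

end StrictTensorCat

/-! ## Layers of diagrams -/

/-- A vertex together with words on its left and on its right. -/
structure Layer (S : Sig.{u}) where
  left : List S.O
  dec : S.M
  inp : List S.O
  out : List S.O
  right : List S.O
  inp_ne_nil : inp ≠ []
  out_ne_nil : out ≠ []
  typ : S.typ dec inp out

namespace Layer

variable {S : Sig.{u}}

/-- The prime diagram of a layer. -/
noncomputable def prime (L : Layer S) : Diag S :=
  Diag.corolla L.dec L.inp L.out L.inp_ne_nil L.out_ne_nil L.typ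

/-- The diagram of a layer. -/
noncomputable def diag (L : Layer S) : Diag S :=
  Diag.tensor (Diag.tensor (Diag.unit L.left) L.prime) (Diag.unit L.right)

/-- A layer as a diagram on an explicit graph. -/
def diagram (L : Layer S) := Diagram.layer L.left L.dec L.inp L.out L.right L.inp_ne_nil
  L.out_ne_nil L.typ

/-- Passes from the algebraic description to an explicit graph, where `Diagram.iso_layer_comp_erase`
and `Diagram.exists_iso_erase` apply. -/
theorem diag_eq (L : Layer S) : L.diag = Diag.cls L.diagram := by
  rw [diag, prime, Diag.corolla, Diag.unit, Diag.tensor_cls, Diag.unit, Diag.tensor_cls]; rfl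

theorem dom_diag (L : Layer S) : L.diag.dom = L.left ++ L.inp ++ L.right := by
  rw [diag, Diag.dom_tensor, Diag.dom_tensor, Diag.dom_unit, prime, Diag.dom_corolla,
    Diag.dom_unit]

theorem cod_diag (L : Layer S) : L.diag.cod = L.left ++ L.out ++ L.right := by
  rw [diag, Diag.cod_tensor, Diag.cod_tensor, Diag.cod_unit, prime, Diag.cod_corolla,
    Diag.cod_unit]

/-- Add a word on the right. -/
def addRight (L : Layer S) (w : List S.O) : Layer S := { L with right := L.right ++ w }

/-- Add a word on the left. -/
def addLeft (w : List S.O) (L : Layer S) : Layer S := { L with left := w ++ L.left }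

theorem diag_addRight (L : Layer S) (w : List S.O) :
    (L.addRight w).diag = Diag.tensor L.diag (Diag.unit w) := by
  simp only [diag, addRight, prime, ← Diag.unit_tensor_unit, Diag.tensor_assoc]

theorem diag_addLeft (w : List S.O) (L : Layer S) :
    (L.addLeft w).diag = Diag.tensor (Diag.unit w) L.diag := by
  simp only [diag, addLeft, prime, ← Diag.unit_tensor_unit, Diag.tensor_assoc]

/-- The layer of an initial vertex of a diagram. -/
def ofVertex {E V : Type} (A : Diagram S E V) (v : V) (l r : List E) : Layer S where
  left := l.map A.col
  dec := A.dec v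
  inp := (A.graph.vin v).map A.col
  out := (A.graph.vout v).map A.col
  right := r.map A.col
  inp_ne_nil := by simpa using A.graph.vin_ne_nil v
  out_ne_nil := by simpa using A.graph.vout_ne_nil v
  typ := A.typ v

end Layer

namespace Diag

variable {S : Sig.{u}} {E V : Type} [Finite E] [Finite V]

theorem comp_congr {d d' e e' : Diag S} {h} (hd : d = d') (he : e = e') :
    comp d e h = comp d' e' (hd ▸ he ▸ h) := by
  subst hd he; rfl

theorem cod_ofVertex {A : Diagram S E V} {v : V} {l r : List E}
    (h : A.graph.ins = l ++ A.graph.vin v ++ r) :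
    (Layer.ofVertex A v l r).diag.cod = (cls (A.erase v l r h)).dom := by
  rw [Layer.cod_diag, dom_cls, Diagram.dom_erase]; rfl

theorem comp_erase {A : Diagram S E V} {v : V} {l r : List E}
    (h : A.graph.ins = l ++ A.graph.vin v ++ r) (hc) :
    comp (Layer.ofVertex A v l r).diag (cls (A.erase v l r h)) hc = cls A := by
  have hd := (Layer.ofVertex A v l r).diag_eq
  refine (comp_congr hd rfl).trans ?_
  rw [comp_cls, cls_eq_iff]
  exact Diagram.iso_layer_comp_erase A v l r h _ _ _ _

theorem exists_erase_of_comp {A : Diagram S E V} {L : Layer S} {d : Diag S} {hc}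
    (h : comp L.diag d hc = cls A) :
    ∃ (v : V) (l r : List E) (hv : A.graph.ins = l ++ A.graph.vin v ++ r),
      l.map A.col = L.left ∧ A.dec v = L.dec ∧ r.map A.col = L.right ∧
        d = cls (A.erase v l r hv) := by
  induction d using ind with | h n k B =>
  rw [comp_congr L.diag_eq rfl, comp_cls, cls_eq_iff] at h
  obtain ⟨v, l, r, hv, h1, h2, -, -, h3, h4⟩ := Diagram.exists_iso_erase h
  exact ⟨v, l, r, hv, h1, h2, h3, cls_eq_iff.2 h4⟩

theorem cls_eq_unit [IsEmpty V] (A : Diagram S E V) : cls A = unit A.dom :=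
  cls_eq_iff.2 A.iso_unit.symm

/-- Every diagram is built from unitary diagrams by composing with layers. -/
@[elab_as_elim]
theorem layer_ind {P : Diag S → Prop} (hu : ∀ w, P (unit w))
    (hL : ∀ (L : Layer S) (d : Diag S) (h), P d → P (comp L.diag d h)) (d : Diag S) : P d := by
  -- Induction on the number of vertices. The edge and vertex types vary with it, since erasing a
  -- vertex replaces them by subtypes.
  have key : ∀ (n : ℕ) (E V : Type) [Finite E] [Finite V] (A : Diagram S E V),
      Nat.card V = n → P (cls A) := by
    intro n
    induction n with
    | zero =>
      intro E V _ _ A hn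
      have := Finite.card_eq_zero_iff.1 hn
      rw [cls_eq_unit]
      exact hu _
    | succ n ih =>
      intro E V _ _ A hn
      have : Nonempty V := (Nat.card_pos_iff.1 (by omega)).1
      obtain ⟨v, hv⟩ := A.graph.exists_isInitial
      obtain ⟨l, r, h⟩ := hv.exists_ins_eq
      rw [← comp_erase h (cod_ofVertex h)]
      refine hL _ _ _ (ih _ _ _ ?_)
      have := Fintype.ofFinite V
      classical
      rw [Nat.card_eq_fintype_card] at hn ⊢
      simp [hn]
  induction d using ind with | h n k A => exact key _ _ _ A rfl

end Diag

/-! ## Positions of initial vertices -/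

theorem restrictList_append {α : Type} (P : α → Prop) (l l' : List α) :
    restrictList P (l ++ l') = restrictList P l ++ restrictList P l' :=
  List.filterMap_append

namespace PlanarGraph

variable {E V : Type} {G : PlanarGraph E V} {v w : V} {l r l' r' : List E}

/-- The right-hand side does not mention the decomposition, so the decomposition around a given
vertex is unique. -/
theorem mem_left_iff (h : G.ins = l ++ G.vin v ++ r) (x : E) :
    x ∈ l ↔ G.src x = none ∧ ∀ i ∈ G.vin v, G.lt x i := by
  have hs := G.ins_sorted
  have hm := G.mem_ins x
  rw [h] at hs hm
  rw [List.pairwise_append, List.pairwise_append] at hs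
  obtain ⟨i, hi⟩ := List.exists_mem_of_ne_nil _ (G.vin_ne_nil v)
  constructor
  · exact fun hx => ⟨hm.1 (by simp [hx]), hs.1.2.2 x hx⟩
  · rintro ⟨h1, h2⟩
    have h1 := hm.2 h1
    rw [List.mem_append, List.mem_append] at h1
    rcases h1 with (h1 | h1) | h1
    · exact h1
    · exact (G.lt_irrefl _ (h2 x h1)).elim
    · exact (G.lt_asymm (h2 i hi) (hs.2.2 i (by simp [hi]) x h1)).elim

theorem left_right_unique (h : G.ins = l ++ G.vin v ++ r) (h' : G.ins = l' ++ G.vin v ++ r') :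
    l = l' ∧ r = r' := by
  have sub : ∀ {l r}, G.ins = l ++ G.vin v ++ r → l.Pairwise G.lt := fun {l r} h => by
    have hs := G.ins_sorted
    rw [h, List.append_assoc, List.pairwise_append] at hs
    exact hs.1
  have hl : l = l' := G.eq_of_sorted (sub h) (sub h') fun x => by
    rw [mem_left_iff h, mem_left_iff h']
  subst hl
  exact ⟨rfl, List.append_cancel_left (h.symm.trans h')⟩

/-- If an input of `v` lies on the left of an input of `w`, then the block of `v` lies on the left
of the block of `w`. -/
theorem exists_between (hvw : v ≠ w) (h : G.ins = l ++ G.vin v ++ r)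
    (h' : G.ins = l' ++ G.vin w ++ r') {i j : E} (hi : i ∈ G.vin v) (hj : j ∈ G.vin w)
    (hij : G.lt i j) : ∃ s, l' = l ++ G.vin v ++ s ∧ r = s ++ G.vin w ++ r' := by
  have hv := isInitial_of_ins_eq h
  have hw := isInitial_of_ins_eq h'
  have disj : ∀ x, x ∈ G.vin v → x ∉ G.vin w := fun x h1 h2 => by
    rw [G.mem_vin] at h1 h2
    rw [h1] at h2
    exact hvw (Option.some.inj h2)
  -- An input `x` of `w` in `l` precedes `i`; since `i` is not an input of `w`, `right_of_all` puts
  -- every input of `w` before `i`, including `j`, against `hij`.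
  have hlt : ∀ x ∈ G.vin w, ¬ x ∈ l ++ G.vin v := by
    intro x hx hx'
    rcases List.mem_append.1 hx' with h1 | h1
    · have h2 := ((mem_left_iff h x).1 h1).2 i hi
      have h3 := hw.right_of_all hx (hv i hi) (disj i hi) h2 j hj
      exact G.lt_asymm hij h3
    · exact disj x h1 hx
  -- Comparison of two cuts of the same list. Were `l'` strictly shorter than `l ++ G.vin v`, the
  -- leading input of `w` would lie in the latter, which `hlt` excludes.
  rw [h, List.append_assoc l' , List.append_eq_append_iff] at h'
  rcases h' with ⟨s, h1, h2⟩ | ⟨c, h1, h2⟩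
  · exact ⟨s, h1, by rw [h2, List.append_assoc]⟩
  · cases c with
    | nil => exact ⟨[], by simpa using h1.symm, by simpa using h2.symm⟩
    | cons x c =>
      obtain ⟨y, t, ht⟩ := List.exists_cons_of_ne_nil (G.vin_ne_nil w)
      rw [ht] at h2
      simp only [List.cons_append, List.cons.injEq] at h2
      exact (hlt y (by simp [ht]) (by rw [h1, h2.1]; simp)).elim

end PlanarGraph

/-! ## Existence and uniqueness of the value of a diagram -/

section evaluation

/-- An interpretation of decorating data in a strict tensor category. -/
structure Interp (S : Sig.{u}) (V : StrictTensorCat.{u}) where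
  ob : S.O → V.Ob
  mor : S.M → V.Mor
  dom_mor : ∀ f a b, S.typ f a b → V.dom (mor f) = V.tensorList (a.map ob)
  cod_mor : ∀ f a b, S.typ f a b → V.cod (mor f) = V.tensorList (b.map ob)

variable {S : Sig.{u}} {V : StrictTensorCat.{u}} {I : Interp S V}

namespace Interp

variable (I)

/-- The value of a word. -/
def word (w : List S.O) : V.Ob := V.tensorList (w.map I.ob)

/-- The value of a decorated vertex with words on its left and on its right. -/
def layer (a : List S.O) (f : S.M) (b : List S.O) : V.Mor :=
  V.layer (a.map I.ob) (I.mor f) (b.map I.ob)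

theorem id_word_append (a b : List S.O) :
    V.id (I.word (a ++ b)) = V.tensorMor (V.id (I.word a)) (V.id (I.word b)) := by
  rw [word, List.map_append, StrictTensorCat.id_tensorList_append]; rfl

theorem layer_append_right (a : List S.O) (f : S.M) (b c : List S.O) :
    I.layer a f (b ++ c) = V.tensorMor (I.layer a f b) (V.id (I.word c)) := by
  rw [layer, List.map_append, StrictTensorCat.layer_append_right]; rfl

theorem layer_append_left (a c : List S.O) (f : S.M) (b : List S.O) :
    I.layer (c ++ a) f b = V.tensorMor (V.id (I.word c)) (I.layer a f b) := by
  rw [layer, List.map_append, StrictTensorCat.layer_append_left]; rfl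

variable {I}

theorem layer_comp_layer {a s b x y x' y' : List S.O} {f f' : S.M}
    (hf : S.typ f x y) (hf' : S.typ f' x' y') (h h') :
    V.comp (I.layer a f (s ++ x' ++ b)) (I.layer (a ++ y ++ s) f' b) h =
      V.comp (I.layer (a ++ x ++ s) f' b) (I.layer a f (s ++ y' ++ b)) h' := by
  simp only [layer, List.map_append]
  exact StrictTensorCat.layer_comp_layer (I.dom_mor _ _ _ hf) (I.cod_mor _ _ _ hf)
    (I.dom_mor _ _ _ hf') (I.cod_mor _ _ _ hf') _ _

end Interp

namespace Layer

variable (I) in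
/-- The morphism of a layer in a strict tensor category. -/
def mor (L : Layer S) : V.Mor := I.layer L.left L.dec L.right

theorem dom_mor (L : Layer S) : V.dom (L.mor I) = I.word L.diag.dom := by
  rw [dom_diag, Interp.word, List.map_append, List.map_append]
  exact StrictTensorCat.dom_layer (I.dom_mor _ _ _ L.typ)

theorem cod_mor (L : Layer S) : V.cod (L.mor I) = I.word L.diag.cod := by
  rw [cod_diag, Interp.word, List.map_append, List.map_append]
  exact StrictTensorCat.cod_layer (I.cod_mor _ _ _ L.typ)

theorem mor_addRight (L : Layer S) (w : List S.O) :
    (L.addRight w).mor I = V.tensorMor (L.mor I) (V.id (I.word w)) :=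
  I.layer_append_right _ _ _ _

theorem mor_addLeft (w : List S.O) (L : Layer S) :
    (L.addLeft w).mor I = V.tensorMor (V.id (I.word w)) (L.mor I) :=
  I.layer_append_left _ _ _ _

end Layer

/-- `HasValue I d m`: composing the layers of some decomposition of the diagram `d` gives `m`. -/
inductive HasValue (I : Interp S V) : Diag S → V.Mor → Prop
  | unit (w : List S.O) : HasValue I (Diag.unit w) (V.id (I.word w))
  | layer (L : Layer S) (d : Diag S) (m : V.Mor)
      (hd : L.diag.cod = d.dom) (hm : V.cod (L.mor I) = V.dom m) :
      HasValue I d m → HasValue I (Diag.comp L.diag d hd) (V.comp (L.mor I) m hm)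

/-! ### The value of a diagram: existence, uniqueness, compatibility with composition and tensor
product. -/

namespace HasValue

theorem dom_eq {d : Diag S} {m : V.Mor} (h : HasValue I d m) :
    V.dom m = I.word d.dom := by
  cases h with
  | unit w => rw [V.dom_id, Diag.dom_unit]
  | layer L d m hd hm h => rw [V.dom_comp, Diag.dom_comp, L.dom_mor]

theorem cod_eq {d : Diag S} {m : V.Mor} (h : HasValue I d m) :
    V.cod m = I.word d.cod := by
  induction h with
  | unit w => rw [V.cod_id, Diag.cod_unit]
  | layer L d m hd hm h ih => rw [V.cod_comp, Diag.cod_comp, ih]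

variable (I) in
theorem exists_value (d : Diag S) : ∃ m, HasValue I d m := by
  induction d using Diag.layer_ind with
  | hu w => exact ⟨_, .unit w⟩
  | hL L d h ih =>
    obtain ⟨m, hm⟩ := ih
    exact ⟨_, .layer L d m h (by rw [L.cod_mor, hm.dom_eq, h]) hm⟩

variable {E X : Type} [Finite E] [Finite X]

/-- Inversion of `HasValue` on an explicit graph: the leading layer of any decomposition comes from
an initial vertex of `A`, and what follows it is the erased diagram. -/
theorem cases_erase {A : Diagram S E X} {m : V.Mor} (h : HasValue I (Diag.cls A) m) :
    (IsEmpty X ∧ m = V.id (I.word A.dom)) ∨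
      ∃ (v : X) (l r : List E) (hv : A.graph.ins = l ++ A.graph.vin v ++ r) (m' : V.Mor) (hm' : _),
        HasValue I (Diag.cls (A.erase v l r hv)) m' ∧
        m = V.comp (I.layer (l.map A.col) (A.dec v) (r.map A.col)) m' hm' := by
  generalize hd : Diag.cls A = d at h
  cases h with
  | unit w =>
    left
    have hw := congrArg Diag.dom hd
    rw [Diag.dom_cls, Diag.dom_unit] at hw
    rw [hw]
    obtain ⟨e, g, -⟩ := Diag.cls_eq_iff.1 hd
    exact ⟨g.isEmpty, rfl⟩
  | layer L d m hd' hm h =>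
    right
    obtain ⟨v, l, r, hv, h1, h2, h3, rfl⟩ := Diag.exists_erase_of_comp hd.symm
    refine ⟨v, l, r, hv, m, ?_, h, ?_⟩
    · rw [h1, h2, h3]; exact hm
    · exact StrictTensorCat.comp_congr (by rw [h1, h2, h3]; rfl) rfl

theorem of_erase {A : Diagram S E X} {v : X} {l r : List E}
    {hv : A.graph.ins = l ++ A.graph.vin v ++ r} {m : V.Mor} {hm}
    (h : HasValue I (Diag.cls (A.erase v l r hv)) m) :
    HasValue I (Diag.cls A) (V.comp (I.layer (l.map A.col) (A.dec v) (r.map A.col)) m hm) := by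
  rw [← Diag.comp_erase hv (Diag.cod_ofVertex hv)]
  exact .layer (Layer.ofVertex A v l r) _ m _ hm h

theorem layer_hom {A : Diagram S E X} {v : X} {l r : List E}
    (hv : A.graph.ins = l ++ A.graph.vin v ++ r) {m : V.Mor}
    (h : HasValue I (Diag.cls (A.erase v l r hv)) m) :
    V.cod (I.layer (l.map A.col) (A.dec v) (r.map A.col)) = V.dom m := by
  refine ((Layer.ofVertex A v l r).cod_mor).trans ?_
  rw [h.dom_eq, Diag.cod_ofVertex hv]

/-- The diamond. Let `k` be a value of the diagram with both vertices removed. Uniqueness for the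
two smaller diagrams makes `m` the layer of `w` followed by `k`, and `m'` the layer of `v` followed
by `k`; the two sides then differ by exchanging layers on disjoint blocks. -/
theorem eq_of_lt {A : Diagram S E X} {v w : X} (hvw : v ≠ w) {l r l' r' : List E}
    (hv : A.graph.ins = l ++ A.graph.vin v ++ r) (hw : A.graph.ins = l' ++ A.graph.vin w ++ r')
    {m m' : V.Mor} {hm hm'} (h : HasValue I (Diag.cls (A.erase v l r hv)) m)
    (h' : HasValue I (Diag.cls (A.erase w l' r' hw)) m')
    (uniq : ∀ {m₁}, HasValue I (Diag.cls (A.erase v l r hv)) m₁ → m = m₁)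
    (uniq' : ∀ {m₁}, HasValue I (Diag.cls (A.erase w l' r' hw)) m₁ → m' = m₁)
    {i j : E} (hi : i ∈ A.graph.vin v) (hj : j ∈ A.graph.vin w) (hij : A.graph.lt i j) :
    V.comp (I.layer (l.map A.col) (A.dec v) (r.map A.col)) m hm =
      V.comp (I.layer (l'.map A.col) (A.dec w) (r'.map A.col)) m' hm' := by
  -- The inputs of the graph now read `l`, inputs of `v`, `s`, inputs of `w`, `r'`.
  obtain ⟨s, rfl, rfl⟩ := PlanarGraph.exists_between hvw hv hw hi hj hij
  -- Each of the two vertices stays initial when the other is removed; what changes in its flanks is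
  -- that the inputs of the removed vertex give way to its outputs.
  have h₁ : (A.erase v l _ hv).graph.ins = restrictList _ (l ++ A.graph.vout v ++ s) ++
      (A.erase v l _ hv).graph.vin ⟨w, hvw.symm⟩ ++ restrictList _ r' := by
    refine Eq.trans ?_ ((restrictList_append _ (l ++ A.graph.vout v ++ s ++ A.graph.vin w)
      r').trans (congrArg (· ++ _) (restrictList_append _ _ _)))
    simp [Diagram.erase, PlanarGraph.erase]
  have h₂ : (A.erase w _ r' hw).graph.ins = restrictList _ l ++
      (A.erase w _ r' hw).graph.vin ⟨v, hvw⟩ ++ restrictList _ (s ++ A.graph.vout w ++ r') := by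
    refine Eq.trans ?_ ((restrictList_append _ (l ++ A.graph.vin v)
      (s ++ A.graph.vout w ++ r')).trans (congrArg (· ++ _) (restrictList_append _ _ _)))
    simp [Diagram.erase, PlanarGraph.erase]
  have col_val : ∀ {P : E → Prop} (t : List E), (∀ x ∈ t, P x) →
      (restrictList P t).map (fun x => A.col x.1) = t.map A.col := fun t ht => by
    conv_rhs => rw [← map_val_restrictList _ ht]
    rw [List.map_map]; rfl
  have e₁ : (restrictList _ (l ++ A.graph.vout v ++ s)).map (A.erase v l _ hv).col =
      l.map A.col ++ (A.graph.vout v).map A.col ++ s.map A.col := by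
    rw [← List.map_append, ← List.map_append]
    refine col_val _ fun x hx => ((PlanarGraph.mem_erase_ins hv).1 ?_).1
    simp only [List.mem_append] at hx ⊢
    tauto
  have e₂ : (restrictList _ r').map (A.erase v l _ hv).col = r'.map A.col := by
    refine col_val _ fun x hx => ((PlanarGraph.mem_erase_ins hv).1 ?_).1
    simp [hx]
  have e₃ : (restrictList _ l).map (A.erase w _ r' hw).col = l.map A.col := by
    refine col_val _ fun x hx => ((PlanarGraph.mem_erase_ins hw).1 ?_).1
    simp [hx]
  have e₄ : (restrictList _ (s ++ A.graph.vout w ++ r')).map (A.erase w _ r' hw).col =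
      s.map A.col ++ (A.graph.vout w).map A.col ++ r'.map A.col := by
    rw [← List.map_append, ← List.map_append]
    refine col_val _ fun x hx => ((PlanarGraph.mem_erase_ins hw).1 ?_).1
    simp only [List.mem_append] at hx ⊢
    tauto
  obtain ⟨k, hk⟩ := exists_value I (Diag.cls ((A.erase v l _ hv).erase _ _ _ h₁))
  have hk' : HasValue I (Diag.cls ((A.erase w _ r' hw).erase _ _ _ h₂)) k := by
    rwa [← Diag.cls_eq_iff.2 (Diagram.iso_erase_erase A hvw hv hw h₁ h₂)]
  have l₁ := layer_hom h₁ hk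
  have l₂ := layer_hom h₂ hk'
  -- The smaller diagrams have unique values, so `m` and `m'` may be computed by removing the
  -- remaining vertex.
  have u₁ := uniq (of_erase (hm := l₁) hk)
  have u₂ := uniq' (of_erase (hm := l₂) hk')
  have d₁ : (A.erase v l _ hv).dec ⟨w, hvw.symm⟩ = A.dec w := rfl
  have d₂ : (A.erase w _ r' hw).dec ⟨v, hvw⟩ = A.dec v := rfl
  simp only [e₁, e₂, d₁] at u₁ l₁
  simp only [e₃, e₄, d₂] at u₂ l₂
  subst u₁ u₂
  have tv := A.typ v
  have tw := A.typ w
  simp only [List.map_append] at hm hm' ⊢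
  rw [V.dom_comp] at hm hm'
  rw [← V.comp_assoc _ _ _ hm l₁ (by rw [V.cod_comp, l₁]) ,
    ← V.comp_assoc _ _ _ hm' l₂ (by rw [V.cod_comp, l₂])]
  exact StrictTensorCat.comp_congr (Interp.layer_comp_layer tv tw _ _) rfl

/-- Two values of `A` begin with initial vertices `v` and `w`. If these coincide, so do the flanking
lists, and the induction hypothesis applies to the rest. If not, an input of `v` and an input of `w`
are comparable and distinct, an edge having one target, and the diamond `eq_of_lt` applies in one of
its two orientations. -/
theorem unique_of_card (n : ℕ) : ∀ (E X : Type) [Finite E] [Finite X]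
    (A : Diagram S E X) {m m' : V.Mor}, Nat.card X = n →
      HasValue I (Diag.cls A) m → HasValue I (Diag.cls A) m' → m = m' := by
  induction n with
  | zero =>
    intro E X _ _ A m m' hn h h'
    have := Finite.card_eq_zero_iff.1 hn
    rcases h.cases_erase with ⟨-, rfl⟩ | ⟨v, -⟩
    · rcases h'.cases_erase with ⟨-, rfl⟩ | ⟨v, -⟩
      · rfl
      · exact isEmptyElim v
    · exact isEmptyElim v
  | succ n ih =>
    intro E X _ _ A m m' hn h h'
    have : Nonempty X := (Nat.card_pos_iff.1 (by omega)).1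
    have card : ∀ v : X, Nat.card {w // w ≠ v} = n := by
      intro v
      have := Fintype.ofFinite X
      classical
      rw [Nat.card_eq_fintype_card] at hn ⊢
      simp [hn]
    rcases h.cases_erase with ⟨h1, -⟩ | ⟨v, l, r, hv, m₁, hm₁, h1, rfl⟩
    · exact isEmptyElim this.some
    rcases h'.cases_erase with ⟨h2, -⟩ | ⟨w, l', r', hw, m₂, hm₂, h2, rfl⟩
    · exact isEmptyElim this.some
    by_cases hvw : v = w
    · subst hvw
      obtain ⟨rfl, rfl⟩ := PlanarGraph.left_right_unique hv hw
      exact StrictTensorCat.comp_congr rfl (ih _ _ _ (card v) h1 h2)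
    · obtain ⟨i, hi⟩ := List.exists_mem_of_ne_nil _ (A.graph.vin_ne_nil v)
      obtain ⟨j, hj⟩ := List.exists_mem_of_ne_nil _ (A.graph.vin_ne_nil w)
      rcases A.graph.lt_total i j with h3 | rfl | h3
      · exact eq_of_lt hvw hv hw h1 h2 (ih _ _ _ (card v) h1) (ih _ _ _ (card w) h2) hi hj h3
      · rw [A.graph.mem_vin] at hi hj
        rw [hi] at hj
        exact (hvw (Option.some.inj hj)).elim
      · exact (eq_of_lt (Ne.symm hvw) hw hv h2 h1 (ih _ _ _ (card w) h2)
          (ih _ _ _ (card v) h1) hj hi h3).symm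

/-- The value of a diagram does not depend on its decomposition into layers. -/
theorem unique {d : Diag S} {m m' : V.Mor} (h : HasValue I d m) (h' : HasValue I d m') :
    m = m' := by
  induction d using Diag.ind with | h n k A => exact unique_of_card _ _ _ A rfl h h'

theorem comp {d e : Diag S} {m k : V.Mor} (h : HasValue I d m) (h' : HasValue I e k)
    (hd) (hm) : HasValue I (Diag.comp d e hd) (V.comp m k hm) := by
  induction h with
  | unit w => rwa [Diag.unit_comp, V.id_comp]
  | layer L d m hd' hm' h ih =>
    have h1 : d.cod = e.dom := by rw [← hd, Diag.cod_comp]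
    have h2 : V.cod m = V.dom k := by rw [← hm, V.cod_comp]
    rw [Diag.comp_assoc _ _ _ _ h1 _ (by rw [Diag.dom_comp, hd']),
      V.comp_assoc _ _ _ _ h2 _ (by rw [V.dom_comp, hm'])]
    exact .layer _ _ _ _ _ (ih h1 h2)

/-- Interchange distributes the added identity over the decomposition, and each layer absorbs it in
its right-hand word. -/
theorem tensor_unit {d : Diag S} {m : V.Mor} (h : HasValue I d m) (w : List S.O) :
    HasValue I (Diag.tensor d (Diag.unit w))
      (V.tensorMor m (V.id (I.word w))) := by
  induction h with
  | unit v =>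
    rw [Diag.unit_tensor_unit, ← I.id_word_append]
    exact .unit _
  | layer L d m hd hm h ih =>
    have h1 : (Diag.tensor L.diag (Diag.unit w)).cod =
        (Diag.tensor d (Diag.unit w)).dom := by
      rw [Diag.cod_tensor, Diag.dom_tensor, hd, Diag.cod_unit, Diag.dom_unit]
    have h2 : V.cod (V.tensorMor (L.mor I) (V.id (I.word w))) =
        V.dom (V.tensorMor m (V.id (I.word w))) := by
      rw [V.cod_tensor, V.dom_tensor, hm, V.cod_id, V.dom_id]
    have e1 := Diag.interchange _ _ _ _ hd
      (by rw [Diag.cod_unit, Diag.dom_unit] : (Diag.unit w).cod =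
        (Diag.unit w).dom) h1
    have e2 := V.interchange _ _ _ _ hm
      (by rw [V.cod_id, V.dom_id] : V.cod (V.id (I.word w)) =
        V.dom (V.id (I.word w))) h2
    rw [Diag.unit_comp] at e1
    rw [V.id_comp] at e2
    rw [← e1, ← e2, Diag.comp_congr (L.diag_addRight w).symm rfl,
      StrictTensorCat.comp_congr (L.mor_addRight w).symm rfl]
    exact .layer (L.addRight w) _ _ _ _ ih

theorem unit_tensor {d : Diag S} {m : V.Mor} (h : HasValue I d m) (w : List S.O) :
    HasValue I (Diag.tensor (Diag.unit w) d)
      (V.tensorMor (V.id (I.word w)) m) := by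
  induction h with
  | unit v =>
    rw [Diag.unit_tensor_unit, ← I.id_word_append]
    exact .unit _
  | layer L d m hd hm h ih =>
    have h1 : (Diag.tensor (Diag.unit w) L.diag).cod =
        (Diag.tensor (Diag.unit w) d).dom := by
      rw [Diag.cod_tensor, Diag.dom_tensor, hd, Diag.cod_unit, Diag.dom_unit]
    have h2 : V.cod (V.tensorMor (V.id (I.word w)) (L.mor I)) =
        V.dom (V.tensorMor (V.id (I.word w)) m) := by
      rw [V.cod_tensor, V.dom_tensor, hm, V.cod_id, V.dom_id]
    have e1 := Diag.interchange _ _ _ _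
      (by rw [Diag.cod_unit, Diag.dom_unit] : (Diag.unit w).cod =
        (Diag.unit w).dom) hd h1
    have e2 := V.interchange _ _ _ _
      (by rw [V.cod_id, V.dom_id] : V.cod (V.id (I.word w)) =
        V.dom (V.id (I.word w))) hm h2
    rw [Diag.unit_comp] at e1
    rw [V.id_comp] at e2
    rw [← e1, ← e2, Diag.comp_congr (L.diag_addLeft w).symm rfl,
      StrictTensorCat.comp_congr (L.mor_addLeft w).symm rfl]
    exact .layer (L.addLeft w) _ _ _ _ ih

/-- A tensor product is a composite of two whiskerings: `d` beside the identity of `e.dom`, followed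
by `e` beside the identity of `d.cod`. -/
theorem tensor {d e : Diag S} {m k : V.Mor} (h : HasValue I d m) (h' : HasValue I e k) :
    HasValue I (Diag.tensor d e) (V.tensorMor m k) := by
  have d1 : d.cod = (Diag.unit d.cod).dom := by rw [Diag.dom_unit]
  have d2 : (Diag.unit e.dom).cod = e.dom := Diag.cod_unit _
  have m1 : V.cod m = V.dom (V.id (I.word d.cod)) := by rw [V.dom_id, h.cod_eq]
  have m2 : V.cod (V.id (I.word e.dom)) = V.dom k := by rw [V.cod_id, h'.dom_eq]
  have e1 := Diag.interchange _ _ _ _ d1 d2 (by rw [Diag.cod_tensor, Diag.dom_tensor, ← d1, d2])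
  have e2 := V.interchange _ _ _ _ m1 m2 (by rw [V.cod_tensor, V.dom_tensor, ← m1, m2])
  rw [Diag.comp_unit, Diag.unit_comp] at e1
  rw [V.comp_id, V.id_comp] at e2
  rw [← e1, ← e2]
  exact (h.tensor_unit _).comp (h'.unit_tensor _) _ _

/-- A corolla is the layer with empty words on both sides, followed by an identity. -/
theorem corolla {f : S.M} {a b : List S.O} (ha hb h) :
    HasValue I (Diag.corolla f a b ha hb h) (I.mor f) := by
  let L : Layer S := ⟨[], f, a, b, [], ha, hb, h⟩
  have h1 : L.diag = Diag.corolla f a b ha hb h :=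
    (Diag.tensor_unit _).trans (Diag.unit_tensor _)
  have h2 : L.mor I = I.mor f := V.layer_nil _
  have := HasValue.layer (I := I) L _ _ (by rw [Diag.dom_unit]) (by rw [V.dom_id, L.cod_mor])
    (.unit L.diag.cod)
  rwa [Diag.comp_unit, V.comp_id, h1, h2] at this

end HasValue
end evaluation

/-! ## Prime diagrams are corollas -/

namespace Diag

variable {S T : Sig.{u}} {E V : Type} [Finite E] [Finite V]

theorem vertex_cls {A : Diagram S E V} (h : (cls A).IsPrime) (v : V) :
    (cls A).vertex h = A.dec v := by
  obtain ⟨e, g, hg⟩ := rep_iso A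
  obtain ⟨w, hw⟩ := (isPrime_cls.1 h).1
  rw [vertex, ← hg.dec, hw v, hw (g _)]

theorem vertex_corolla (f : S.M) (a b : List S.O) (ha hb h) :
    (corolla f a b ha hb h).vertex (isPrime_corolla f a b ha hb h) = f :=
  vertex_cls _ ()

/-- A prime graph has neither loops nor virtual edges, so every edge is either an input or an
output, and these are the inputs and outputs of the vertex. Enumerating them in order gives the
isomorphism. -/
theorem eq_corolla {d : Diag S} (h : d.IsPrime) : d = corolla (d.vertex h) d.dom d.cod
    h.dom_ne_nil h.cod_ne_nil (typ_vertex d h) := by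
  induction d using ind with | h n k A =>
  have hA := isPrime_cls.1 h
  obtain ⟨v, hv⟩ := hA.1
  have key : ∀ (f : S.M) (a b : List S.O) (ha hb h'), f = A.dec v → a = A.dom → b = A.cod →
      cls A = corolla f a b ha hb h' := by
    rintro _ _ _ ha hb h' rfl rfl rfl
    refine Eq.symm (cls_eq_iff.2 ?_)
    have hi : (List.finRange A.dom.length).map
        (fun i => A.graph.ins.get (i.cast (by simp [Diagram.dom]))) = A.graph.ins :=
      PlanarGraph.map_finRange_get (by simp [Diagram.dom])
    have ho : (List.finRange A.cod.length).map
        (fun i => A.graph.outs.get (i.cast (by simp [Diagram.cod]))) = A.graph.outs :=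
      PlanarGraph.map_finRange_get (by simp [Diagram.cod])
    let g : Unit ≃ Fin k := ⟨fun _ => v, fun _ => (), fun _ => rfl, fun w => (hv w).symm⟩
    refine Diagram.Iso.of_compat (g := g)
      (f := Sum.elim (fun i => A.graph.ins.get (i.cast (by simp [Diagram.dom])))
        (fun i => A.graph.outs.get (i.cast (by simp [Diagram.cod])))) ⟨?_, ?_, ?_, ?_⟩ ?_ ?_
    · exact (List.map_map ..).trans hi
    · exact (List.map_map ..).trans ho
    · exact fun _ => (List.map_map ..).trans (hi.trans (hA.vin_eq _).symm)
    · exact fun _ => (List.map_map ..).trans (ho.trans (hA.vout_eq _).symm)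
    · rintro (i | i)
      · exact (List.getElem_map A.col).symm
      · exact (List.getElem_map A.col).symm
    · exact fun _ => rfl
  exact key _ _ _ _ _ _ (vertex_cls h v) (dom_cls A) (cod_cls A)

/-- The rigidity behind both identifications and behind the comparisons of prime diagrams in the
adjunction. -/
theorem IsPrime.ext {d e : Diag S} (hd : d.IsPrime) (he : e.IsPrime)
    (h : d.vertex hd = e.vertex he) (h' : d.dom = e.dom) (h'' : d.cod = e.cod) : d = e := by
  rw [eq_corolla hd, eq_corolla he]
  congr 1

theorem vertex_map (φ : Sig.Hom S T) (d : Diag S) (h : d.IsPrime) :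
    (d.map φ).vertex (h.map φ) = φ.m (d.vertex h) := by
  induction d using ind with | h n k A =>
  obtain ⟨v, -⟩ := (isPrime_cls.1 h).1
  rw [vertex_cls h v]
  exact vertex_cls (A := A.map φ) _ v

theorem corolla_congr {f : S.M} {a b a' b' : List S.O} {ha hb h} (ea : a = a') (eb : b = b') :
    corolla f a b ha hb h = corolla f a' b' (ea ▸ ha) (eb ▸ hb) (ea ▸ eb ▸ h) := by
  subst ea eb; rfl

theorem map_corolla (φ : Sig.Hom S T) (f : S.M) (a b : List S.O) (ha hb h) :
    map φ (corolla f a b ha hb h) = corolla (φ.m f) (a.map φ.o) (b.map φ.o) (by simpa using ha)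
      (by simpa using hb) (φ.typ _ _ _ h) := by
  refine ((isPrime_corolla f a b ha hb h).map φ).ext (isPrime_corolla _ _ _ _ _ _) ?_ ?_ ?_
  · rw [vertex_map _ _ (isPrime_corolla f a b ha hb h), vertex_corolla, vertex_corolla]
  · rw [dom_map, dom_corolla, dom_corolla]
  · rw [cod_map, cod_corolla, cod_corolla]

end Diag

/-! ## Functors out of categories of diagrams -/

/-- Strict tensor functors out of a category of diagrams are determined by their values on letters
and on prime diagrams. -/
theorem diagCat_hom_ext {S : Sig.{u}} {V : StrictTensorCat.{u}}
    {K L : StrictTensorCat.Hom (diagCat.obj S) V} (ho : ∀ x : S.O, K.onOb [x] = L.onOb [x])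
    (hm : ∀ (f : S.M) (a b : List S.O) (ha : a ≠ []) (hb : b ≠ []) (h : S.typ f a b),
      K.onMor (Diag.corolla f a b ha hb h) = L.onMor (Diag.corolla f a b ha hb h)) : K = L := by
  have hw : ∀ w : List S.O, K.onOb w = L.onOb w := by
    intro w
    induction w with
    | nil => exact K.one.trans L.one.symm
    | cons x w ih =>
      refine (K.tensorOb [x] w).trans (Eq.trans ?_ (L.tensorOb [x] w).symm)
      rw [ho, ih]
  have hu : ∀ w : List S.O, K.onMor (Diag.unit w) = L.onMor (Diag.unit w) := fun w =>
    (K.id w).trans ((congrArg V.id (hw w)).trans (L.id w).symm)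
  refine StrictTensorCat.Hom.ext (funext hw) (funext fun d => ?_)
  -- A layer is a tensor product of identities and one corolla, so agreement on letters and corollas
  -- spreads to layers and, through composition, to all diagrams.
  refine Diag.layer_ind (P := fun d => K.onMor d = L.onMor d) hu (fun l d h ih => ?_) d
  have hl : K.onMor l.diag = L.onMor l.diag := by
    refine (K.tensorMor _ _).trans (Eq.trans ?_ (L.tensorMor _ _).symm)
    refine congrArg₂ V.tensorMor ?_ (hu _)
    refine (K.tensorMor _ _).trans (Eq.trans ?_ (L.tensorMor _ _).symm)
    exact congrArg₂ V.tensorMor (hu _) (hm _ _ _ _ _ _)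
  have hK : V.cod (K.onMor l.diag) = V.dom (K.onMor d) :=
    (K.cod _).trans ((congrArg K.onOb h).trans (K.dom _).symm)
  have hL : V.cod (L.onMor l.diag) = V.dom (L.onMor d) :=
    (L.cod _).trans ((congrArg L.onOb h).trans (L.dom _).symm)
  exact (K.comp l.diag d h hK).trans
    ((StrictTensorCat.comp_congr hl ih).trans (L.comp l.diag d h hL).symm)

namespace Interp

variable {S : Sig.{u}} {V : StrictTensorCat.{u}} (I : Interp S V)

/-- The value of a diagram. -/
noncomputable def val (d : Diag S) : V.Mor := (HasValue.exists_value I d).choose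

theorem hasValue_val (d : Diag S) : HasValue I d (I.val d) :=
  (HasValue.exists_value I d).choose_spec

variable {I} in
theorem _root_.TensorCalculus.HasValue.val_eq {d : Diag S} {m : V.Mor} (h : HasValue I d m) :
    I.val d = m :=
  (I.hasValue_val d).unique h

/-- The strict tensor functor extending an interpretation. -/
noncomputable def lift : diagCat.obj S ⟶ V where
  onOb := I.word
  onMor := I.val
  dom d := (I.hasValue_val d).dom_eq
  cod d := (I.hasValue_val d).cod_eq
  id w := (HasValue.unit w).val_eq
  comp d e h h' := ((I.hasValue_val d).comp (I.hasValue_val e) h h').val_eq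
  one := rfl
  tensorOb _ _ := (congrArg V.tensorList List.map_append).trans (V.tensorList_append _ _)
  tensorMor d e := ((I.hasValue_val d).tensor (I.hasValue_val e)).val_eq

theorem val_corolla (f : S.M) (a b : List S.O) (ha hb h) :
    I.val (Diag.corolla f a b ha hb h) = I.mor f :=
  (HasValue.corolla ha hb h).val_eq

end Interp

/-! ## The evaluation map -/

/-- The tautological interpretation of diagrams in a strict tensor category. -/
def Interp.self (V : StrictTensorCat.{u}) : Interp (catSig.obj V) V where
  ob x := x
  mor f := f
  dom_mor _ _ _ h := h.1.trans (congrArg _ (List.map_id' _).symm)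
  cod_mor _ _ _ h := h.2.trans (congrArg _ (List.map_id' _).symm)

namespace Evaluation

variable {V : StrictTensorCat.{u}}

/-- An evaluation map as a strict tensor functor. -/
def toHom (ev : Evaluation V) : diagCat.obj (catSig.obj V) ⟶ V where
  onOb := V.tensorList
  onMor := ev.val
  dom := ev.dom_val
  cod := ev.cod_val
  -- The axioms of an evaluation prescribe only the empty diagram and single virtual edges; an
  -- identity on a longer word is a tensor product of these.
  id w := by
    induction w with
    | nil => exact ev.val_empty
    | cons x w ih =>
      have h : (diagCat.obj (catSig.obj V)).id (x :: w) =
          Diag.tensor (Diag.unit (S := catSig.obj V) [x]) (Diag.unit (S := catSig.obj V) w) :=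
        (Diag.unit_tensor_unit (S := catSig.obj V) [x] w).symm
      refine (congrArg ev.val h).trans ((ev.val_tensor _ _).trans ?_)
      exact (congrArg₂ V.tensorMor (ev.val_unitary x) ih).trans (V.tensor_id _ _)
  comp d e h _ := ev.val_comp d e h
  one := rfl
  tensorOb := V.tensorList_append
  tensorMor := ev.val_tensor

theorem val_corolla (ev : Evaluation V) (f : V.Mor) (a b : List V.Ob) (ha hb h) :
    ev.val (Diag.corolla (S := catSig.obj V) f a b ha hb h) = f :=
  (ev.val_prime _ (Diag.isPrime_corolla (S := catSig.obj V) f a b ha hb h)).trans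
    (Diag.vertex_corolla (S := catSig.obj V) f a b ha hb h)

theorem word_self (w : List V.Ob) : (Interp.self V).word w = V.tensorList w :=
  congrArg V.tensorList (List.map_id' w)

/-- The evaluation map of a strict tensor category. -/
noncomputable def canonical (V : StrictTensorCat.{u}) : Evaluation V where
  val := (Interp.self V).val
  dom_val d := ((Interp.self V).lift.dom d).trans (word_self _)
  cod_val d := ((Interp.self V).lift.cod d).trans (word_self _)
  val_empty := (Interp.self V).lift.id []
  val_unitary x := ((Interp.self V).lift.id [x]).trans
    (congrArg V.id ((word_self [x]).trans (V.tensorList_singleton x)))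
  val_prime d h := by
    conv_lhs => rw [Diag.eq_corolla h]
    exact (Interp.self V).val_corolla _ _ _ _ _ _
  val_tensor := (Interp.self V).lift.tensorMor
  val_comp d e h := (Interp.self V).lift.comp d e h _

/-- Both are strict tensor functors acting on objects by `tensorList`, and the axiom on prime
diagrams fixes them on corollas. -/
theorem eq (ev ev' : Evaluation V) : ev = ev' := by
  refine Evaluation.ext (congrArg StrictTensorCat.Hom.onMor (?_ : ev.toHom = ev'.toHom))
  refine diagCat_hom_ext (fun _ => rfl) fun f a b ha hb h => ?_
  exact (ev.val_corolla f a b ha hb h).trans (ev'.val_corolla f a b ha hb h).symm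

end Evaluation

/-! ## The adjunction -/

/-- A diagram in `U V` is interpreted in `V` through the decorations of its components. -/
noncomputable def Interp.prime (V : StrictTensorCat.{u}) :
    Interp (schemeSig.obj (U.obj V)) V where
  ob x := x
  mor d := d.1.vertex d.2
  dom_mor := by
    rintro d _ _ ⟨rfl, rfl⟩
    exact (Diag.typ_vertex d.1 d.2).1.trans (congrArg _ (List.map_id' _).symm)
  cod_mor := by
    rintro d _ _ ⟨rfl, rfl⟩
    exact (Diag.typ_vertex d.1 d.2).2.trans (congrArg _ (List.map_id' _).symm)

/-- The counit of the adjunction. -/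
noncomputable def counitHom (V : StrictTensorCat.{u}) : (Up ⋙ Fp).obj V ⟶ V :=
  (Interp.prime V).lift

theorem counitHom_singleton {V : StrictTensorCat.{u}} (x : V.Ob) : (counitHom V).onOb [x] = x :=
  V.tensorList_singleton x

theorem counitHom_onOb {V : StrictTensorCat.{u}} (w : List V.Ob) :
    (counitHom V).onOb w = V.tensorList w :=
  congrArg V.tensorList (List.map_id' w)

theorem counitHom_corolla {V : StrictTensorCat.{u}} (f : (U.obj V).Mor)
    (a b : List V.Ob) (ha hb h) :
    (counitHom V).onMor (Diag.corolla (S := schemeSig.obj (U.obj V)) f a b ha hb h) =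
      f.1.vertex f.2 :=
  (Interp.prime V).val_corolla f a b ha hb h

/-- Both sides are strict tensor functors on diagrams; on a corolla each of them gives `K` of the
inner decoration of its vertex. -/
theorem counitHom_naturality {V W : StrictTensorCat.{u}} (K : V ⟶ W) :
    (Up ⋙ Fp).map K ≫ counitHom W = counitHom V ≫ K := by
  refine diagCat_hom_ext (S := schemeSig.obj (U.obj V)) (fun x => ?_) fun f a b ha hb h => ?_
  · refine (counitHom_singleton (K.onOb x)).trans ?_
    exact congrArg K.onOb (counitHom_singleton x).symm
  · refine (congrArg (counitHom W).onMor
      (Diag.map_corolla (schemeSig.map (U.map K)) f a b ha hb h)).trans ?_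
    refine (counitHom_corolla ..).trans ?_
    refine (Diag.vertex_map (catSig.map K) f.1 f.2).trans ?_
    exact congrArg K.onMor (counitHom_corolla f a b ha hb h).symm

/-- The two images of a morphism are prime diagrams. Their legs agree because both sides are
morphisms of tensor schemes with the same action on objects, and their vertices are both decorated
by the corolla of the image of that morphism. -/
theorem eta_naturality {D D' : IsProper.{u}.FullSubcategory} (φ : D ⟶ D') :
    φ ≫ eta D' = eta D ≫ (Fp ⋙ Up).map φ := by
  refine ObjectProperty.hom_ext _ (TensorScheme.Hom.ext rfl (funext fun f => Subtype.ext ?_))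
  refine Diag.IsPrime.ext (S := catSig.obj (F.obj D'.obj)) ((φ ≫ eta D').hom.onMor f).2
    ((eta D ≫ (Fp ⋙ Up).map φ).hom.onMor f).2 ?_ (((φ ≫ eta D').hom.src f).trans
    ((eta D ≫ (Fp ⋙ Up).map φ).hom.src f).symm) (((φ ≫ eta D').hom.tgt f).trans
    ((eta D ≫ (Fp ⋙ Up).map φ).hom.tgt f).symm)
  refine (Diag.vertex_corolla (S := catSig.obj (F.obj D'.obj)) _ _ _ _ _ _).trans
    (Eq.trans ?_ (Diag.vertex_map (catSig.map (Fp.map φ)) _ ((eta D).hom.onMor f).2).symm)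
  refine Eq.trans ?_ (congrArg (Diag.map (schemeSig.map φ.hom))
    (Diag.vertex_corolla (S := catSig.obj (F.obj D.obj)) _ _ _ _ _ _).symm)
  refine Eq.trans ?_ (Diag.map_corolla (schemeSig.map φ.hom) _ _ _ _ _ _).symm
  exact Diag.corolla_congr (S := schemeSig.obj D'.obj) (φ.hom.src f) (φ.hom.tgt f)

theorem counitHom_left_triangle (D : IsProper.{u}.FullSubcategory) :
    Fp.map (eta D) ≫ counitHom (Fp.obj D) = 𝟙 (Fp.obj D) := by
  refine diagCat_hom_ext (S := schemeSig.obj D.obj) (fun x => ?_) fun f a b ha hb h => ?_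
  · exact counitHom_singleton (V := Fp.obj D) [x]
  · refine (congrArg (counitHom (Fp.obj D)).onMor
      (Diag.map_corolla (schemeSig.map (eta D).hom) f a b ha hb h)).trans ?_
    refine (counitHom_corolla ..).trans ?_
    -- The legs of a corolla in a tensor scheme are the source and target of its decoration, so the
    -- corolla contained in `eta` at `f` is the given one.
    obtain ⟨rfl, rfl⟩ := h
    exact Diag.vertex_corolla (S := catSig.obj (F.obj D.obj)) _ _ _ _ _ _

/-- By rigidity of prime diagrams only the vertex matters: the unit wraps `f` in a corolla, and the
counit returns the decoration of the vertex of `f`. -/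
theorem counitHom_right_triangle (V : StrictTensorCat.{u}) :
    eta (Up.obj V) ≫ Up.map (counitHom V) = 𝟙 (Up.obj V) := by
  refine ObjectProperty.hom_ext _ (TensorScheme.Hom.ext (funext counitHom_singleton)
    (funext fun f => Subtype.ext ?_))
  have ho : ((eta (Up.obj V) ≫ Up.map (counitHom V)).hom.onOb) = fun x => x :=
    funext counitHom_singleton
  refine Diag.IsPrime.ext (S := catSig.obj V)
    ((eta (Up.obj V) ≫ Up.map (counitHom V)).hom.onMor f).2 f.2 ?_
    (((eta (Up.obj V) ≫ Up.map (counitHom V)).hom.src f).trans (by rw [ho]; exact List.map_id' _))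
    (((eta (Up.obj V) ≫ Up.map (counitHom V)).hom.tgt f).trans (by rw [ho]; exact List.map_id' _))
  refine (Diag.vertex_map (catSig.map (counitHom V)) _ ((eta (Up.obj V)).hom.onMor f).2).trans ?_
  refine (congrArg (counitHom V).onMor
    (Diag.vertex_corolla (S := catSig.obj (F.obj (U.obj V))) _ _ _ _ _ _)).trans ?_
  exact counitHom_corolla ..

/-- The adjunction between free strict tensor categories and schemes of prime diagrams. -/
noncomputable def adjunction : Fp.{u} ⊣ Up.{u} :=
  Adjunction.mkOfUnitCounit
    { unit := { app := eta, naturality := fun _ _ φ => eta_naturality φ }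
      counit := { app := counitHom, naturality := fun _ _ K => counitHom_naturality K }
      left_triangle := by
        ext D : 2
        change Fp.map (eta D) ≫ 𝟙 _ ≫ counitHom (Fp.obj D) = 𝟙 (Fp.obj D)
        rw [Category.id_comp]
        exact counitHom_left_triangle D
      right_triangle := by
        ext V : 2
        change eta (Up.obj V) ≫ 𝟙 _ ≫ Up.map (counitHom V) = 𝟙 (Up.obj V)
        rw [Category.id_comp]
        exact counitHom_right_triangle V }

/-! ## Isomorphisms -/

/-- A bijective strict tensor functor is an isomorphism. -/
theorem StrictTensorCat.isIso_of_bijective {V W : StrictTensorCat.{u}} (K : V ⟶ W)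
    (ho : Function.Bijective K.onOb) (hm : Function.Bijective K.onMor) : IsIso K := by
  let o := Equiv.ofBijective _ ho
  let m := Equiv.ofBijective _ hm
  have ho' : ∀ x, K.onOb (o.symm x) = x := o.apply_symm_apply
  have hm' : ∀ f, K.onMor (m.symm f) = f := m.apply_symm_apply
  have hd : ∀ f, V.dom (m.symm f) = o.symm (W.dom f) := fun f =>
    ho.1 (by rw [ho', ← K.dom, hm'])
  have hc : ∀ f, V.cod (m.symm f) = o.symm (W.cod f) := fun f =>
    ho.1 (by rw [ho', ← K.cod, hm'])
  refine ⟨⟨{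
    onOb := o.symm
    onMor := m.symm
    dom := hd
    cod := hc
    id := fun x => hm.1 (by rw [hm', K.id, ho'])
    comp := fun f g h h' => hm.1 (by
      have e : W.cod (K.onMor (m.symm f)) = W.dom (K.onMor (m.symm g)) := by rw [hm', hm', h]
      rw [hm', K.comp _ _ h' e]
      exact StrictTensorCat.comp_congr (hm' f).symm (hm' g).symm)
    one := ho.1 (by rw [ho', K.one])
    tensorOb := fun x y => ho.1 (by rw [ho', K.tensorOb, ho', ho'])
    tensorMor := fun f g => hm.1 (by rw [hm', K.tensorMor, hm', hm']) }, ?_, ?_⟩⟩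
  · exact StrictTensorCat.Hom.ext (funext o.symm_apply_apply) (funext m.symm_apply_apply)
  · exact StrictTensorCat.Hom.ext (funext ho') (funext hm')

/-- A bijective morphism of tensor schemes is an isomorphism. -/
theorem TensorScheme.isIso_of_bijective {D D' : TensorScheme.{u}} (φ : D ⟶ D')
    (ho : Function.Bijective φ.onOb) (hm : Function.Bijective φ.onMor) : IsIso φ := by
  let o := Equiv.ofBijective _ ho
  let m := Equiv.ofBijective _ hm
  have ho' : ∀ x, φ.onOb (o.symm x) = x := o.apply_symm_apply
  have hm' : ∀ f, φ.onMor (m.symm f) = f := m.apply_symm_apply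
  have hl : ∀ w : List D'.Ob, (w.map o.symm).map φ.onOb = w := fun w => by
    rw [List.map_map]; exact (List.map_congr_left fun x _ => ho' x).trans (List.map_id w)
  have inj := List.map_injective_iff.2 ho.1
  refine ⟨⟨{
    onOb := o.symm
    onMor := m.symm
    src := fun f => inj (by rw [hl, ← φ.src, hm'])
    tgt := fun f => inj (by rw [hl, ← φ.tgt, hm']) }, ?_, ?_⟩⟩
  · exact TensorScheme.Hom.ext (funext o.symm_apply_apply) (funext m.symm_apply_apply)
  · exact TensorScheme.Hom.ext (funext ho') (funext hm')

/-! ## The first identification -/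

section zeta

variable (V : StrictTensorCat.{u})

/-- An isomorphism after the replacement of decorations is already one before it: corresponding
vertices carry prime diagrams with equal inner decorations, whose legs are the colours around the
vertex, hence are equal as well. -/
theorem map_zetaSig_injective : Function.Injective (Diag.map (zetaSig V)) := by
  intro d e h
  induction d using Diag.ind with | h n k A =>
  induction e using Diag.ind with | h n' k' B =>
  rw [Diag.map_cls, Diag.map_cls, Diag.cls_eq_iff] at h
  obtain ⟨e, g, h⟩ := h
  refine Diag.cls_eq_iff.2 ⟨e, g, h.src, h.tgt, h.lt, h.col, fun v => Subtype.ext ?_⟩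
  have hA := A.typ v
  have hB := B.typ (g v)
  have hi : (A.graph.vin v).map e = B.graph.vin (g v) := h.compat.vin v
  have ho : (A.graph.vout v).map e = B.graph.vout (g v) := h.compat.vout v
  rw [← hi, ← ho, List.map_map, List.map_map] at hB
  have hcol : B.col ∘ e = A.col := funext h.col
  rw [hcol] at hB
  exact Diag.IsPrime.ext (S := catSig.obj V) (B.dec (g v)).2 (A.dec v).2 (h.dec v)
    (hB.1.trans hA.1.symm) (hB.2.trans hA.2.symm)

/-- Each vertex is decorated by the corolla on its former decoration, with the adjacent colours as
legs; this requires every vertex to have inputs and outputs. -/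
theorem map_zetaSig_surjective : Function.Surjective (Diag.map (zetaSig V)) := by
  intro d
  induction d using Diag.ind with | h n k A =>
  have hi : ∀ v, (A.graph.vin v).map A.col ≠ [] := fun v => by simpa using A.graph.vin_ne_nil v
  have ho : ∀ v, (A.graph.vout v).map A.col ≠ [] := fun v => by simpa using A.graph.vout_ne_nil v
  let B : Diagram (schemeSig.obj (U.obj V)) (Fin n) (Fin k) :=
    { graph := A.graph
      col := A.col
      dec := fun v => ⟨Diag.corolla (A.dec v) _ _ (hi v) (ho v) (A.typ v),
        Diag.isPrime_corolla _ _ _ _ _ _⟩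
      typ := fun v => ⟨Diag.dom_corolla _ _ _ (hi v) (ho v) (A.typ v),
        Diag.cod_corolla _ _ _ (hi v) (ho v) (A.typ v)⟩ }
  refine ⟨Diag.cls B, (Diag.map_cls _ B).trans
    (Diag.cls_eq_iff.2 ⟨Equiv.refl _, Equiv.refl _, ?_⟩)⟩
  refine ⟨fun x => Option.map_id'.symm, fun x => Option.map_id'.symm, fun _ _ => Iff.rfl,
    fun _ => rfl, fun v => ?_⟩
  exact (Diag.vertex_corolla _ _ _ (hi v) (ho v) (A.typ v)).symm

/-- The first identification, on a strict tensor category. -/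
noncomputable def zetaHom : (Up ⋙ Fp).obj V ⟶ GammaTensor.obj V := diagCat.map (zetaSig V)

theorem zetaHom_onOb (w : List V.Ob) : (zetaHom V).onOb w = w := List.map_id' w

instance : IsIso (zetaHom V) := by
  refine StrictTensorCat.isIso_of_bijective _ ?_ ⟨map_zetaSig_injective V, map_zetaSig_surjective V⟩
  rw [show (zetaHom V).onOb = _root_.id from funext (zetaHom_onOb V)]
  exact Function.bijective_id

theorem zetaSig_naturality {V W : StrictTensorCat.{u}} (K : V ⟶ W) :
    schemeSig.map (U.map K) ≫ zetaSig W = zetaSig V ≫ catSig.map K :=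
  Sig.Hom.ext rfl (funext fun d => Diag.vertex_map (catSig.map K) d.1 d.2)

/-- The first identification. -/
noncomputable def zeta : Up.{u} ⋙ Fp.{u} ≅ GammaTensor.{u} :=
  NatIso.ofComponents (fun V => asIso (zetaHom V)) fun K => by
    refine (diagCat.map_comp _ _).symm.trans (Eq.trans ?_ (diagCat.map_comp _ _))
    exact congrArg _ (zetaSig_naturality K)

end zeta

/-! ## The second identification -/

namespace FDiag

variable {S T : Sig.{u}}

/-- A fissus diagram is determined by its underlying diagram, its domain and its codomain. -/
theorem ext {x y : FDiag S} (h : x.forget = y.forget) (hd : x.dom = y.dom)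
    (hc : x.cod = y.cod) : x = y := by
  induction x using Quotient.ind with | _ A =>
  induction y using Quotient.ind with | _ B =>
  obtain ⟨e, g, h⟩ := Quotient.exact h
  -- A cut of a list is determined by the lengths of its blocks, and these lengths can be read off
  -- the domain or codomain, which are words of words.
  have key : ∀ {α β : Type} {δ : Type u} (e : α → β) (p : List (List α)) (q : List (List β))
      (c : α → δ) (c' : β → δ), p.flatten.map e = q.flatten →
      p.map (List.map c) = q.map (List.map c') → p.map (List.map e) = q := by
    intro α β δ e p q c c' h h'
    refine List.eq_iff_flatten_eq.2 ⟨by rw [← h, List.map_flatten], ?_⟩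
    have := congrArg (List.map List.length) h'
    simpa [Function.comp_def] using this
  refine Quotient.sound ⟨e, g, h, ?_, ?_⟩
  · refine key e _ _ A.fdiag.diag.col B.fdiag.diag.col ?_ hd
    rw [A.fdiag.flatten_pin, B.fdiag.flatten_pin]
    exact h.compat.ins
  · refine key e _ _ A.fdiag.diag.col B.fdiag.diag.col ?_ hc
    rw [A.fdiag.flatten_pout, B.fdiag.flatten_pout]
    exact h.compat.outs

theorem forget_map (φ : Sig.Hom S T) (x : FDiag S) : (x.map φ).forget = x.forget.map φ := by
  induction x using Quotient.ind with | _ A => rfl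

end FDiag

section omega

variable (D : TensorScheme.{u})

theorem forget_fissusOfPrime (x : ((F ⋙ U).obj D).Mor) :
    FDiag.forget (fissusOfPrime D x) = x.1.vertex x.2 := FDiag.forget_bracket ..

theorem dom_fissusOfPrime (x : ((F ⋙ U).obj D).Mor) :
    FDiag.dom (fissusOfPrime D x) = x.1.dom := FDiag.dom_bracket ..

theorem cod_fissusOfPrime (x : ((F ⋙ U).obj D).Mor) :
    FDiag.cod (fissusOfPrime D x) = x.1.cod := FDiag.cod_bracket ..

theorem fissusOfPrime_injective : Function.Injective (fissusOfPrime D) := by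
  intro x y h
  refine Subtype.ext (x.2.ext y.2 ?_ ?_ ?_)
  · exact (forget_fissusOfPrime D x).symm.trans
      ((congrArg FDiag.forget h).trans (forget_fissusOfPrime D y))
  · exact (dom_fissusOfPrime D x).symm.trans
      ((congrArg FDiag.dom h).trans (dom_fissusOfPrime D y))
  · exact (cod_fissusOfPrime D x).symm.trans
      ((congrArg FDiag.cod h).trans (cod_fissusOfPrime D y))

/-- The preimage is the corolla decorated by the underlying diagram, with the blocks as legs. Its
legs fit because tensoring words in `F D` means concatenating them, and they are nonempty because a
fission has at least one block. -/
theorem fissusOfPrime_surjective : Function.Surjective (fissusOfPrime D) := by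
  intro x
  have ht : (catSig.obj (F.obj D)).typ (FDiag.forget x) (FDiag.dom x) (FDiag.cod x) :=
    ⟨(FDiag.dom_forget x).trans (tensorList_diagCat _ _).symm,
      (FDiag.cod_forget x).trans (tensorList_diagCat _ _).symm⟩
  refine ⟨⟨Diag.corolla _ _ _ (FDiag.dom_ne_nil x) (FDiag.cod_ne_nil x) ht,
    Diag.isPrime_corolla _ _ _ (FDiag.dom_ne_nil x) (FDiag.cod_ne_nil x) ht⟩, ?_⟩
  refine FDiag.ext ?_ ?_ ?_
  · exact (forget_fissusOfPrime D _).trans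
      (Diag.vertex_corolla _ _ _ (FDiag.dom_ne_nil x) (FDiag.cod_ne_nil x) ht)
  · exact (dom_fissusOfPrime D _).trans
      (Diag.dom_corolla _ _ _ (FDiag.dom_ne_nil x) (FDiag.cod_ne_nil x) ht)
  · exact (cod_fissusOfPrime D _).trans
      (Diag.cod_corolla _ _ _ (FDiag.dom_ne_nil x) (FDiag.cod_ne_nil x) ht)

/-- The second identification, on a tensor scheme. -/
noncomputable def omegaHom : (F ⋙ U).obj D ⟶ GammaF.obj D where
  onOb w := w
  onMor := fissusOfPrime D
  src x := (dom_fissusOfPrime D x).trans (List.map_id' _).symm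
  tgt x := (cod_fissusOfPrime D x).trans (List.map_id' _).symm

instance : IsIso (omegaHom D) :=
  TensorScheme.isIso_of_bijective _ Function.bijective_id
    ⟨fissusOfPrime_injective D, fissusOfPrime_surjective D⟩

/-- Morphisms of tensor schemes into a scheme of fissus diagrams agree as soon as the underlying
diagrams agree. -/
theorem gammaF_hom_ext {D' : TensorScheme.{u}} {φ ψ : D' ⟶ GammaF.obj D}
    (ho : φ.onOb = ψ.onOb) (hm : ∀ f, FDiag.forget (φ.onMor f) = FDiag.forget (ψ.onMor f)) :
    φ = ψ := by
  -- The brackets are forced: the domain and codomain of an image are determined by the action on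
  -- objects.
  refine TensorScheme.Hom.ext ho (funext fun f => FDiag.ext (hm f) ?_ ?_)
  · exact (φ.src f).trans ((congrArg (List.map · _) ho).trans (ψ.src f).symm)
  · exact (φ.tgt f).trans ((congrArg (List.map · _) ho).trans (ψ.tgt f).symm)

variable {D} in
theorem omegaHom_naturality {D' : TensorScheme.{u}} (φ : D ⟶ D') :
    (F ⋙ U).map φ ≫ omegaHom D' = omegaHom D ≫ GammaF.map φ := by
  refine gammaF_hom_ext D' rfl fun x => ?_
  refine (forget_fissusOfPrime D' _).trans
    ((Diag.vertex_map (catSig.map (F.map φ)) x.1 x.2).trans ?_)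
  refine Eq.trans ?_ (FDiag.forget_map (schemeSig.map φ) (fissusOfPrime D x)).symm
  exact congrArg (Diag.map (schemeSig.map φ)) (forget_fissusOfPrime D x).symm

/-- The second identification. -/
noncomputable def omega : F.{u} ⋙ U.{u} ≅ GammaF.{u} :=
  NatIso.ofComponents (fun D => asIso (omegaHom D)) omegaHom_naturality

/-- Links the two identifications: turning components into fissus diagrams and dropping their
brackets leaves the inner decorations, which is what `zetaSig` selects. -/
theorem omegaHom_forgetSig :
    (schemeSig.map (omegaHom D) ≫ forgetSig D : schemeSig.obj (U.obj (F.obj D)) ⟶ _) =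
      zetaSig (F.obj D) :=
  Sig.Hom.ext rfl (funext (forget_fissusOfPrime D))

end omega

/-! ## Fine-graining -/

/-- The counit evaluates a diagram of prime diagrams: both sides tensor the letters of a word and
send a corolla to the inner decoration of its vertex. -/
theorem zetaHom_comp_evaluation {V : StrictTensorCat.{u}} (ev : Evaluation V) :
    zetaHom V ≫ ev.toHom = counitHom V := by
  refine diagCat_hom_ext (S := schemeSig.obj (U.obj V)) (fun _ => rfl) fun f a b ha hb h => ?_
  refine (congrArg ev.val (Diag.map_corolla (zetaSig V) f a b ha hb h)).trans ?_
  exact (ev.val_corolla _ _ _ _ _ _).trans (counitHom_corolla f a b ha hb h).symm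

theorem forget_fineGraining (D : TensorScheme.{u}) (ev : Evaluation (F.obj D))
    (x : (GammaF.obj (GammaF.obj D)).Mor) : FDiag.forget ((fineGraining D ev).onMor x) =
      ev.val ((FDiag.forget x).map (forgetSig D)) :=
  FDiag.forget_bracket _ _ _ (dom_val_forget D ev x).symm (cod_val_forget D ev x).symm
    (fun h => FDiag.dom_ne_nil x (List.map_eq_nil_iff.1 h))
    (fun h => FDiag.cod_ne_nil x (List.map_eq_nil_iff.1 h))

/-- By `gammaF_hom_ext` the brackets need no separate check. On objects the counit of `F D`
concatenates words. On a prime diagram the left side evaluates the vertex after `zetaSig`, the right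
side after `omegaHom` and `forgetSig`, and `omegaHom_forgetSig` identifies the two. -/
theorem fineGraining_eq (D : TensorScheme.{u}) (ev : Evaluation (F.obj D)) :
    U.map (counitHom (F.obj D)) ≫ omegaHom D =
      omegaHom (U.obj (F.obj D)) ≫ GammaF.map (omegaHom D) ≫ fineGraining D ev := by
  refine gammaF_hom_ext D (funext fun w => ?_) fun x => ?_
  · refine (counitHom_onOb (V := F.obj D) w).trans ((tensorList_diagCat _ w).trans ?_)
    exact congrArg List.flatten (List.map_id' w).symm
  · refine (forget_fissusOfPrime D _).trans
      ((Diag.vertex_map (catSig.map (counitHom (F.obj D))) x.1 x.2).trans ?_)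
    refine Eq.trans ?_ (forget_fineGraining D ev _).symm
    have h1 : (counitHom (F.obj D)).onMor = fun d => ev.val (Diag.map (zetaSig (F.obj D)) d) :=
      congrArg StrictTensorCat.Hom.onMor (zetaHom_comp_evaluation ev).symm
    refine (congrFun h1 _).trans (congrArg ev.val ?_)
    refine Eq.trans ?_ (congrArg (Diag.map (forgetSig D)) ((FDiag.forget_map _ _).trans
      (congrArg (Diag.map _) (forget_fissusOfPrime _ x)))).symm
    refine Eq.trans ?_ (Diag.map_map (schemeSig.map (omegaHom D)) (forgetSig D) _)
    rw [omegaHom_forgetSig]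
    rfl

end TensorCalculus

/-! ### The theorem. -/

theorem mainTheorem7 :
    ∃ adj : Fp.{u} ⊣ Up.{u},
      -- the unit of the adjunction is the explicit one
      (∀ D, adj.unit.app D = eta D) ∧
      -- first identification
      (∃ ζ : adj.toComonad.toFunctor ≅ GammaTensor.{u}, ∀ V : StrictTensorCat.{u},
        (∀ w, (ζ.hom.app V).onOb w = w) ∧
          ∀ x, (ζ.hom.app V).onMor x = Diag.map (zetaSig V) x) ∧
      -- diagrams in a strict tensor category have a unique evaluation map
      (∀ V : StrictTensorCat.{u}, Nonempty (Unique (Evaluation V))) ∧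
      -- second identification
      ∃ ω : F.{u} ⋙ U.{u} ≅ GammaF.{u},
        (∀ D : TensorScheme.{u}, (∀ w, (ω.hom.app D).onOb w = w) ∧
          ∀ x, (ω.hom.app D).onMor x = fissusOfPrime D x) ∧
        -- the multiplication of the monad is fine-graining
        (∀ (D : IsProper.{u}.FullSubcategory) (ev : Evaluation (F.obj D.obj)),
          (adj.toMonad.μ.app D).hom ≫ ω.hom.app D.obj =
            ω.hom.app (U.obj (F.obj D.obj)) ≫ GammaF.map (ω.hom.app D.obj) ≫
              fineGraining D.obj ev) ∧
        -- the same formula for all tensor schemes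
        (∀ (D : TensorScheme.{u}) (ev : Evaluation (F.obj D)),
          U.map (adj.counit.app (F.obj D)) ≫ ω.hom.app D =
            ω.hom.app (U.obj (F.obj D)) ≫ GammaF.map (ω.hom.app D) ≫ fineGraining D ev) := by
  -- The multiplication at `D` unfolds to `U` of the counit at `F D`, so `fineGraining_eq` settles
  -- both formulas for the multiplication.
  refine ⟨adjunction, fun D => rfl, ⟨zeta, fun V => ⟨zetaHom_onOb V, fun _ => rfl⟩⟩,
    fun V => ⟨⟨⟨Evaluation.canonical V⟩, fun ev => ev.eq _⟩⟩, omega,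
    fun D => ⟨fun _ => rfl, fun _ => rfl⟩, fun D ev => fineGraining_eq D.obj ev,
    fun D ev => fineGraining_eq D ev⟩
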